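/- Identify $\mathbb R^3$ with the quaternions $x=x_0+x_1e_1+x_2e_2$ having no $e_3$-component, and write $\overline{x}=x_0-x_1e_1-x_2e_2$. For an open set $\Omega\subseteq\mathbb R^3$ let $L_2(\Omega)=L_2(\Omega,\mathbb R^3)$ carry the real inner product $\langle f,g\rangle=\int_\Omega(f_0g_0+f_1g_1+f_2g_2)\,dV$. Let $\mathcal H(\Omega)$ be the space of functions $\Omega\to\mathbb R^3$ with three real harmonic components, let $$\mathcal M(\Omega)=\{f\in C^1(\Omega,\mathbb R^3):\ \partial_0f+e_1\partial_1f+e_2\partial_2f=0\}$$ (quaternionic multiplication), and put $\mathcal M_2(\Omega)=\mathcal M(\Omega)\cap L_2(\Omega)$ and $\overline{\mathcal M}_2(\Omega)=\{\overline f: f\in\mathcal M_2(\Omega)\}$. The space $\mathcal N(\Omega)$ of contragenic functions is the orthogonal complement of $\mathcal M_2(\Omega)+\overline{\mathcal M}_2(\Omega)$ in $\mathcal H(\Omega)\cap L_2(\Omega)$. Let $\mathbb B^3$ be the open unit ball. In spherical coordinates $x_0=r\cos\theta$, $x_1=r\sin\theta\cos\varphi$, $x_2=r\sin\theta\sin\varphi$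 put $$\widehat U^n_m=r^nP_n^m(\cos\theta)\cos(m\varphi),\qquad \widehat V^n_m=r^nP_n^m(\cos\theta)\sin(m\varphi)\qquad(0\le m\le n),$$ where $P_n^m(t)=(1-t^2)^{m/2}\frac{d^m}{dt^m}P_n(t)$ and $P_n$ is the Legendre polynomial of degree $n$ (so $\widehat V^n_0=0$). For $n\ge1$ and $1\le m\le n-1$ let $d^n_m=(n-m)(n-m+1)$ and \begin{align*} Z^n_0&=\widehat V^n_1e_1-\widehat U^n_1e_2,\\ Z^n_{m,+}&=(d^n_m\widehat V^n_{m-1}+\widehat V^n_{m+1})e_1+(d^n_m\widehat U^n_{m-1}-\widehat U^n_{m+1})e_2,\\ Z^n_{m,-}&=(d^n_m\widehat U^n_{m-1}+\widehat U^n_{m+1})e_1+(-d^n_m\widehat V^n_{m-1}+\widehat V^n_{m+1})e_2. \end{align*} Then the family $\{Z^n_0,\ Z^n_{m,+},\ Z^n_{m,-}:\ n\ge1,\ 1\le m\le n-1\}$ is an orthogonal basis of $\mathcal N(\mathbb B^3)$: its members are nonzero elements of $\mathcal N(\mathbb B^3)$, they are pairwise orthogonal, and their finite linear combinations are dense in $\mathcal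 N(\mathbb B^3)$ in the $L_2$-norm. Their norms in $L_2(\mathbb B^3)$ are $$\|Z^n_0\|=\sqrt{\frac{4\pi n(n+1)}{(2n+1)(2n+3)}},\qquad \|Z^n_{m,+}\|=\|Z^n_{m,-}\|=\sqrt{\frac{8\pi\,(n^2+m^2+n)\,(n+m-1)!}{(2n+1)(2n+3)\,(n-m-1)!}}\qquad(1\le m\le n-1).$$ -/

import Mathlib

open MeasureTheory
open scoped Quaternion

noncomputable section

namespace Contragenic

/-- The space `ℝ³` with coordinates `(x₀, x₁, x₂)` and its Euclidean norm. -/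
abbrev E3 : Type := EuclideanSpace ℝ (Fin 3)

/-- The embedding `x ↦ x₀ + x₁ e₁ + x₂ e₂` of `ℝ³` in the quaternions. -/
def toQuaternion : E3 →ₗ[ℝ] ℍ[ℝ] where
  toFun x := ⟨x 0, x 1, x 2, 0⟩
  map_add' _ _ := QuaternionAlgebra.ext rfl rfl rfl (add_zero 0).symm
  map_smul' c _ := QuaternionAlgebra.ext rfl rfl rfl (smul_zero c).symm

/-- The quaternion unit `e₁`. -/
def e1 : ℍ[ℝ] := ⟨0, 1, 0, 0⟩

/-- The quaternion unit `e₂`. -/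
def e2 : ℍ[ℝ] := ⟨0, 0, 1, 0⟩

/-- Quaternionic conjugation `x₀ + x₁ e₁ + x₂ e₂ ↦ x₀ - x₁ e₁ - x₂ e₂`, restricted to `ℝ³`. -/
def conjugation : E3 →ₗ[ℝ] E3 where
  toFun x := !₂[x 0, -x 1, -x 2]
  map_add' x y := by ext i; fin_cases i <;> simp <;> ring
  map_smul' c x := by ext i; fin_cases i <;> simp

/-- The partial derivative `∂ⱼ f` at `x`. -/
def partialDeriv (j : Fin 3) (f : E3 → E3) (x : E3) : E3 :=
  fderiv ℝ f x (EuclideanSpace.single j 1)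

/-- The operator `D̄ f = ∂₀ f + e₁ ∂₁ f + e₂ ∂₂ f`, acting from the left. -/
def Dbar (f : E3 → E3) (x : E3) : ℍ[ℝ] :=
  toQuaternion (partialDeriv 0 f x) + e1 * toQuaternion (partialDeriv 1 f x)
    + e2 * toQuaternion (partialDeriv 2 f x)

theorem Dbar_add {f g : E3 → E3} {x : E3} (hf : DifferentiableAt ℝ f x)
    (hg : DifferentiableAt ℝ g x) : Dbar (f + g) x = Dbar f x + Dbar g x := by
  simp only [Dbar, partialDeriv, fderiv_add hf hg, add_apply, map_add, mul_add]
  abel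

theorem Dbar_smul {f : E3 → E3} {x : E3} (c : ℝ) (hf : DifferentiableAt ℝ f x) :
    Dbar (c • f) x = c • Dbar f x := by
  simp only [Dbar, partialDeriv, fderiv_const_smul hf, smul_apply, map_smul, smul_add,
    mul_smul_comm]

/-- `𝓜(Ω)`, for `Ω` open: the `C¹` functions `f : Ω → ℝ³` with `D̄ f = 0` in `Ω`. -/
def monogenic (Ω : Set E3) : Submodule ℝ (E3 → E3) where
  carrier := {f | ∀ x ∈ Ω, ContDiffAt ℝ 1 f x ∧ Dbar f x = 0}
  add_mem' {f g} hf hg x hx := by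
    obtain ⟨hf1, hf2⟩ := hf x hx
    obtain ⟨hg1, hg2⟩ := hg x hx
    refine ⟨hf1.add hg1, ?_⟩
    rw [Dbar_add (hf1.differentiableAt (by simp)) (hg1.differentiableAt (by simp)), hf2, hg2,
      add_zero]
  zero_mem' x _ := by
    refine ⟨contDiffAt_const, ?_⟩
    have h : fderiv ℝ (0 : E3 → E3) x = 0 := fderiv_const_apply (0 : E3)
    simp [Dbar, partialDeriv, h]
  smul_mem' c f hf x hx := by
    obtain ⟨hf1, hf2⟩ := hf x hx
    refine ⟨hf1.const_smul c, ?_⟩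
    rw [Dbar_smul c (hf1.differentiableAt (by simp)), hf2, smul_zero]

/-- The conjugates of the functions in `𝓜(Ω)`. -/
def conjMonogenic (Ω : Set E3) : Submodule ℝ (E3 → E3) :=
  (monogenic Ω).map (conjugation.compLeft E3)

/-- `𝓗(Ω)`, for `Ω` open: the functions `Ω → ℝ³` whose three components are harmonic in `Ω`. -/
def harmonic (Ω : Set E3) : Submodule ℝ (E3 → E3) where
  carrier := {f | ∀ j : Fin 3, InnerProductSpace.HarmonicOnNhd (fun x => f x j) Ω}
  add_mem' hf hg j := (hf j).add (hg j)
  zero_mem' _ := InnerProductSpace.harmonicOnNhd_const 0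
  smul_mem' c _ hf j := (hf j).const_smul (c := c)

/-- `L₂(Ω, ℝ³)`, with inner product `⟨f, g⟩ = ∫_Ω (f₀ g₀ + f₁ g₁ + f₂ g₂) dV`. -/
abbrev L2 (Ω : Set E3) : Type := Lp E3 2 (volume.restrict Ω)

/-- `V ∩ L₂(Ω, ℝ³)`: the elements of `L₂(Ω, ℝ³)` represented by a function in `V`. -/
def interL2 (V : Submodule ℝ (E3 → E3)) (Ω : Set E3) : Submodule ℝ (L2 Ω) where
  carrier := {F | ∃ f ∈ V, F =ᵐ[volume.restrict Ω] f}
  add_mem' := by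
    rintro F G ⟨f, hf, hF⟩ ⟨g, hg, hG⟩
    exact ⟨f + g, V.add_mem hf hg, (Lp.coeFn_add F G).trans (hF.add hG)⟩
  zero_mem' := ⟨0, V.zero_mem, Lp.coeFn_zero _ _ _⟩
  smul_mem' := by
    rintro c F ⟨f, hf, hF⟩
    exact ⟨c • f, V.smul_mem c hf, (Lp.coeFn_smul c F).trans (hF.const_smul c)⟩

/-- The contragenic functions `𝓝(Ω)`: the orthogonal complement of `𝓜₂(Ω) + 𝓜̄₂(Ω)` in
`𝓗(Ω) ∩ L₂(Ω)`. -/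
def contragenic (Ω : Set E3) : Submodule ℝ (L2 Ω) :=
  interL2 (harmonic Ω) Ω ⊓ (interL2 (monogenic Ω) Ω ⊔ interL2 (conjMonogenic Ω) Ω)ᗮ

/-- The Legendre polynomial `Pₙ`, by the formula of Rodrigues. -/
def legendre (n : ℕ) : Polynomial ℝ :=
  Polynomial.C (1 / (2 ^ n * (n.factorial : ℝ))) *
    Polynomial.derivative^[n] ((Polynomial.X ^ 2 - 1) ^ n)

/-- The associated Legendre function `Pₙᵐ(t) = (1 - t²)^{m/2} dᵐPₙ/dtᵐ (t)`, for `|t| ≤ 1`. -/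
def assocLegendre (n m : ℕ) (t : ℝ) : ℝ :=
  Real.sqrt (1 - t ^ 2) ^ m * (Polynomial.derivative^[m] (legendre n)).eval t

/-- The cosine of the polar angle `θ`, where `x₀ = r cos θ` and `r = |x|`. -/
def cosTheta (x : E3) : ℝ := x 0 / ‖x‖

/-- The azimuth `φ`, where `x₁ = r sin θ cos φ` and `x₂ = r sin θ sin φ`. -/
def azimuth (x : E3) : ℝ := Complex.arg ⟨x 1, x 2⟩

/-- The solid spherical harmonic `rⁿ Pₙᵐ(cos θ) cos (m φ)`. -/
def solidU (n m : ℕ) (x : E3) : ℝ :=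
  ‖x‖ ^ n * (assocLegendre n m (cosTheta x) * Real.cos (m * azimuth x))

/-- The solid spherical harmonic `rⁿ Pₙᵐ(cos θ) sin (m φ)`; it vanishes for `m = 0`. -/
def solidV (n m : ℕ) (x : E3) : ℝ :=
  ‖x‖ ^ n * (assocLegendre n m (cosTheta x) * Real.sin (m * azimuth x))

/-- The coefficient `dₘⁿ = (n - m)(n - m + 1)`. -/
def dCoeff (n m : ℕ) : ℝ := ((n : ℝ) - m) * ((n : ℝ) - m + 1)

/-- `Zⁿ₀ = V̂ⁿ₁ e₁ - Ûⁿ₁ e₂`. -/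
def Zzero (n : ℕ) (x : E3) : E3 := !₂[0, solidV n 1 x, -solidU n 1 x]

/-- `Zⁿ_{m,+} = (dₘⁿ V̂ⁿ_{m-1} + V̂ⁿ_{m+1}) e₁ + (dₘⁿ Ûⁿ_{m-1} - Ûⁿ_{m+1}) e₂`, for `m ≥ 1`. -/
def Zplus (n m : ℕ) (x : E3) : E3 :=
  !₂[0, dCoeff n m * solidV n (m - 1) x + solidV n (m + 1) x,
    dCoeff n m * solidU n (m - 1) x - solidU n (m + 1) x]

/-- `Zⁿ_{m,-} = (dₘⁿ Ûⁿ_{m-1} + Ûⁿ_{m+1}) e₁ + (-dₘⁿ V̂ⁿ_{m-1} + V̂ⁿ_{m+1}) e₂`, for `m ≥ 1`. -/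
def Zminus (n m : ℕ) (x : E3) : E3 :=
  !₂[0, dCoeff n m * solidU n (m - 1) x + solidU n (m + 1) x,
    -dCoeff n m * solidV n (m - 1) x + solidV n (m + 1) x]

/-- The index set of the family `Zⁿ₀`, `Zⁿ_{m,+}`, `Zⁿ_{m,-}` with `n ≥ 1` and `1 ≤ m ≤ n - 1`. -/
inductive Index : Type
  | zero (n : ℕ) (hn : 1 ≤ n) : Index
  | plus (n m : ℕ) (hm : 1 ≤ m) (hmn : m + 1 ≤ n) : Index
  | minus (n m : ℕ) (hm : 1 ≤ m) (hmn : m + 1 ≤ n) : Index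

/-- The family of all `Zⁿ₀`, `Zⁿ_{m,+}` and `Zⁿ_{m,-}`. -/
def Z : Index → E3 → E3
  | .zero n _ => Zzero n
  | .plus n m _ _ => Zplus n m
  | .minus n m _ _ => Zminus n m

/-- An orthogonal basis of a subspace `N` of a Hilbert space: a family of nonzero, pairwise
orthogonal elements of `N` whose finite linear combinations are dense in `N`. -/
structure IsOrthogonalBasis {ι H : Type*} [NormedAddCommGroup H] [InnerProductSpace ℝ H]
    (v : ι → H) (N : Submodule ℝ H) : Prop where
  mem : ∀ i, v i ∈ N
  ne_zero : ∀ i, v i ≠ 0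
  orthogonal : ∀ i j, i ≠ j → inner ℝ (v i) (v j) = 0
  dense : N ≤ (Submodule.span ℝ (Set.range v)).topologicalClosure

/-- The open unit ball of `ℝ³`. -/
abbrev unitBall : Set E3 := Metric.ball 0 1

end Contragenic

end

noncomputable section

namespace Contragenic

open scoped ComplexConjugate

/-! Write `W n k` for `solidHarmonic n k` and `C n k = ∫ (F₁ + i F₂) W n k` for the moments of a
field `F` on the ball. Since the ball is convex, a monogenic function is the conjugate of the
gradient of a harmonic function (`exists_potential`). A gradient and its conjugate differ only in
the sign of the last two components, so orthogonality to both kinds splits into a condition on `F₀`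
and one on `(F₁, F₂)`. Tested on the gradients of `W (n+1) j`, it says that the moments of `F₀`
vanish and that `C n (j-1) = (-1)^(j+1) conj (C n (-j-1))` (`coeff_of_mem_orthogonal`,
`coeffD_eq_conj`).

This relation pairs the order `k` with `-k-2`. Moments with `|k| > n` vanish, hence so do those with
`k > n-2`. What remains is one complex number for each `0 ≤ k ≤ n-2`, and at the fixed point `k =
-1` a purely imaginary number. These are `2n-1` real parameters, as many as there are fields `Z` of
degree `n`, and the inner product with each `Z` reads off exactly one of them (`inner_Z`). Applied
to `F = Z`, this gives orthogonality and norms; applied to an `F` orthogonal to the family, it makes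
all moments vanish (`coeffC_eq_zero`).

Two analytic facts pass from polynomials to all of `L₂`. First, `Z` is orthogonal to every
square-integrable monogenic function: with a radial cutoff `χ`, integration by parts moves the
derivative onto `χ Z`. The divergence of `χ Z` is supported in a smaller ball and orthogonal to
every `W`, hence to every harmonic function, because combinations of the `W` approximate harmonic
functions uniformly on smaller balls (Stone-Weierstrass on the sphere and the maximum principle;
`integral_mul_harmonic_eq_zero`). Second, a harmonic function with vanishing moments is zero
(`IsWeaklyHarmonic.ae_eq_zero`). This is proved for a weaker notion of harmonicity that is visibly
closed in `L₂`, so that an orthogonal projection onto the closed span of the family can be used.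

All explicit integrals come from the algebraic recurrences of the `W` and from radial moments
(`integral_mul_of_le`). -/

/-- The complex coordinate `x₁ + i x₂`. -/
def zeta : E3 →L[ℝ] ℂ :=
  (EuclideanSpace.proj 1 : E3 →L[ℝ] ℝ).smulRight (1 : ℂ) +
    (EuclideanSpace.proj 2 : E3 →L[ℝ] ℝ).smulRight Complex.I

/-- The coordinate `x₀` as a complex number. -/
def axial : E3 →L[ℝ] ℂ := (EuclideanSpace.proj 0 : E3 →L[ℝ] ℝ).smulRight (1 : ℂ)

theorem zeta_apply (x : E3) : zeta x = x 1 + x 2 * Complex.I := by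
  simp [zeta]

theorem axial_apply (x : E3) : axial x = x 0 := by
  simp [axial]

theorem conj_axial (x : E3) : conj (axial x) = axial x := by
  simp [axial_apply]

theorem norm_sq_eq (x : E3) : ((‖x‖ ^ 2 : ℝ) : ℂ) = axial x ^ 2 + zeta x * conj (zeta x) := by
  rw [EuclideanSpace.norm_sq_eq, Fin.sum_univ_three, zeta_apply, axial_apply]
  apply Complex.ext <;> simp [pow_two] <;> ring

/-! ### Solid spherical harmonics and their recurrences -/

/-- The solid spherical harmonics, with the normalization
`solidHarmonic n m = rⁿ Pₙᵐ(cos θ) e^{imφ} / (n + m)!`: the coefficient of `tᵐ` in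
`(x₀ + ζ t / 2 - ζ̄ t⁻¹ / 2)ⁿ / n!`. -/
def solidHarmonic : ℕ → ℤ → E3 → ℂ
  | 0, m, _ => if m = 0 then 1 else 0
  | n + 1, m, x => (axial x * solidHarmonic n m x + zeta x / 2 * solidHarmonic n (m - 1) x
      - conj (zeta x) / 2 * solidHarmonic n (m + 1) x) / (n + 1)

/-- The solid spherical harmonics of degree `n - 1`, which are `0` for `n = 0`. -/
def solidHarmonicPred : ℕ → ℤ → E3 → ℂ
  | 0, _, _ => 0
  | n + 1, m, x => solidHarmonic n m x

@[simp] theorem solidHarmonicPred_zero (m : ℤ) (x : E3) : solidHarmonicPred 0 m x = 0 := rfl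

@[simp] theorem solidHarmonicPred_succ (n : ℕ) (m : ℤ) (x : E3) :
    solidHarmonicPred (n + 1) m x = solidHarmonic n m x := rfl

theorem solidHarmonic_zero (m : ℤ) (x : E3) :
    solidHarmonic 0 m x = if m = 0 then 1 else 0 := rfl

theorem solidHarmonic_succ (n : ℕ) (m : ℤ) (x : E3) :
    (n + 1) * solidHarmonic (n + 1) m x =
      axial x * solidHarmonic n m x + zeta x / 2 * solidHarmonic n (m - 1) x
        - conj (zeta x) / 2 * solidHarmonic n (m + 1) x := by
  rw [solidHarmonic]
  field_simp [Nat.cast_add_one_ne_zero n]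

/-- Euler's identity. With `L = x₀ + ζ t / 2 - ζ̄ t⁻¹ / 2`, it is the coefficient of `tᵐ` in `n Lⁿ /
n! = L · Lⁿ⁻¹ / (n-1)!`. -/
theorem solidHarmonic_euler (n : ℕ) (m : ℤ) (x : E3) :
    n * solidHarmonic n m x =
      axial x * solidHarmonicPred n m x + zeta x / 2 * solidHarmonicPred n (m - 1) x
        - conj (zeta x) / 2 * solidHarmonicPred n (m + 1) x := by
  cases n with
  | zero => simp
  | succ n => simpa using solidHarmonic_succ n m x

/-- This is the operator `t d/dt` applied to the generating function `Lⁿ / n!`, since `t dL/dt = ζ t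
/ 2 + ζ̄ t⁻¹ / 2`. -/
theorem solidHarmonic_angular (n : ℕ) (m : ℤ) (x : E3) :
    m * solidHarmonic n m x =
      zeta x / 2 * solidHarmonicPred n (m - 1) x
        + conj (zeta x) / 2 * solidHarmonicPred n (m + 1) x := by
  induction n generalizing m with
  | zero => by_cases h : m = 0 <;> simp [solidHarmonic_zero, h]
  | succ n ih =>
    have hn : (n + 1 : ℂ) ≠ 0 := Nat.cast_add_one_ne_zero n
    apply mul_left_cancel₀ hn
    have e1 := solidHarmonic_succ n m x
    have e2 := solidHarmonic_euler n (m - 1) x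
    have e3 := solidHarmonic_euler n (m + 1) x
    have i1 := ih m
    have i2 := ih (m - 1)
    have i3 := ih (m + 1)
    simp only [sub_add_cancel, add_sub_cancel_right, solidHarmonicPred_succ] at *
    push_cast at *
    linear_combination m * e1 + axial x * i1 + zeta x / 2 * i2 - conj (zeta x) / 2 * i3
      - zeta x / 2 * e2 - conj (zeta x) / 2 * e3

theorem solidHarmonic_raise (n : ℕ) (m : ℤ) (x : E3) :
    (n + m) * solidHarmonic n m x =
      axial x * solidHarmonicPred n m x + zeta x * solidHarmonicPred n (m - 1) x := by
  linear_combination solidHarmonic_euler n m x + solidHarmonic_angular n m x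

theorem solidHarmonic_lower (n : ℕ) (m : ℤ) (x : E3) :
    (n - m) * solidHarmonic n m x =
      axial x * solidHarmonicPred n m x - conj (zeta x) * solidHarmonicPred n (m + 1) x := by
  linear_combination solidHarmonic_euler n m x - solidHarmonic_angular n m x

/-- Elimination between the raising and lowering relations in two consecutive degrees; `|x|² = x₀² +
ζ ζ̄` produces the last term. This relation and the next two split a coordinate times a harmonic
polynomial into a harmonic part and `|x|²` times a harmonic part. They serve twice: on a sphere
`|x|²` is constant, and in inner products they move a coordinate from one factor to the other. -/
theorem axial_mul_solidHarmonic (n : ℕ) (m : ℤ) (x : E3) :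
    (2 * n + 1) * (axial x * solidHarmonic n m x) =
      ((n + 1) ^ 2 - m ^ 2) * solidHarmonic (n + 1) m x
        + (‖x‖ ^ 2 : ℝ) * solidHarmonicPred n m x := by
  have h1 := solidHarmonic_raise (n + 1) m x
  have h2 := solidHarmonic_lower n (m - 1) x
  have h3 := solidHarmonic_raise n m x
  rw [norm_sq_eq]
  simp only [sub_add_cancel, solidHarmonicPred_succ] at *
  push_cast at *
  linear_combination -(n + 1 - m) * h1 - zeta x * h2 + axial x * h3

theorem zeta_mul_solidHarmonic (n : ℕ) (m : ℤ) (x : E3) :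
    (2 * n + 1) * (zeta x * solidHarmonic n m x) =
      (n + m + 2) * (n + m + 1) * solidHarmonic (n + 1) (m + 1) x
        - (‖x‖ ^ 2 : ℝ) * solidHarmonicPred n (m + 1) x := by
  have h1 := solidHarmonic_raise (n + 1) (m + 1) x
  have h2 := solidHarmonic_raise n (m + 1) x
  have h3 := solidHarmonic_lower n m x
  rw [norm_sq_eq]
  simp only [add_sub_cancel_right, solidHarmonicPred_succ] at *
  push_cast at *
  linear_combination -(n + m + 1) * h1 - axial x * h2 + zeta x * h3

theorem conj_zeta_mul_solidHarmonic (n : ℕ) (m : ℤ) (x : E3) :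
    (2 * n + 1) * (conj (zeta x) * solidHarmonic n m x) =
      -((n - m + 2) * (n - m + 1) * solidHarmonic (n + 1) (m - 1) x)
        + (‖x‖ ^ 2 : ℝ) * solidHarmonicPred n (m - 1) x := by
  have h1 := solidHarmonic_lower (n + 1) (m - 1) x
  have h2 := solidHarmonic_lower n (m - 1) x
  have h3 := solidHarmonic_raise n m x
  rw [norm_sq_eq]
  simp only [sub_add_cancel, solidHarmonicPred_succ] at *
  push_cast at *
  linear_combination (n - m + 1) * h1 + axial x * h2 + conj (zeta x) * h3

theorem solidHarmonic_eq_zero (n : ℕ) {m : ℤ} (h : n < m.natAbs) (x : E3) :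
    solidHarmonic n m x = 0 := by
  induction n generalizing m with
  | zero => rw [solidHarmonic_zero, if_neg (by omega)]
  | succ n ih =>
    rw [solidHarmonic, ih (by omega), ih (by omega), ih (by omega)]
    simp

theorem neg_one_zpow_succ (m : ℤ) : (-1 : ℂ) ^ (m + 1) = -(-1) ^ m := by
  rw [zpow_add₀ (by norm_num)]; simp

theorem neg_one_zpow_pred (m : ℤ) : (-1 : ℂ) ^ (m - 1) = -(-1) ^ m := by
  rw [zpow_sub₀ (by norm_num)]; simp [div_neg]

theorem conj_solidHarmonic (n : ℕ) (m : ℤ) (x : E3) :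
    conj (solidHarmonic n m x) = (-1) ^ m * solidHarmonic n (-m) x := by
  induction n generalizing m with
  | zero =>
    by_cases h : m = 0 <;> simp [solidHarmonic_zero, h]
  | succ n ih =>
    have e1 : -(m - 1) = -m + 1 := by ring
    have e2 : -(m + 1) = -m - 1 := by ring
    simp only [solidHarmonic, map_div₀, map_sub, map_add, map_mul, ih, conj_axial,
      Complex.conj_conj, map_natCast, map_one, map_ofNat, neg_one_zpow_succ, neg_one_zpow_pred,
      e1, e2]
    ring

theorem solidHarmonic_apply_zero {n : ℕ} (hn : n ≠ 0) (m : ℤ) : solidHarmonic n m 0 = 0 := by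
  obtain ⟨k, rfl⟩ := Nat.exists_eq_succ_of_ne_zero hn
  simp [solidHarmonic]

/-- The derivative of a solid spherical harmonic. -/
def solidHarmonicDeriv (n : ℕ) (m : ℤ) (x : E3) : E3 →L[ℝ] ℂ :=
  solidHarmonicPred n m x • axial + (solidHarmonicPred n (m - 1) x / 2) • zeta
    - (solidHarmonicPred n (m + 1) x / 2) • (Complex.conjCLE : ℂ →L[ℝ] ℂ).comp zeta

theorem solidHarmonicDeriv_apply (n : ℕ) (m : ℤ) (x v : E3) :
    solidHarmonicDeriv n m x v = axial v * solidHarmonicPred n m x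
      + zeta v / 2 * solidHarmonicPred n (m - 1) x
      - conj (zeta v) / 2 * solidHarmonicPred n (m + 1) x := by
  simp [solidHarmonicDeriv]
  ring

/-- Differentiating `Lⁿ / n!` gives `Lⁿ⁻¹ / (n-1)!` times the derivative of the linear form `L`, so
derivatives stay in the family, one degree lower. -/
theorem hasFDerivAt_solidHarmonic (n : ℕ) (m : ℤ) (x : E3) :
    HasFDerivAt (solidHarmonic n m) (solidHarmonicDeriv n m x) x := by
  induction n generalizing m with
  | zero =>
    have : solidHarmonicDeriv 0 m x = 0 := by
      ext v; simp [solidHarmonicDeriv_apply]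
    rw [this]
    exact hasFDerivAt_const _ _
  | succ n ih =>
    have hz : HasFDerivAt (fun y => zeta y) zeta x := zeta.hasFDerivAt
    have hc : HasFDerivAt (fun y => conj (zeta y))
      ((Complex.conjCLE : ℂ →L[ℝ] ℂ).comp zeta) x :=
      ((Complex.conjCLE : ℂ →L[ℝ] ℂ).comp zeta).hasFDerivAt
    have ha : HasFDerivAt (fun y => axial y) axial x := axial.hasFDerivAt
    have H := (((ha.mul (ih m)).add ((hz.mul (ih (m - 1))).mul_const (1 / 2))).sub
      ((hc.mul (ih (m + 1))).mul_const (1 / 2))).mul_const ((n + 1 : ℂ)⁻¹)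
    refine (H.congr_of_eventuallyEq (Filter.Eventually.of_forall fun y => ?_)).congr_fderiv ?_
    · simp only [solidHarmonic, Pi.add_apply, Pi.sub_apply, Pi.mul_apply]
      ring
    · ext v
      have hn : (n + 1 : ℂ) ≠ 0 := Nat.cast_add_one_ne_zero n
      have e0 := solidHarmonic_euler n m x
      have e1 := solidHarmonic_euler n (m - 1) x
      have e2 := solidHarmonic_euler n (m + 1) x
      simp [solidHarmonicDeriv_apply]
      simp only [sub_add_cancel, add_sub_cancel_right] at e1 e2
      field_simp
      linear_combination -(4 * axial v) * e0 - 2 * zeta v * e1 + 2 * conj (zeta v) * e2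

/-! ### Legendre polynomials and the classical form of the solid harmonics -/

section Legendre

open Polynomial

section Legendre


theorem iterate_derivative_X_mul_real (k : ℕ) (p : ℝ[X]) :
    derivative^[k + 1] (X * p) = X * derivative^[k + 1] p + (k + 1 : ℝ[X]) * derivative^[k] p := by
  induction k with
  | zero => simp; ring
  | succ k ih =>
    rw [Function.iterate_succ_apply', ih]
    simp only [derivative_add, derivative_mul, derivative_X, derivative_natCast, derivative_one,
      ← Function.iterate_succ_apply']
    push_cast
    ring

theorem iterate_derivative_X_sq_sub_one_mul_derivative (k : ℕ) (p : ℝ[X]) :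
    derivative^[k + 1] ((X ^ 2 - 1) * derivative p) =
      (X ^ 2 - 1) * derivative^[k + 2] p + 2 * (k + 1 : ℝ[X]) * X * derivative^[k + 1] p
        + (k + 1 : ℝ[X]) * (k : ℝ[X]) * derivative^[k] p := by
  induction k with
  | zero => simp; ring
  | succ k ih =>
    rw [Function.iterate_succ_apply', ih]
    simp only [derivative_add, derivative_sub, derivative_mul, derivative_X, derivative_X_sq,
      derivative_natCast, derivative_one, derivative_ofNat, ← Function.iterate_succ_apply']
    simp only [map_ofNat]
    push_cast
    ring

theorem iterate_derivative_X_sq_sub_one_mul (k : ℕ) (p : ℝ[X]) :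
    derivative^[k + 2] ((X ^ 2 - 1) * p) =
      (X ^ 2 - 1) * derivative^[k + 2] p + 2 * (k + 2 : ℝ[X]) * X * derivative^[k + 1] p
        + (k + 2 : ℝ[X]) * (k + 1 : ℝ[X]) * derivative^[k] p := by
  induction k with
  | zero => simp; ring
  | succ k ih =>
    rw [Function.iterate_succ_apply', ih]
    simp only [derivative_add, derivative_sub, derivative_mul, derivative_X, derivative_X_sq,
      derivative_natCast, derivative_one, derivative_ofNat, ← Function.iterate_succ_apply']
    simp only [map_ofNat]
    push_cast
    ring

theorem derivative_X_sq_sub_one_pow (n : ℕ) :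
    derivative ((X ^ 2 - 1 : ℝ[X]) ^ (n + 1)) = 2 * (n + 1 : ℝ[X]) * (X * (X ^ 2 - 1) ^ n) := by
  rw [derivative_pow_succ]
  simp
  ring

theorem iterate_derivative_X_sq_sub_one_pow_succ (n : ℕ) :
    derivative^[n + 1] ((X ^ 2 - 1 : ℝ[X]) ^ (n + 1)) =
      2 * ((n + 1 : ℝ[X]) * X * derivative^[n] ((X ^ 2 - 1) ^ n)
        + (X ^ 2 - 1) * derivative^[n + 1] ((X ^ 2 - 1) ^ n)) := by
  cases n with
  | zero => simp; norm_num
  | succ k =>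
    have h1 := iterate_derivative_X_sq_sub_one_mul k ((X ^ 2 - 1) ^ (k + 1))
    have h2 : derivative^[k + 2] ((X ^ 2 - 1 : ℝ[X]) ^ (k + 2)) =
        2 * (k + 2 : ℝ[X]) * (X * derivative^[k + 1] ((X ^ 2 - 1) ^ (k + 1))
          + (k + 1 : ℝ[X]) * derivative^[k] ((X ^ 2 - 1) ^ (k + 1))) := by
      rw [Function.iterate_succ_apply, derivative_X_sq_sub_one_pow]
      have : (2 * (((k + 1 : ℕ) : ℝ[X]) + 1) * (X * (X ^ 2 - 1) ^ (k + 1))) =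
          ((2 * (k + 2) : ℕ) : ℝ[X]) * (X * (X ^ 2 - 1) ^ (k + 1)) := by
        push_cast; ring
      rw [this, iterate_derivative_natCast_mul, iterate_derivative_X_mul_real]
      push_cast
      ring
    rw [← pow_succ'] at h1
    push_cast
    linear_combination 2 * h1 - h2

theorem legendre_succ (n : ℕ) :
    (n + 1 : ℝ[X]) * legendre (n + 1) =
      (n + 1 : ℝ[X]) * (X * legendre n) + (X ^ 2 - 1) * derivative (legendre n) := by
  have hn : (n + 1 : ℝ) ≠ 0 := Nat.cast_add_one_ne_zero n
  have hc : (n + 1 : ℝ[X]) * C (1 / (2 ^ (n + 1) * ((n + 1).factorial : ℝ))) * 2 =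
      C (1 / (2 ^ n * (n.factorial : ℝ))) := by
    have : (n + 1 : ℝ[X]) = C (n + 1 : ℝ) := by simp
    rw [this, show (2 : ℝ[X]) = C 2 from rfl, ← C_mul, ← C_mul]
    congr 1
    have := Nat.factorial_ne_zero n
    rw [Nat.factorial_succ]
    push_cast
    field_simp
    ring
  simp only [legendre, iterate_derivative_X_sq_sub_one_pow_succ, derivative_C_mul,
    ← Function.iterate_succ_apply']
  linear_combination ((n + 1 : ℝ[X]) * X * derivative^[n] ((X ^ 2 - 1) ^ n)
        + (X ^ 2 - 1) * derivative^[n + 1] ((X ^ 2 - 1) ^ n)) * hc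

/-- The polynomial `p = (X² - 1)ⁿ` satisfies `(X² - 1) p' = 2 n X p`; differentiating this `k + n +
1` times gives the equation. -/
theorem legendre_ode (n k : ℕ) :
    (X ^ 2 - 1) * derivative^[k + 2] (legendre n) + 2 * (k + 1 : ℝ[X]) * X * derivative^[k + 1] (legendre n)
      + ((k : ℝ[X]) * (k + 1 : ℝ[X]) - (n : ℝ[X]) * (n + 1 : ℝ[X])) * derivative^[k] (legendre n) = 0 := by
  have h : (X ^ 2 - 1) * derivative ((X ^ 2 - 1 : ℝ[X]) ^ n) =
      ((2 * n : ℕ) : ℝ[X]) * (X * (X ^ 2 - 1) ^ n) := by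
    cases n with
    | zero => simp
    | succ n => rw [derivative_X_sq_sub_one_pow]; push_cast; ring
  have h2 := congrArg (derivative^[k + n + 1]) h
  rw [iterate_derivative_X_sq_sub_one_mul_derivative, iterate_derivative_natCast_mul,
    iterate_derivative_X_mul_real] at h2
  simp only [legendre, iterate_derivative_C_mul, ← Function.iterate_add_apply]
  rw [show k + 2 + n = k + n + 2 by ring, show k + 1 + n = k + n + 1 by ring]
  push_cast at h2
  linear_combination C (1 / (2 ^ n * (n.factorial : ℝ))) * h2

/-- The differentiated recurrence, corrected by the differential equation so that its three terms
match those of `solidHarmonic_succ` for the order `m = k + 1`: orders `m`, `m - 1` and `m + 1`. -/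
theorem legendre_derivative_succ (n k : ℕ) :
    2 * (n + 1 : ℝ[X]) * derivative^[k + 1] (legendre (n + 1)) =
      2 * (n + k + 2 : ℝ[X]) * X * derivative^[k + 1] (legendre n)
        + (n + k + 2 : ℝ[X]) * (n + k + 1 : ℝ[X]) * derivative^[k] (legendre n)
        + (X ^ 2 - 1) * derivative^[k + 2] (legendre n) := by
  have h := congrArg (derivative^[k + 1]) (legendre_succ n)
  have hn : (n + 1 : ℝ[X]) = ((n + 1 : ℕ) : ℝ[X]) := by push_cast; ring
  rw [hn, iterate_map_add, iterate_derivative_natCast_mul, iterate_derivative_natCast_mul,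
    iterate_derivative_X_sq_sub_one_mul_derivative, iterate_derivative_X_mul_real] at h
  push_cast at h
  linear_combination 2 * h + legendre_ode n k

theorem legendre_zero : legendre 0 = 1 := by
  simp [legendre]

end Legendre

theorem spherical_coordinates {x : E3} (hx : x ≠ 0) :
    x 0 = ‖x‖ * cosTheta x ∧ cosTheta x ^ 2 ≤ 1 ∧
      zeta x = ‖x‖ * Real.sqrt (1 - cosTheta x ^ 2)
        * (Complex.cos (azimuth x) + Complex.sin (azimuth x) * Complex.I) := by
  have hr : 0 < ‖x‖ := norm_pos_iff.2 hx
  have h0 : x 0 = ‖x‖ * cosTheta x := by rw [cosTheta]; field_simp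
  have hz : zeta x = ⟨x 1, x 2⟩ := by
    rw [zeta_apply]; apply Complex.ext <;> simp
  have hn : ‖zeta x‖ ^ 2 = ‖x‖ ^ 2 * (1 - cosTheta x ^ 2) := by
    rw [hz, ← Complex.normSq_eq_norm_sq, Complex.normSq_mk]
    have := EuclideanSpace.norm_sq_eq x
    simp only [Fin.sum_univ_three, Real.norm_eq_abs, sq_abs] at this
    rw [h0] at this
    linear_combination -this
  have ht : cosTheta x ^ 2 ≤ 1 := by
    have h2 : 0 ≤ ‖x‖ ^ 2 * (1 - cosTheta x ^ 2) := hn ▸ sq_nonneg _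
    have := nonneg_of_mul_nonneg_right h2 (by positivity)
    linarith
  refine ⟨h0, ht, ?_⟩
  have h3 : ‖zeta x‖ = ‖x‖ * Real.sqrt (1 - cosTheta x ^ 2) := by
    rw [← Real.sqrt_sq (norm_nonneg (zeta x)), hn, Real.sqrt_mul (sq_nonneg _),
      Real.sqrt_sq hr.le]
  have h4 := Complex.norm_mul_cos_add_sin_mul_I (zeta x)
  rw [h3] at h4
  rw [← h4, azimuth, ← hz]
  push_cast
  rfl

/-- The functions `rⁿ Pₙᵐ(cos θ) e^{imφ}` in terms of the solid spherical harmonics. -/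
theorem solidHarmonic_eq_legendre (n m : ℕ) {r t s : ℝ} {e : ℂ} (x : E3)
    (h0 : x 0 = r * t) (hs : s ^ 2 = 1 - t ^ 2) (he : e * conj e = 1) (hz : zeta x = r * s * e) :
    ((n + m).factorial : ℂ) * solidHarmonic n m x =
      r ^ n * (s ^ m * ((Polynomial.derivative^[m] (legendre n)).eval t : ℝ)) * e ^ m := by
  have hcz : conj (zeta x) = r * s * conj e := by rw [hz]; simp
  have hax : axial x = r * t := by rw [axial_apply, h0]; push_cast; rfl
  have hsc : (s : ℂ) ^ 2 = 1 - t ^ 2 := by exact_mod_cast hs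
  induction n generalizing m with
  | zero =>
    cases m with
    | zero => simp [solidHarmonic_zero, legendre_zero]
    | succ m =>
      rw [solidHarmonic_zero, if_neg (by omega), legendre_zero,
        Polynomial.iterate_derivative_one (by omega)]
      simp
  | succ n ih =>
    have hn : (n + 1 : ℂ) ≠ 0 := Nat.cast_add_one_ne_zero n
    apply mul_left_cancel₀ hn
    cases m with
    | zero =>
      have h := congrArg (Polynomial.eval t) (legendre_succ n)
      simp only [Polynomial.eval_add, Polynomial.eval_mul, Polynomial.eval_natCast,
        Polynomial.eval_one, Polynomial.eval_X, Polynomial.eval_sub, Polynomial.eval_pow] at h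
      have hC := congrArg (Complex.ofReal) h
      push_cast at hC
      have i0 := ih 0
      have i1 := ih 1
      have i1' := congrArg conj i1
      have hs' := solidHarmonic_succ n 0 x
      -- For order `0` the recurrence involves the order `-1`, outside the range of the induction
      -- hypothesis; it is the conjugate of order `1` up to sign.
      have hm : solidHarmonic n (0 - 1) x = - conj (solidHarmonic n 1 x) := by
        rw [conj_solidHarmonic]; simp
      rw [hm, hax, hz, map_mul, map_mul, Complex.conj_ofReal, Complex.conj_ofReal] at hs'
      simp only [Function.iterate_zero, Function.iterate_one, id, map_mul, map_pow,
        Complex.conj_ofReal, map_natCast, Nat.factorial_succ, Nat.cast_mul, Nat.cast_add,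
        Nat.cast_one, Nat.cast_zero, map_add, map_one, add_zero, pow_zero, zero_add, pow_one, mul_one] at *
      linear_combination (n + 1) * n.factorial * hs' + (n + 1) * r * t * i0
        - r * s * e / 2 * i1' - r * s * conj e / 2 * i1 - r ^ (n + 1) * hC
        - r ^ (n + 1) * ((Polynomial.derivative (legendre n)).eval t : ℝ) * (s ^ 2 * he + hsc)
    | succ k =>
      have h := congrArg (Polynomial.eval t) (legendre_derivative_succ n k)
      simp only [Polynomial.eval_add, Polynomial.eval_mul, Polynomial.eval_natCast,
        Polynomial.eval_one, Polynomial.eval_X, Polynomial.eval_sub, Polynomial.eval_pow,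
        Polynomial.eval_ofNat] at h
      have hC := congrArg (Complex.ofReal) h
      push_cast at hC
      have i0 := ih k
      have i1 := ih (k + 1)
      have i2 := ih (k + 2)
      have hs' := solidHarmonic_succ n (k + 1) x
      rw [hax, hz, map_mul, map_mul, Complex.conj_ofReal, Complex.conj_ofReal] at hs'
      have e1 : ((k : ℤ) + 1 - 1) = k := by ring
      have e2 : ((k : ℤ) + 1 + 1) = k + 2 := by ring
      rw [e1, e2] at hs'
      rw [show n + 1 + (k + 1) = n + k + 1 + 1 by ring]
      rw [show n + (k + 1) = n + k + 1 by ring] at i1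
      rw [show n + (k + 2) = n + k + 1 + 1 by ring] at i2
      simp only [Nat.factorial_succ, Nat.cast_mul, Nat.cast_add, Nat.cast_one,
        Nat.cast_ofNat] at *
      linear_combination (n + k + 2) * (n + k + 1) * ((n + k).factorial : ℂ) * hs'
        + (n + k + 2) * r * t * i1 + (n + k + 2) * (n + k + 1) * r * s * e / 2 * i0
        - r * s * conj e / 2 * i2 - r ^ (n + 1) * s ^ (k + 1) * e ^ (k + 1) / 2 * hC
        - r ^ (n + 1) * s ^ (k + 1) * e ^ (k + 1) / 2
          * ((Polynomial.derivative^[k + 2] (legendre n)).eval t : ℝ) * (s ^ 2 * he + hsc)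

theorem solid_eq_solidHarmonic {n : ℕ} (hn : n ≠ 0) (m : ℕ) (x : E3) :
    (solidU n m x + solidV n m x * Complex.I : ℂ) =
      ((n + m).factorial : ℂ) * solidHarmonic n m x := by
  by_cases hx : x = 0
  -- At the origin the angles take default values, but `‖x‖ ^ n` is zero because `n ≠ 0`.
  · simp [hx, solidU, solidV, hn, solidHarmonic_apply_zero hn]
  obtain ⟨h0, ht, hz⟩ := spherical_coordinates hx
  rw [solidHarmonic_eq_legendre n m x h0 (Real.sq_sqrt (sub_nonneg.2 ht)) ?_ hz]
  · rw [Complex.cos_add_sin_mul_I_pow, solidU, solidV, assocLegendre]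
    push_cast
    ring
  · simp only [map_add, map_mul, ← Complex.cos_conj, ← Complex.sin_conj, Complex.conj_ofReal,
      Complex.conj_I]
    linear_combination Complex.cos_sq_add_sin_sq (azimuth x)
      - Complex.sin (azimuth x) ^ 2 * Complex.I_sq

end Legendre

/-! ### Harmonicity of the solid harmonics and their linear span -/

section Harmonic

open InnerProductSpace Laplacian Metric

theorem contDiff_solidHarmonic (n : ℕ) (m : ℤ) (k : WithTop ℕ∞) :
    ContDiff ℝ k (solidHarmonic n m) := by
  induction n generalizing m with
  | zero => exact contDiff_const
  | succ n ih =>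
    have hc : ContDiff ℝ k (fun y => conj (zeta y)) :=
      ((Complex.conjCLE : ℂ →L[ℝ] ℂ).comp zeta).contDiff
    have h0 := ih m
    have h1 := ih (m - 1)
    have h2 := ih (m + 1)
    have : solidHarmonic (n + 1) m = fun x => (axial x * solidHarmonic n m x
      + zeta x / 2 * solidHarmonic n (m - 1) x
      - conj (zeta x) / 2 * solidHarmonic n (m + 1) x) / (n + 1) := rfl
    rw [this]
    fun_prop

theorem continuous_solidHarmonic (n : ℕ) (m : ℤ) : Continuous (solidHarmonic n m) :=
  (contDiff_solidHarmonic n m 0).continuous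

theorem fderiv_solidHarmonic (n : ℕ) (m : ℤ) :
    fderiv ℝ (solidHarmonic n m) = solidHarmonicDeriv n m :=
  funext fun x => (hasFDerivAt_solidHarmonic n m x).fderiv

/-- The `i`-th vector of the standard basis of `ℝ³`. -/
def unitVec (i : Fin 3) : E3 := EuclideanSpace.single i 1

theorem laplacian_eq_sum {F : Type*} [NormedAddCommGroup F] [NormedSpace ℝ F] (f : E3 → F)
    (x : E3) : Δ f x = ∑ i, fderiv ℝ (fderiv ℝ f) x (unitVec i) (unitVec i) := by
  rw [laplacian_eq_iteratedFDeriv_orthonormalBasis f (EuclideanSpace.basisFun (Fin 3) ℝ)]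
  simp only [iteratedFDeriv_two_apply, EuclideanSpace.basisFun_apply]
  rfl

theorem axial_unitVec (i : Fin 3) : axial (unitVec i) = if i = 0 then 1 else 0 := by
  fin_cases i <;> simp [axial_apply, unitVec]

theorem zeta_unitVec (i : Fin 3) :
    zeta (unitVec i) = if i = 1 then 1 else if i = 2 then Complex.I else 0 := by
  fin_cases i <;> simp [zeta_apply, unitVec]

/-- The coefficient vector `(1, (t - t⁻¹)/2, i (t + t⁻¹)/2)` of `L` is isotropic, so every power of
`L` is harmonic. -/
theorem laplacian_solidHarmonic (n : ℕ) (m : ℤ) (x : E3) : Δ (solidHarmonic n m) x = 0 := by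
  have h (i : Fin 3) : fderiv ℝ (fderiv ℝ (solidHarmonic n m)) x (unitVec i) (unitVec i) =
      fderiv ℝ (fun y => solidHarmonicDeriv n m y (unitVec i)) x (unitVec i) := by
    rw [← fderiv_solidHarmonic, fderiv_clm_apply (((contDiff_solidHarmonic n m 2).fderiv_right
      (m := 1) (by norm_num)).differentiable (by norm_num) x) (differentiableAt_const _)]
    simp
  simp only [laplacian_eq_sum, h, solidHarmonicDeriv_apply]
  cases n with
  | zero => simp
  | succ n =>
    have h (i : Fin 3) := ((((hasFDerivAt_solidHarmonic n m x).const_mul (axial (unitVec i))).add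
      ((hasFDerivAt_solidHarmonic n (m - 1) x).const_mul (zeta (unitVec i) / 2))).sub
      ((hasFDerivAt_solidHarmonic n (m + 1) x).const_mul (conj (zeta (unitVec i)) / 2))).fderiv
    have h' (i : Fin 3) : fderiv ℝ (fun y => axial (unitVec i) * solidHarmonicPred (n + 1) m y
        + zeta (unitVec i) / 2 * solidHarmonicPred (n + 1) (m - 1) y
        - conj (zeta (unitVec i)) / 2 * solidHarmonicPred (n + 1) (m + 1) y) x = _ := h i
    simp only [h']
    simp only [Fin.sum_univ_three, sub_apply, add_apply, smul_apply,
      solidHarmonicDeriv_apply, axial_unitVec, zeta_unitVec]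
    simp
    linear_combination (1 / 4) * (-solidHarmonicPred n (m - 1 - 1) x - 2 * solidHarmonicPred n m x
      - solidHarmonicPred n (m + 1 + 1) x) * (-Complex.I_sq)

theorem harmonicAt_solidHarmonic (n : ℕ) (m : ℤ) (x : E3) :
    HarmonicAt (solidHarmonic n m) x :=
  ⟨(contDiff_solidHarmonic n m 2).contDiffAt,
    Filter.Eventually.of_forall fun y => laplacian_solidHarmonic n m y⟩

/-- The complex linear span of the solid spherical harmonics. -/
def harmonicSpan : Submodule ℂ (E3 → ℂ) :=
  Submodule.span ℂ (Set.range fun p : ℕ × ℤ => solidHarmonic p.1 p.2)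

theorem solidHarmonic_mem (n : ℕ) (m : ℤ) : solidHarmonic n m ∈ harmonicSpan :=
  Submodule.subset_span ⟨(n, m), rfl⟩

theorem harmonicSpan_induction {P : (E3 → ℂ) → Prop} (hw : ∀ n m, P (solidHarmonic n m))
    (hadd : ∀ p q, P p → P q → P (p + q)) (hsmul : ∀ (c : ℂ) p, P p → P (c • p))
    {p : E3 → ℂ} (hp : p ∈ harmonicSpan) : P p := by
  refine Submodule.span_induction ?_ ?_ (fun p q _ _ => hadd p q) (fun c p _ => hsmul c p) hp
  · rintro _ ⟨⟨n, m⟩, rfl⟩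
    exact hw n m
  · simpa using hsmul 0 _ (hw 0 0)

theorem harmonicAt_of_mem {p : E3 → ℂ} (hp : p ∈ harmonicSpan) (x : E3) : HarmonicAt p x :=
  harmonicSpan_induction (P := fun p => HarmonicAt p x)
    (fun n m => harmonicAt_solidHarmonic n m x) (fun _ _ h1 h2 => h1.add h2)
    (fun c _ h => h.comp_CLM (ContinuousLinearMap.mul ℝ ℂ c)) hp

theorem continuous_of_mem {p : E3 → ℂ} (hp : p ∈ harmonicSpan) : Continuous p :=
  continuous_iff_continuousAt.2 fun x => (harmonicAt_of_mem hp x).1.continuousAt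

theorem conj_mem {p : E3 → ℂ} (hp : p ∈ harmonicSpan) : (fun x => conj (p x)) ∈ harmonicSpan := by
  refine harmonicSpan_induction (P := fun p => (fun x => conj (p x)) ∈ harmonicSpan)
    (fun n m => ?_) (fun p q h1 h2 => ?_) (fun c p h => ?_) hp
  · have : (fun x => conj (solidHarmonic n m x)) = (-1 : ℂ) ^ m • solidHarmonic n (-m) :=
      funext fun x => conj_solidHarmonic n m x
    rw [this]
    exact harmonicSpan.smul_mem _ (solidHarmonic_mem n _)
  · convert harmonicSpan.add_mem h1 h2 using 1
    ext x; simp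
  · convert harmonicSpan.smul_mem (conj c) h using 1
    ext x; simp

/-! ### Maximum principle -/

/-- A function has non-positive second derivatives at a local maximum. -/
theorem fderiv_fderiv_nonpos_of_isLocalMax {v : E3 → ℝ} {y : E3} (h : IsLocalMax v y)
    (hv : ContDiffAt ℝ 2 v y) (e : E3) : fderiv ℝ (fderiv ℝ v) y e e ≤ 0 := by
  by_contra! hpos
  have hl (t : ℝ) : HasDerivAt (fun t : ℝ => y + t • e) e t := by
    simpa using ((hasDerivAt_id t).smul_const e).const_add y
  have hc : Filter.Tendsto (fun t : ℝ => y + t • e) (nhds 0) (nhds y) := by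
    simpa using (hl 0).continuousAt.tendsto
  have hd : ∀ᶠ t in nhds (0 : ℝ), deriv (fun t : ℝ => v (y + t • e)) t =
      fderiv ℝ v (y + t • e) e := by
    have : ∀ᶠ z in nhds y, DifferentiableAt ℝ v z := by
      filter_upwards [hv.eventually (by norm_num)] with z hz
      exact hz.differentiableAt (by norm_num)
    filter_upwards [hc.eventually this] with t ht
    exact (ht.hasFDerivAt.comp_hasDerivAt t (hl t)).deriv
  have hdd : deriv (deriv fun t : ℝ => v (y + t • e)) 0 = fderiv ℝ (fderiv ℝ v) y e e := by
    rw [Filter.EventuallyEq.deriv_eq hd]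
    have h1 : HasFDerivAt (fderiv ℝ v) (fderiv ℝ (fderiv ℝ v) y) y :=
      ((hv.fderiv_right (m := 1) (by norm_num)).differentiableAt (by norm_num)).hasFDerivAt
    have h2 : HasFDerivAt (fun z => fderiv ℝ v z e) ((fderiv ℝ (fderiv ℝ v) y).flip e) y :=
      (h1.clm_apply (hasFDerivAt_const e y)).congr_fderiv (by ext; simp)
    have h3 := h2.comp_hasDerivAt_of_eq (0 : ℝ) (hl 0) (by simp)
    exact h3.deriv
  have hmax : IsLocalMax (fun t : ℝ => v (y + t • e)) 0 := by
    filter_upwards [hc.eventually h] with t ht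
    simpa using ht
  -- With a positive second derivative the point would also be a local minimum along the line. The
  -- function would then be locally constant there, and its second derivative zero.
  have hmin : IsLocalMin (fun t : ℝ => v (y + t • e)) 0 := by
    refine isLocalMin_of_deriv_deriv_pos (by rwa [hdd]) hmax.deriv_eq_zero ?_
    have h1 : ContinuousAt v (y + (0 : ℝ) • e) := by simpa using hv.continuousAt
    exact ContinuousAt.comp (f := fun t : ℝ => y + t • e) h1 (hl 0).continuousAt
  have hconst : (fun t : ℝ => v (y + t • e)) =ᶠ[nhds 0] fun _ => v (y + (0 : ℝ) • e) := by
    filter_upwards [hmax, hmin] with t h1 h2 using le_antisymm h1 h2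
  have : deriv (deriv fun t : ℝ => v (y + t • e)) 0 = 0 := by
    rw [Filter.EventuallyEq.deriv_eq hconst.deriv]
    simp
  rw [hdd] at this
  exact hpos.ne' this

theorem laplacian_norm_sq (x : E3) : Δ (fun y : E3 => ‖y‖ ^ 2) x = 6 := by
  have h : fderiv ℝ (fun y : E3 => ‖y‖ ^ 2) =
      fun y => (2 : ℝ) • (innerSL ℝ : E3 →L[ℝ] E3 →L[ℝ] ℝ) y := by
    ext y v
    rw [fderiv_norm_sq_apply]
    simp
  rw [laplacian_eq_sum, h]
  have h2 : fderiv ℝ (fun y => (2 : ℝ) • (innerSL ℝ : E3 →L[ℝ] E3 →L[ℝ] ℝ) y) x = _ :=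
    ((innerSL ℝ : E3 →L[ℝ] E3 →L[ℝ] ℝ).hasFDerivAt.const_smul (2 : ℝ)).fderiv
  have h3 (i : Fin 3) : ((2 : ℝ) • (innerSL ℝ : E3 →L[ℝ] E3 →L[ℝ] ℝ)) (unitVec i) (unitVec i) = 2 := by
    change (2 : ℝ) * inner ℝ (unitVec i) (unitVec i) = 2
    simp [unitVec]
  simp only [h2, h3]
  norm_num

/-- The maximum principle on balls. -/
theorem le_of_le_on_sphere {u : E3 → ℝ} {ρ M : ℝ} (hc : ContinuousOn u (closedBall 0 ρ))
    (hu : HarmonicOnNhd u (ball 0 ρ)) (hM : ∀ x ∈ sphere (0 : E3) ρ, u x ≤ M) :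
    ∀ x ∈ closedBall (0 : E3) ρ, u x ≤ M := by
  intro x₀ hx₀
  by_contra! hlt
  -- Adding `δ |x|²` makes the Laplacian `6 δ > 0`, which excludes an interior maximum; `δ` is small
  -- enough that the maximum cannot lie on the sphere either.
  obtain ⟨δ, hδ, hδ'⟩ : ∃ δ > 0, δ * ρ ^ 2 < u x₀ - M :=
    ⟨(u x₀ - M) / (2 * (ρ ^ 2 + 1)), by have := sub_pos.2 hlt; positivity, by
      have := sub_pos.2 hlt
      rw [div_mul_eq_mul_div, div_lt_iff₀ (by positivity)]
      nlinarith [sq_nonneg ρ]⟩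
  obtain ⟨y, hy, hmax⟩ := (isCompact_closedBall (0 : E3) ρ).exists_isMaxOn ⟨x₀, hx₀⟩
    (f := u + δ • fun y : E3 => ‖y‖ ^ 2) (hc.add (by fun_prop))
  have h1 := hmax hx₀
  simp only [Set.mem_ofPred_eq, Pi.add_apply, Pi.smul_apply, smul_eq_mul] at h1
  have h0 : 0 ≤ δ * ‖x₀‖ ^ 2 := by positivity
  rw [mem_closedBall_zero_iff] at hy
  rcases hy.eq_or_lt with hy | hy
  · have := hM y (by simpa using hy)
    rw [hy] at h1
    linarith
  · have hyb : y ∈ ball (0 : E3) ρ := by simpa using hy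
    have hloc : IsLocalMax (u + δ • fun y : E3 => ‖y‖ ^ 2) y :=
      (hmax.on_subset ball_subset_closedBall).isLocalMax (isOpen_ball.mem_nhds hyb)
    have hn : ContDiffAt ℝ 2 (fun y : E3 => ‖y‖ ^ 2) y := (contDiff_norm_sq ℝ).contDiffAt
    have hcd : ContDiffAt ℝ 2 (δ • fun y : E3 => ‖y‖ ^ 2) y := hn.const_smul δ
    have hle : Δ (u + δ • fun y : E3 => ‖y‖ ^ 2) y ≤ 0 := by
      rw [laplacian_eq_sum]
      exact Finset.sum_nonpos fun i _ =>
        fderiv_fderiv_nonpos_of_isLocalMax hloc ((hu y hyb).1.add hcd) _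
    have hΔ : Δ u y = 0 := (hu y hyb).2.self_of_nhds
    rw [(hu y hyb).1.laplacian_add hcd, laplacian_smul δ hn, laplacian_norm_sq, hΔ] at hle
    simp only [smul_eq_mul] at hle
    linarith

/-! ### Uniform approximation on spheres and balls -/

/-- Products of a coordinate with a combination of solid spherical harmonics agree on a sphere with
such a combination. -/
theorem exists_mem_eq_mul_on_sphere (ρ : ℝ) {a : E3 → ℂ}
    (ha : ∀ n m, ∃ q ∈ harmonicSpan, ∀ x ∈ sphere (0 : E3) ρ, a x * solidHarmonic n m x = q x)
    {p : E3 → ℂ} (hp : p ∈ harmonicSpan) :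
    ∃ q ∈ harmonicSpan, ∀ x ∈ sphere (0 : E3) ρ, a x * p x = q x := by
  refine harmonicSpan_induction (P := fun p => ∃ q ∈ harmonicSpan,
    ∀ x ∈ sphere (0 : E3) ρ, a x * p x = q x) ha ?_ ?_ hp
  · rintro p q ⟨p', hp', hpe⟩ ⟨q', hq', hqe⟩
    refine ⟨p' + q', harmonicSpan.add_mem hp' hq', fun x hx => ?_⟩
    rw [Pi.add_apply, Pi.add_apply, mul_add, hpe x hx, hqe x hx]
  · rintro c p ⟨p', hp', hpe⟩
    refine ⟨c • p', harmonicSpan.smul_mem c hp', fun x hx => ?_⟩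
    rw [Pi.smul_apply, Pi.smul_apply, mul_smul_comm, hpe x hx]

theorem solidHarmonicPred_mem (n : ℕ) (m : ℤ) : solidHarmonicPred n m ∈ harmonicSpan := by
  cases n with
  | zero => exact harmonicSpan.zero_mem
  | succ n => exact solidHarmonic_mem n m

theorem exists_mem_eq_axial_mul (ρ : ℝ) (n : ℕ) (m : ℤ) : ∃ q ∈ harmonicSpan,
    ∀ x ∈ sphere (0 : E3) ρ, axial x * solidHarmonic n m x = q x := by
  have hn : (2 * n + 1 : ℂ) ≠ 0 := by exact_mod_cast Nat.succ_ne_zero (2 * n)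
  refine ⟨(2 * n + 1 : ℂ)⁻¹ • ((((n + 1) ^ 2 - m ^ 2 : ℂ)) • solidHarmonic (n + 1) m
    + ((ρ ^ 2 : ℝ) : ℂ) • solidHarmonicPred n m), harmonicSpan.smul_mem _ (harmonicSpan.add_mem
    (harmonicSpan.smul_mem _ (solidHarmonic_mem _ _))
    (harmonicSpan.smul_mem _ (solidHarmonicPred_mem _ _))), fun x hx => ?_⟩
  have h := axial_mul_solidHarmonic n m x
  rw [mem_sphere_zero_iff_norm.1 hx] at h
  simp only [Pi.smul_apply, Pi.add_apply, smul_eq_mul, ← h]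
  field_simp

theorem exists_mem_eq_zeta_mul (ρ : ℝ) (n : ℕ) (m : ℤ) : ∃ q ∈ harmonicSpan,
    ∀ x ∈ sphere (0 : E3) ρ, zeta x * solidHarmonic n m x = q x := by
  have hn : (2 * n + 1 : ℂ) ≠ 0 := by exact_mod_cast Nat.succ_ne_zero (2 * n)
  refine ⟨(2 * n + 1 : ℂ)⁻¹ • (((n + m + 2) * (n + m + 1) : ℂ) • solidHarmonic (n + 1) (m + 1)
    - ((ρ ^ 2 : ℝ) : ℂ) • solidHarmonicPred n (m + 1)), harmonicSpan.smul_mem _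
    (harmonicSpan.sub_mem (harmonicSpan.smul_mem _ (solidHarmonic_mem _ _))
    (harmonicSpan.smul_mem _ (solidHarmonicPred_mem _ _))), fun x hx => ?_⟩
  have h := zeta_mul_solidHarmonic n m x
  rw [mem_sphere_zero_iff_norm.1 hx] at h
  simp only [Pi.smul_apply, Pi.sub_apply, smul_eq_mul, ← h]
  field_simp

theorem exists_mem_eq_conj_zeta_mul (ρ : ℝ) (n : ℕ) (m : ℤ) : ∃ q ∈ harmonicSpan,
    ∀ x ∈ sphere (0 : E3) ρ, conj (zeta x) * solidHarmonic n m x = q x := by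
  obtain ⟨q, hq, h⟩ := exists_mem_eq_zeta_mul ρ n (-m)
  refine ⟨_, harmonicSpan.smul_mem ((-1) ^ m) (conj_mem hq), fun x hx => ?_⟩
  have h1 : ((-1 : ℂ) ^ m) * (-1) ^ m = 1 := by
    rw [← mul_zpow]; simp
  rw [Pi.smul_apply, ← h x hx, map_mul, conj_solidHarmonic, neg_neg, zpow_neg, smul_eq_mul,
    ← inv_zpow, inv_neg_one]
  linear_combination (-conj (zeta x) * solidHarmonic n m x) * h1

/-- Combinations of solid spherical harmonics are uniformly dense in the continuous functions on a
sphere. -/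
theorem exists_mem_near_on_sphere (ρ : ℝ) (f : C(sphere (0 : E3) ρ, ℂ)) {ε : ℝ} (hε : 0 < ε) :
    ∃ p ∈ harmonicSpan, ∀ x : sphere (0 : E3) ρ, ‖f x - p x‖ < ε := by
  let V : Set C(sphere (0 : E3) ρ, ℂ) :=
    {f | ∃ p ∈ harmonicSpan, ∀ x ∈ sphere (0 : E3) ρ, ∀ h, f ⟨x, h⟩ = p x}
  let a : C(sphere (0 : E3) ρ, ℂ) := ⟨fun x => axial x, by fun_prop⟩
  let z : C(sphere (0 : E3) ρ, ℂ) := ⟨fun x => zeta x, by fun_prop⟩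
  let A : StarSubalgebra ℂ C(sphere (0 : E3) ρ, ℂ) := StarAlgebra.adjoin ℂ {a, z}
  have hgen {g : E3 → ℂ} {g' : C(sphere (0 : E3) ρ, ℂ)} (hg : ∀ x, g' x = g x)
      (H : ∀ n m, ∃ q ∈ harmonicSpan, ∀ x ∈ sphere (0 : E3) ρ, g x * solidHarmonic n m x = q x)
      {v} (hv : v ∈ V) : g' * v ∈ V := by
    obtain ⟨p, hp, hpv⟩ := hv
    obtain ⟨q, hq, hqe⟩ := exists_mem_eq_mul_on_sphere ρ H hp
    refine ⟨q, hq, fun x hx h => ?_⟩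
    rw [ContinuousMap.mul_apply, hpv x hx, hg, hqe x hx]
  -- The restrictions `V` of the span are shown to be a module over the star algebra generated by
  -- the coordinates; since `1 ∈ V`, they contain that algebra. Carrying `f` and `star f` together
  -- makes the star step of the induction a swap.
  have hA : ∀ f ∈ A, ∀ v ∈ V, f * v ∈ V ∧ star f * v ∈ V := by
    intro f hf
    refine StarAlgebra.adjoin_induction (p := fun f _ => ∀ v ∈ V, f * v ∈ V ∧ star f * v ∈ V)
      ?_ ?_ ?_ ?_ ?_ hf
    · rintro f (rfl | rfl) v hv
      · exact ⟨hgen (g := axial) (fun _ => rfl) (exists_mem_eq_axial_mul ρ) hv,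
          hgen (g := axial) (fun x => conj_axial x) (exists_mem_eq_axial_mul ρ) hv⟩
      · exact ⟨hgen (g := zeta) (fun _ => rfl) (exists_mem_eq_zeta_mul ρ) hv,
          hgen (g := fun x => conj (zeta x)) (fun _ => rfl) (exists_mem_eq_conj_zeta_mul ρ) hv⟩
    · rintro c v ⟨p, hp, hpv⟩
      refine ⟨⟨c • p, harmonicSpan.smul_mem c hp, fun x hx h => ?_⟩,
        ⟨conj c • p, harmonicSpan.smul_mem _ hp, fun x hx h => ?_⟩⟩
      · simp [hpv x hx]
      · simp [hpv x hx]
    · intro f g _ _ hf hg v hv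
      have hadd {f g} (hf : f ∈ V) (hg : g ∈ V) : f + g ∈ V := by
        obtain ⟨p, hp, hpv⟩ := hf
        obtain ⟨q, hq, hqv⟩ := hg
        exact ⟨p + q, harmonicSpan.add_mem hp hq, fun x hx h => by simp [hpv x hx, hqv x hx]⟩
      rw [add_mul, star_add, add_mul]
      exact ⟨hadd (hf v hv).1 (hg v hv).1, hadd (hf v hv).2 (hg v hv).2⟩
    · intro f g _ _ hf hg v hv
      rw [mul_assoc, star_mul, mul_assoc]
      exact ⟨(hf _ (hg v hv).1).1, (hg _ (hf v hv).2).2⟩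
    · intro f _ hf v hv
      rw [star_star]
      exact (hf v hv).symm
  have hdense : A.topologicalClosure = ⊤ := by
    -- Stone-Weierstrass: `x₀` and `ζ` together determine the point.
    refine ContinuousMap.starSubalgebra_topologicalClosure_eq_top_of_separatesPoints A ?_
    intro x y hxy
    by_contra! hall
    have h1 := hall a ⟨a, StarAlgebra.subset_adjoin ℂ _ (by simp), rfl⟩
    have h2 := hall z ⟨z, StarAlgebra.subset_adjoin ℂ _ (by simp), rfl⟩
    refine hxy (Subtype.ext ?_)
    have h1' : axial x = axial y := h1
    have h2' : zeta x = zeta y := h2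
    rw [axial_apply, axial_apply] at h1'
    rw [zeta_apply, zeta_apply] at h2'
    have hre := congrArg Complex.re h2'
    have him := congrArg Complex.im h2'
    simp at hre him
    ext i
    fin_cases i
    · exact_mod_cast h1'
    · exact hre
    · exact him
  have hf : f ∈ closure (A : Set C(sphere (0 : E3) ρ, ℂ)) := by
    rw [← StarSubalgebra.topologicalClosure_coe, hdense]; trivial
  obtain ⟨g, hg, hfg⟩ := Metric.mem_closure_iff.1 hf ε hε
  have h1 : (1 : C(sphere (0 : E3) ρ, ℂ)) ∈ V :=
    ⟨solidHarmonic 0 0, solidHarmonic_mem 0 0, fun x hx h => by simp [solidHarmonic_zero]⟩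
  obtain ⟨p, hp, hpg⟩ := (hA g hg 1 h1).1
  refine ⟨p, hp, fun x => ?_⟩
  rw [← hpg x x.2 x.2, mul_one, ← dist_eq_norm]
  exact (ContinuousMap.dist_apply_le_dist x).trans_lt hfg

/-- Harmonic functions on a ball are uniform limits of combinations of solid spherical
harmonics. -/
theorem exists_mem_near_harmonic {ρ : ℝ} {u : E3 → ℝ} (hc : ContinuousOn u (closedBall 0 ρ))
    (hu : HarmonicOnNhd u (ball 0 ρ)) {ε : ℝ} (hε : 0 < ε) :
    ∃ p ∈ harmonicSpan, ∀ x ∈ closedBall (0 : E3) ρ, ‖(u x : ℂ) - p x‖ ≤ ε := by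
  obtain ⟨p, hp, hpu⟩ := exists_mem_near_on_sphere ρ
    ⟨fun x => (u x : ℂ), Complex.continuous_ofReal.comp
      (hc.mono sphere_subset_closedBall).domRestrict⟩ hε
  -- The real part of `p`, since the maximum principle concerns real functions. It is applied to
  -- both differences of `u` and `Re p`.
  refine ⟨(1 / 2 : ℂ) • (p + fun x => conj (p x)),
    harmonicSpan.smul_mem _ (harmonicSpan.add_mem hp (conj_mem hp)), ?_⟩
  have hre (x : E3) : ((1 / 2 : ℂ) • (p + fun x => conj (p x))) x = ((p x).re : ℂ) := by
    rw [Pi.smul_apply, Pi.add_apply, Complex.add_conj]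
    simp
  have hph (x : E3) : HarmonicAt (fun x => (p x).re) x :=
    (harmonicAt_of_mem hp x).comp_CLM Complex.reCLM
  have hpc : Continuous fun x => (p x).re := Complex.continuous_re.comp (continuous_of_mem hp)
  have hs : ∀ x ∈ sphere (0 : E3) ρ, |u x - (p x).re| ≤ ε := by
    intro x hx
    have h := hpu ⟨x, hx⟩
    refine le_trans ?_ h.le
    have := Complex.abs_re_le_norm ((u x : ℂ) - p x)
    simpa using this
  have h1 := le_of_le_on_sphere (hc.sub hpc.continuousOn) (hu.sub fun x _ => hph x)
    fun x hx => (abs_le.1 (hs x hx)).2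
  have h2 := le_of_le_on_sphere (hpc.continuousOn.sub hc) (HarmonicOnNhd.sub (fun x _ => hph x) hu)
    (M := ε) fun x hx => by
      have := (abs_le.1 (hs x hx)).1
      simp only [Pi.sub_apply] at *
      linarith
  intro x hx
  have h1 := h1 x hx
  have h2 := h2 x hx
  simp only [Pi.sub_apply] at h1 h2
  rw [hre, ← Complex.ofReal_sub, Complex.norm_real, Real.norm_eq_abs, abs_le]
  constructor <;> linarith

/-- An integrable function supported in a smaller ball which is orthogonal to the solid spherical
harmonics is orthogonal to the harmonic functions. -/
theorem integral_mul_harmonic_eq_zero {ρ : ℝ} (hρ : ρ < 1) {g : E3 → ℂ} (hg : Integrable g)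
    (hsupp : ∀ x, x ∉ closedBall (0 : E3) ρ → g x = 0) {u : E3 → ℝ}
    (hu : HarmonicOnNhd u (ball 0 1)) (h : ∀ n m, ∫ x, g x * solidHarmonic n m x = 0) :
    ∫ x, g x * u x = 0 := by
  have hsub : closedBall (0 : E3) ρ ⊆ ball 0 1 := closedBall_subset_ball hρ
  have hmul {q : E3 → ℂ} (hq : ContinuousOn q (closedBall 0 ρ)) :
      Integrable fun x => g x * q x := by
    refine (integrableOn_iff_integrable_of_support_subset fun x hx => ?_).1
      (hg.integrableOn.mul_continuousOn hq (isCompact_closedBall (0 : E3) ρ))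
    by_contra hx'
    exact hx (by simp [hsupp x hx'])
  have hint {q : E3 → ℂ} (hq : Continuous q) := hmul hq.continuousOn
  have hp {p : E3 → ℂ} (hp : p ∈ harmonicSpan) : ∫ x, g x * p x = 0 := by
    refine (harmonicSpan_induction (P := fun p => Integrable (fun x => g x * p x) ∧
      ∫ x, g x * p x = 0) (fun n m => ⟨hint (continuous_solidHarmonic n m), h n m⟩)
      (fun p q h1 h2 => ?_) (fun c p h => ?_) hp).2
    · simp only [Pi.add_apply, mul_add]
      exact ⟨h1.1.add h2.1, by rw [integral_add h1.1 h2.1, h1.2, h2.2, add_zero]⟩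
    · simp only [Pi.smul_apply, mul_smul_comm]
      exact ⟨h.1.smul c, by rw [integral_smul, h.2, smul_zero]⟩
  have huc : ContinuousOn u (closedBall 0 ρ) := hu.continuousOn.mono hsub
  have hgu : Integrable fun x => g x * (u x : ℂ) :=
    hmul (Complex.continuous_ofReal.comp_continuousOn huc)
  have hgi : Integrable fun x => ‖g x‖ := hg.norm
  -- The integral against an approximating combination of solid harmonics is zero, so only the
  -- uniform error `ε` contributes.
  have hle : ∀ ε > 0, ‖∫ x, g x * u x‖ ≤ ε * ∫ x, ‖g x‖ := by
    intro ε hε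
    obtain ⟨p, hpm, hpu⟩ := exists_mem_near_harmonic huc
      (hu.mono (ball_subset_closedBall.trans hsub)) hε
    have hpi := hint (continuous_of_mem hpm)
    rw [← sub_zero (∫ x, g x * u x), ← hp hpm, ← integral_sub hgu hpi, ← integral_const_mul]
    refine norm_integral_le_of_norm_le (hgi.const_mul ε) (Filter.Eventually.of_forall fun x => ?_)
    rw [← mul_sub, norm_mul, mul_comm]
    by_cases hx : x ∈ closedBall (0 : E3) ρ
    · exact mul_le_mul_of_nonneg_right (hpu x hx) (norm_nonneg _)
    · simp [hsupp x hx]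
  have hnn : 0 ≤ ∫ x, ‖g x‖ := integral_nonneg fun x => norm_nonneg _
  by_contra hne
  have hpos := norm_pos_iff.2 hne
  have := hle (‖∫ x, g x * u x‖ / (2 * ((∫ x, ‖g x‖) + 1))) (by positivity)
  rw [div_mul_eq_mul_div, le_div_iff₀ (by positivity)] at this
  nlinarith

end Harmonic

/-! ### Radial weights and orthogonality relations -/

section Basis

open InnerProductSpace Laplacian Metric Filter Topology

/-- The reciprocal of the factorial of an integer, which is `0` for negative integers. -/
def invFactorial (k : ℤ) : ℂ := if 0 ≤ k then (k.toNat.factorial : ℂ)⁻¹ else 0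

theorem invFactorial_natCast (k : ℕ) : invFactorial k = (k.factorial : ℂ)⁻¹ := by
  simp [invFactorial]

theorem invFactorial_of_neg {k : ℤ} (h : k < 0) : invFactorial k = 0 := if_neg (by omega)

/-- Valid for all integers because of the value `0` at negative ones. This lets the orthogonality
relations hold for every order, including `|m| > n`, without cases. -/
theorem invFactorial_sub_one (k : ℤ) : invFactorial (k - 1) = k * invFactorial k := by
  rcases lt_trichotomy k 0 with h | rfl | h
  · rw [invFactorial_of_neg h, invFactorial_of_neg (by omega), mul_zero]
  · simp [invFactorial_of_neg]
  · obtain ⟨l, rfl⟩ : ∃ l : ℕ, k = (l + 1 : ℕ) := ⟨(k - 1).toNat, by omega⟩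
    rw [invFactorial_natCast, show ((l + 1 : ℕ) : ℤ) - 1 = l by push_cast; ring,
      invFactorial_natCast, Nat.factorial_succ]
    have h1 : (l + 1 : ℂ) ≠ 0 := Nat.cast_add_one_ne_zero l
    have h2 : (l.factorial : ℂ) ≠ 0 := by exact_mod_cast l.factorial_ne_zero
    push_cast
    field_simp

/-- The function `f` is integrable with integral `a`. -/
def HasIntegral (μ : Measure E3) (f : E3 → ℂ) (a : ℂ) : Prop := Integrable f μ ∧ ∫ x, f x ∂μ = a

namespace HasIntegral

variable {μ : Measure E3} {f g : E3 → ℂ} {a b : ℂ}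

theorem add (hf : HasIntegral μ f a) (hg : HasIntegral μ g b) :
    HasIntegral μ (fun x => f x + g x) (a + b) :=
  ⟨hf.1.add hg.1, by rw [integral_add hf.1 hg.1, hf.2, hg.2]⟩

theorem sub (hf : HasIntegral μ f a) (hg : HasIntegral μ g b) :
    HasIntegral μ (fun x => f x - g x) (a - b) :=
  ⟨hf.1.sub hg.1, by rw [integral_sub hf.1 hg.1, hf.2, hg.2]⟩

theorem const_mul (hf : HasIntegral μ f a) (c : ℂ) :
    HasIntegral μ (fun x => c * f x) (c * a) :=
  ⟨hf.1.const_mul c, by rw [integral_const_mul, hf.2]⟩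

end HasIntegral

/-- A radial weight: integrable against continuous functions, and orthogonal, together with its
products by even powers of the norm, to the solid spherical harmonics of positive degree. -/
structure IsWeight (ω : E3 → ℝ) : Prop where
  integrable : ∀ g : E3 → ℂ, Continuous g → Integrable fun x => (ω x : ℂ) * g x
  integral_eq_zero : ∀ (a n : ℕ) (m : ℤ),
    ∫ x, (ω x : ℂ) * (((‖x‖ ^ 2 : ℝ) : ℂ) ^ a * solidHarmonic (n + 1) m x) = 0

theorem IsWeight.norm_sq_mul {ω : E3 → ℝ} (hω : IsWeight ω) :
    IsWeight fun x => ω x * ‖x‖ ^ 2 where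
  integrable g hg := by
    have := hω.integrable (fun x => ((‖x‖ ^ 2 : ℝ) : ℂ) * g x)
      ((Complex.continuous_ofReal.comp (by fun_prop)).mul hg)
    refine this.congr (Eventually.of_forall fun x => ?_)
    push_cast
    ring
  integral_eq_zero a n m := by
    rw [← hω.integral_eq_zero (a + 1) n m]
    congr 1
    ext x
    push_cast
    ring

/-- The moment `∫ ω(x) |x|^{2n} dx`. -/
def moment (ω : E3 → ℝ) (n : ℕ) : ℂ := ∫ x, (ω x : ℂ) * ((‖x‖ ^ 2 : ℝ) : ℂ) ^ n

theorem moment_norm_sq_mul (ω : E3 → ℝ) (n : ℕ) :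
    moment (fun x => ω x * ‖x‖ ^ 2) n = moment ω (n + 1) := by
  unfold moment
  congr 1
  ext x
  push_cast
  ring

/-- Induction on the smaller degree. The recurrence writes `W (n+1) m` as coordinates times `W n`,
and the three-term relations absorb those coordinates into `W (l+1) j`. This leaves products of `W
n` with `W (l+2)` for the weight `ω`, and with `W l` for the weight `ω |x|²`; hence the
generalization over `ω`. -/
theorem integral_mul_of_le {ω : E3 → ℝ} (hω : IsWeight ω) {n k : ℕ} (hnk : n ≤ k) (m j : ℤ) :
    ∫ x, (ω x : ℂ) * (solidHarmonic n m x * solidHarmonic k j x) =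
      if n = k ∧ m + j = 0 then
        (-1) ^ m * (invFactorial (n + m) * invFactorial (n - m)) / (2 * n + 1) * moment ω n
      else 0 := by
  induction n generalizing ω k m j with
  | zero =>
    by_cases hm : m = 0
    · subst hm
      cases k with
      | zero =>
        by_cases hj : j = 0
        · simp [hj, solidHarmonic_zero, moment, invFactorial]
        · simp [hj, solidHarmonic_zero]
      | succ k =>
        have := hω.integral_eq_zero 0 k j
        simpa [solidHarmonic_zero] using this
    · rcases lt_or_gt_of_ne hm with h | h
      · simp [solidHarmonic_zero, hm, invFactorial_of_neg h]
      · simp [solidHarmonic_zero, hm, invFactorial_of_neg (neg_neg_of_pos h)]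
  | succ n ih =>
    obtain ⟨l, rfl⟩ : ∃ l, k = l + 1 := ⟨k - 1, by omega⟩
    have hn : (n + 1 : ℂ) ≠ 0 := Nat.cast_add_one_ne_zero n
    have hl : (2 * (l + 1) + 1 : ℂ) ≠ 0 := by exact_mod_cast Nat.succ_ne_zero (2 * (l + 1))
    have hω' := hω.norm_sq_mul
    have I (a b : ℤ) := ih hω (k := l + 2) (by omega) a b
    have J (a b : ℤ) := ih hω' (k := l) (by omega) a b
    -- Here `n + 1 ≤ k` matters: raising the larger degree cannot produce equal degrees, so these
    -- integrals vanish.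
    have hne : n ≠ l + 2 := by omega
    simp only [hne, false_and, if_false] at I
    simp only [moment_norm_sq_mul] at J
    have hI (a b : ℤ) : HasIntegral volume
        (fun x => (ω x : ℂ) * (solidHarmonic n a x * solidHarmonic (l + 2) b x)) _ :=
      ⟨hω.integrable _ ((continuous_solidHarmonic _ _).mul (continuous_solidHarmonic _ _)), I a b⟩
    have hJ (a b : ℤ) : HasIntegral volume
        (fun x => ((ω x * ‖x‖ ^ 2 : ℝ) : ℂ) * (solidHarmonic n a x * solidHarmonic l b x)) _ :=
      ⟨hω'.integrable _ ((continuous_solidHarmonic _ _).mul (continuous_solidHarmonic _ _)), J a b⟩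
    have hpt (x : E3) : ((n + 1) * (2 * (l + 1) + 1) : ℂ) *
        ((ω x : ℂ) * (solidHarmonic (n + 1) m x * solidHarmonic (l + 1) j x)) =
        (((l + 2) ^ 2 - j ^ 2 : ℂ) * ((ω x : ℂ) * (solidHarmonic n m x * solidHarmonic (l + 2) j x))
        + ((l + j + 3) * (l + j + 2) / 2 : ℂ) *
          ((ω x : ℂ) * (solidHarmonic n (m - 1) x * solidHarmonic (l + 2) (j + 1) x))
        + ((l - j + 3) * (l - j + 2) / 2 : ℂ) *
          ((ω x : ℂ) * (solidHarmonic n (m + 1) x * solidHarmonic (l + 2) (j - 1) x)))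
        + (((ω x * ‖x‖ ^ 2 : ℝ) : ℂ) * (solidHarmonic n m x * solidHarmonic l j x)
        - (1 / 2 : ℂ) * (((ω x * ‖x‖ ^ 2 : ℝ) : ℂ) *
          (solidHarmonic n (m - 1) x * solidHarmonic l (j + 1) x))
        - (1 / 2 : ℂ) * (((ω x * ‖x‖ ^ 2 : ℝ) : ℂ) *
          (solidHarmonic n (m + 1) x * solidHarmonic l (j - 1) x))) := by
      have h0 := solidHarmonic_succ n m x
      have h1 := axial_mul_solidHarmonic (l + 1) j x
      have h2 := zeta_mul_solidHarmonic (l + 1) j x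
      have h3 := conj_zeta_mul_solidHarmonic (l + 1) j x
      simp only [solidHarmonicPred_succ] at h1 h2 h3
      push_cast at *
      linear_combination (ω x : ℂ) * ((2 * (l + 1) + 1) * solidHarmonic (l + 1) j x * h0
        + solidHarmonic n m x * h1 + solidHarmonic n (m - 1) x / 2 * h2
        - solidHarmonic n (m + 1) x / 2 * h3)
    apply mul_left_cancel₀ (mul_ne_zero hn hl)
    rw [← integral_const_mul]
    simp only [hpt]
    refine Eq.trans (((((hI m j).const_mul _).add ((hI (m - 1) (j + 1)).const_mul _)).add
        ((hI (m + 1) (j - 1)).const_mul _)).add (((hJ m j).sub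
        ((hJ (m - 1) (j + 1)).const_mul _)).sub ((hJ (m + 1) (j - 1)).const_mul _))).2 ?_
    rw [show m - 1 + (j + 1) = m + j by ring, show m + 1 + (j - 1) = m + j by ring]
    by_cases h : n = l ∧ m + j = 0
    · obtain ⟨rfl, h⟩ := h
      have hn2 : (2 * n + 1 : ℂ) ≠ 0 := by exact_mod_cast Nat.succ_ne_zero (2 * n)
      rw [if_pos ⟨rfl, h⟩, if_pos ⟨rfl, h⟩, if_pos ⟨rfl, h⟩, if_pos ⟨rfl, h⟩, neg_one_zpow_pred,
        neg_one_zpow_succ]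
      have a1 := invFactorial_sub_one (n + m + 1)
      have a2 := invFactorial_sub_one (n + m)
      have b1 := invFactorial_sub_one (n - m + 1)
      have b2 := invFactorial_sub_one (n - m)
      rw [show (n : ℤ) + (m - 1) = n + m - 1 by ring, show (n : ℤ) - (m - 1) = n - m + 1 by ring,
        show (n : ℤ) + (m + 1) = n + m + 1 by ring, show (n : ℤ) - (m + 1) = n - m - 1 by ring,
        show ((n + 1 : ℕ) : ℤ) + m = n + m + 1 by push_cast; ring,
        show ((n + 1 : ℕ) : ℤ) - m = n - m + 1 by push_cast; ring, a2, b2]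
      rw [add_sub_cancel_right] at a1 b1
      rw [a1, b1]
      push_cast
      have h1 := mul_inv_cancel₀ hn2
      have h2 := mul_inv_cancel₀ hl
      simp only [div_eq_mul_inv]
      linear_combination ((n + 1) * (-1) ^ m * invFactorial (n + m + 1) * invFactorial (n - m + 1)
        * moment ω (n + 1)) * (h1 - h2)
    · have h' : ¬ (n + 1 = l + 1 ∧ m + j = 0) := by omega
      rw [if_neg h']
      simp [h]

/-- The weighted orthogonality relations of the solid spherical harmonics. -/
theorem IsWeight.integral_mul {ω : E3 → ℝ} (hω : IsWeight ω) (n k : ℕ) (m j : ℤ) :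
    ∫ x, (ω x : ℂ) * (solidHarmonic n m x * solidHarmonic k j x) =
      if n = k ∧ m + j = 0 then
        (-1) ^ m * (invFactorial (n + m) * invFactorial (n - m)) / (2 * n + 1) * moment ω n
      else 0 := by
  rcases le_or_gt n k with h | h
  · exact integral_mul_of_le hω h m j
  · have h1 : n ≠ k := by omega
    have h2 := integral_mul_of_le hω h.le j m
    simp only [h1.symm, false_and, if_false] at h2
    simp only [h1, false_and, if_false, mul_comm (solidHarmonic n m _), h2]

theorem hasFDerivAt_radial {Ψ ψ : ℝ → ℝ} (hΨ : ∀ s, HasDerivAt Ψ (ψ s) s) (x : E3) :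
    HasFDerivAt (fun x : E3 => Ψ (‖x‖ ^ 2)) ((2 * ψ (‖x‖ ^ 2)) • innerSL ℝ x) x := by
  have h := (hΨ (‖x‖ ^ 2)).comp_hasFDerivAt x (hasStrictFDerivAt_norm_sq x).hasFDerivAt
  refine h.congr_fderiv ?_
  ext v
  simp
  ring

theorem hasCompactSupport_radial {F : Type*} [Zero F] {g : E3 → F} {ρ : ℝ}
    (h : ∀ x, ρ ≤ ‖x‖ → g x = 0) : HasCompactSupport g :=
  HasCompactSupport.intro (isCompact_closedBall (0 : E3) ρ) fun x hx =>
    h x (by rw [mem_closedBall_zero_iff] at hx; linarith)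

theorem solidHarmonicDeriv_self (n : ℕ) (m : ℤ) (x : E3) :
    solidHarmonicDeriv n m x x = n * solidHarmonic n m x := by
  rw [solidHarmonicDeriv_apply, solidHarmonic_euler]

/-- Integration by parts: `0 = ∫ Ψ ΔW = -∫ ∇Ψ · ∇W`. Here `∇Ψ = 2 ψ x`, and `x · ∇W = (n + 1) W` by
homogeneity. -/
theorem integral_radial_deriv_mul {Ψ ψ : ℝ → ℝ} (hΨ : ∀ s, HasDerivAt Ψ (ψ s) s)
    (hψ : Continuous ψ) (h1 : ∀ s, 1 ≤ s → Ψ s = 0) (h2 : ∀ s, 1 ≤ s → ψ s = 0) (n : ℕ) (m : ℤ) :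
    ∫ x : E3, (ψ (‖x‖ ^ 2) : ℂ) * solidHarmonic (n + 1) m x = 0 := by
  have hsq {x : E3} (hx : 1 ≤ ‖x‖) : 1 ≤ ‖x‖ ^ 2 := one_le_pow₀ hx
  have hΨc : Continuous Ψ := continuous_iff_continuousAt.2 fun s => (hΨ s).continuousAt
  have hf (x : E3) : HasFDerivAt (fun x : E3 => (Ψ (‖x‖ ^ 2) : ℂ))
      (Complex.ofRealCLM.comp ((2 * ψ (‖x‖ ^ 2)) • innerSL ℝ x)) x :=
    Complex.ofRealCLM.hasFDerivAt.comp x (hasFDerivAt_radial hΨ x)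
  have hfv (x v : E3) : fderiv ℝ (fun x : E3 => (Ψ (‖x‖ ^ 2) : ℂ)) x v =
      ((2 * ψ (‖x‖ ^ 2) * inner ℝ x v : ℝ) : ℂ) := by
    rw [(hf x).fderiv]
    simp
  have hint {g : E3 → ℂ} (hg : Continuous g) (h : ∀ x, 1 ≤ ‖x‖ → g x = 0) : Integrable g :=
    hg.integrable_of_hasCompactSupport (hasCompactSupport_radial h)
  have hcd : ContDiff ℝ 1 (solidHarmonicDeriv (n + 1) m) := by
    rw [← fderiv_solidHarmonic]
    exact (contDiff_solidHarmonic (n + 1) m 2).fderiv_right (by norm_num)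
  have hcdv (v : E3) : ContDiff ℝ 1 fun x => solidHarmonicDeriv (n + 1) m x v :=
    hcd.clm_apply contDiff_const
  have hc2 (v : E3) : Continuous fun x => fderiv ℝ (fun x => solidHarmonicDeriv (n + 1) m x v) x v :=
    ((hcdv v).continuous_fderiv (by norm_num)).clm_apply continuous_const
  have hΨ' : Continuous fun x : E3 => (Ψ (‖x‖ ^ 2) : ℂ) :=
    Complex.continuous_ofReal.comp (hΨc.comp (by fun_prop))
  have hψ' : Continuous fun x : E3 => (ψ (‖x‖ ^ 2) : ℂ) :=
    Complex.continuous_ofReal.comp (hψ.comp (by fun_prop))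
  have hi1 (v : E3) : Integrable fun x : E3 => (Ψ (‖x‖ ^ 2) : ℂ)
      * fderiv ℝ (fun x => solidHarmonicDeriv (n + 1) m x v) x v :=
    hint (hΨ'.mul (hc2 v)) fun x hx => by simp [h1 _ (hsq hx)]
  have hi2 (v : E3) : Integrable fun x : E3 =>
      ((2 * ψ (‖x‖ ^ 2) * inner ℝ x v : ℝ) : ℂ) * solidHarmonicDeriv (n + 1) m x v :=
    hint ((Complex.continuous_ofReal.comp (by fun_prop)).mul (hcdv v).continuous)
      fun x hx => by simp [h2 _ (hsq hx)]
  have key (v : E3) : ∫ x : E3, (Ψ (‖x‖ ^ 2) : ℂ)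
      * fderiv ℝ (fun x => solidHarmonicDeriv (n + 1) m x v) x v =
      - ∫ x : E3, ((2 * ψ (‖x‖ ^ 2) * inner ℝ x v : ℝ) : ℂ) * solidHarmonicDeriv (n + 1) m x v := by
    rw [integral_mul_fderiv_eq_neg_fderiv_mul_of_integrable]
    · simp only [hfv]
    · simpa only [hfv] using hi2 v
    · exact hi1 v
    · exact hint (hΨ'.mul (hcdv v).continuous) fun x hx => by simp [h1 _ (hsq hx)]
    · exact fun x _ => (hf x).differentiableAt
    · exact fun x _ => (hcdv v).differentiable (by norm_num) x
  have hsum := Finset.sum_congr rfl fun (i : Fin 3) (_ : i ∈ Finset.univ) => key (unitVec i)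
  rw [Finset.sum_neg_distrib, ← integral_finsetSum _ fun i _ => hi1 _,
    ← integral_finsetSum _ fun i _ => hi2 _] at hsum
  have hl : (fun x : E3 => ∑ i, (Ψ (‖x‖ ^ 2) : ℂ)
      * fderiv ℝ (fun x => solidHarmonicDeriv (n + 1) m x (unitVec i)) x (unitVec i)) = 0 := by
    ext x
    have h := laplacian_solidHarmonic (n + 1) m x
    rw [laplacian_eq_sum] at h
    rw [← Finset.mul_sum, Pi.zero_apply, ← mul_zero (Ψ (‖x‖ ^ 2) : ℂ), ← h]
    congr 1
    refine Finset.sum_congr rfl fun i _ => ?_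
    rw [fderiv_solidHarmonic, fderiv_clm_apply (hcd.differentiable (by norm_num) x)
      (differentiableAt_const _)]
    simp
  have hr (x : E3) : ∑ i, ((2 * ψ (‖x‖ ^ 2) * inner ℝ x (unitVec i) : ℝ) : ℂ)
      * solidHarmonicDeriv (n + 1) m x (unitVec i) =
      (2 * (n + 1) : ℂ) * ((ψ (‖x‖ ^ 2) : ℂ) * solidHarmonic (n + 1) m x) := by
    have hx : x = ∑ i, x i • unitVec i := by
      ext j
      fin_cases j <;> simp [unitVec, Fin.sum_univ_three]
    have h := solidHarmonicDeriv_self (n + 1) m x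
    nth_rewrite 2 [hx] at h
    rw [map_sum] at h
    have : (2 * (n + 1) : ℂ) * ((ψ (‖x‖ ^ 2) : ℂ) * solidHarmonic (n + 1) m x) =
      (2 * ψ (‖x‖ ^ 2) : ℂ) * (((n + 1 : ℕ) : ℂ) * solidHarmonic (n + 1) m x) := by
      push_cast; ring
    rw [this, ← h, Finset.mul_sum]
    refine Finset.sum_congr rfl fun i _ => ?_
    rw [map_smul]
    simp [unitVec, EuclideanSpace.inner_single_right]
    ring
  rw [hl] at hsum
  simp only [hr, integral_const_mul, integral_zero'] at hsum
  have h3 : (2 * (n + 1) : ℂ) ≠ 0 := mul_ne_zero two_ne_zero (Nat.cast_add_one_ne_zero n)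
  exact (mul_eq_zero.1 (neg_eq_zero.1 hsum.symm)).resolve_left h3

theorem isWeight_radial {φ : ℝ → ℝ} (hφ : Continuous φ) (h : ∀ s, 1 ≤ s → φ s = 0) :
    IsWeight fun x : E3 => φ (‖x‖ ^ 2) where
  integrable g hg := by
    refine Continuous.integrable_of_hasCompactSupport
      ((Complex.continuous_ofReal.comp (by fun_prop)).mul hg)
      (hasCompactSupport_radial (ρ := 1) fun x hx => ?_)
    simp [h _ (one_le_pow₀ hx)]
  integral_eq_zero a n m := by
    have hc : Continuous fun s : ℝ => φ s * s ^ a := by fun_prop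
    -- The antiderivative starts at `1`, so it vanishes for `s ≥ 1`, where `φ` does.
    have := integral_radial_deriv_mul (Ψ := fun s => ∫ t in (1 : ℝ)..s, φ t * t ^ a)
      (ψ := fun s => φ s * s ^ a) (fun s => hc.integral_hasStrictDerivAt 1 s |>.hasDerivAt) hc
      (fun s hs => ?_) (fun s hs => by simp [h s hs]) n m
    · rw [← this]
      congr 1
      ext x
      push_cast
      ring
    · rw [intervalIntegral.integral_congr (g := fun _ => 0), intervalIntegral.integral_zero]
      intro t ht
      rw [Set.uIcc_of_le hs] at ht
      simp [h t ht.1]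

/-! ### Cutoff functions and the unit ball as a weight -/

/-- A smooth radial approximation of the indicator function of the unit ball. -/
def cutoff (k : ℕ) (x : E3) : ℝ := Real.smoothTransition (k * (1 - ‖x‖ ^ 2) - 1)

theorem isWeight_cutoff (k : ℕ) : IsWeight (cutoff k) := by
  refine isWeight_radial (φ := fun s => Real.smoothTransition (k * (1 - s) - 1))
    (Real.smoothTransition.continuous.comp (by fun_prop)) fun s hs => ?_
  refine Real.smoothTransition.zero_of_nonpos ?_
  have : (k : ℝ) * (1 - s) ≤ 0 := mul_nonpos_of_nonneg_of_nonpos k.cast_nonneg (by linarith)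
  linarith

theorem contDiff_cutoff (k : ℕ) (n : ℕ∞) : ContDiff ℝ n (cutoff k) := by
  have : ContDiff ℝ n fun x : E3 => (k : ℝ) * (1 - ‖x‖ ^ 2) - 1 := by
    have := contDiff_norm_sq ℝ (E := E3) (n := n)
    fun_prop
  exact Real.smoothTransition.contDiff.comp this

theorem cutoff_nonneg (k : ℕ) (x : E3) : 0 ≤ cutoff k x := Real.smoothTransition.nonneg _

theorem cutoff_le_one (k : ℕ) (x : E3) : cutoff k x ≤ 1 := Real.smoothTransition.le_one _

/-- The cutoff functions are supported in smaller balls. -/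
theorem exists_radius_cutoff (k : ℕ) :
    ∃ ρ < 1, ∀ x, x ∉ closedBall (0 : E3) ρ → cutoff k x = 0 := by
  have hk : (0 : ℝ) < k + 1 := k.cast_add_one_pos
  -- The support lies in `k (1 - |x|²) ≥ 1`; using `k + 1` avoids a division by zero and gives a
  -- slightly larger ball.
  refine ⟨Real.sqrt (1 - 1 / (k + 1)), ?_, fun x hx => ?_⟩
  · rw [Real.sqrt_lt' one_pos]
    have : 0 < 1 / ((k : ℝ) + 1) := by positivity
    linarith
  · rw [mem_closedBall_zero_iff, not_le] at hx
    rw [Real.sqrt_lt' ((Real.sqrt_nonneg _).trans_lt hx)] at hx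
    refine Real.smoothTransition.zero_of_nonpos ?_
    have h1 : (1 - ‖x‖ ^ 2) < 1 / (k + 1) := by linarith
    rcases le_or_gt (1 - ‖x‖ ^ 2) 0 with h | h
    · have := mul_nonpos_of_nonneg_of_nonpos (k.cast_nonneg (α := ℝ)) h
      linarith
    · rw [lt_div_iff₀ hk] at h1
      nlinarith

theorem tendsto_cutoff {x : E3} (hx : x ∈ unitBall) :
    Tendsto (fun k => cutoff k x) atTop (𝓝 1) := by
  have hx' : ‖x‖ < 1 := by simpa using hx
  have hpos : 0 < 1 - ‖x‖ ^ 2 := by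
    have := pow_lt_one₀ (norm_nonneg x) hx' two_ne_zero
    linarith
  refine tendsto_const_nhds.congr' ?_
  filter_upwards [(tendsto_natCast_atTop_atTop (R := ℝ)).eventually_ge_atTop (2 / (1 - ‖x‖ ^ 2))]
    with k hk
  refine (Real.smoothTransition.one_of_one_le ?_).symm
  rw [div_le_iff₀ hpos] at hk
  linarith

theorem cutoff_eq_zero {k : ℕ} {x : E3} (hx : x ∉ unitBall) : cutoff k x = 0 := by
  obtain ⟨ρ, hρ, h⟩ := exists_radius_cutoff k
  exact h x fun hx' => hx (closedBall_subset_ball hρ hx')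

/-- Integrals over the unit ball are limits of integrals against the cutoff functions. -/
theorem tendsto_integral_cutoff {F : Type*} [NormedAddCommGroup F] [NormedSpace ℝ F]
    {g : E3 → F} (hg : IntegrableOn g unitBall) :
    Tendsto (fun k => ∫ x, cutoff k x • g x) atTop (𝓝 (∫ x in unitBall, g x)) := by
  have hset (k : ℕ) : ∫ x, cutoff k x • g x = ∫ x in unitBall, cutoff k x • g x := by
    rw [setIntegral_eq_integral_of_forall_compl_eq_zero]
    intro x hx
    rw [cutoff_eq_zero hx, zero_smul]
  simp only [hset]
  refine tendsto_integral_of_dominated_convergence (fun x => ‖g x‖)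
    (fun k => (contDiff_cutoff k 0).continuous.aestronglyMeasurable.smul hg.1) hg.norm
    (fun k => Eventually.of_forall fun x => ?_) ?_
  · rw [norm_smul, Real.norm_of_nonneg (cutoff_nonneg k x)]
    exact mul_le_of_le_one_left (norm_nonneg _) (cutoff_le_one k x)
  · filter_upwards [ae_restrict_mem measurableSet_ball] with x hx
    simpa using (tendsto_cutoff hx).smul_const (g x)

/-- The indicator function of the unit ball. -/
def ballWeight : E3 → ℝ := unitBall.indicator 1

theorem integral_ballWeight_mul (g : E3 → ℂ) :
    ∫ x, (ballWeight x : ℂ) * g x = ∫ x in unitBall, g x := by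
  rw [← integral_indicator measurableSet_ball]
  congr 1
  ext x
  by_cases hx : x ∈ unitBall <;> simp [ballWeight, hx]

theorem integrableOn_unitBall {F : Type*} [NormedAddCommGroup F] {g : E3 → F}
    (hg : Continuous g) : IntegrableOn g unitBall :=
  (hg.continuousOn.integrableOn_compact (isCompact_closedBall (0 : E3) 1)).mono_set
    ball_subset_closedBall

theorem isWeight_ballWeight : IsWeight ballWeight where
  integrable g hg := by
    refine ((integrable_indicator_iff measurableSet_ball).2 (integrableOn_unitBall hg)).congr
      (Eventually.of_forall fun x => ?_)
    by_cases hx : x ∈ unitBall <;> simp [ballWeight, hx]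
  integral_eq_zero a n m := by
    rw [integral_ballWeight_mul]
    have hc : Continuous fun x : E3 => ((‖x‖ ^ 2 : ℝ) : ℂ) ^ a * solidHarmonic (n + 1) m x :=
      ((Complex.continuous_ofReal.comp (by fun_prop)).pow a).mul (continuous_solidHarmonic _ _)
    refine tendsto_nhds_unique (tendsto_integral_cutoff (integrableOn_unitBall hc)) ?_
    simp only [Complex.real_smul, (isWeight_cutoff _).integral_eq_zero]
    exact tendsto_const_nhds

/-- Polar coordinates: three times the volume `4π/3`, times `∫₀¹ r^(2n+2) dr`. -/
theorem moment_ballWeight (n : ℕ) :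
    moment ballWeight n = ((4 * Real.pi / (2 * n + 3) : ℝ) : ℂ) := by
  rw [moment, integral_ballWeight_mul]
  have h1 : ∀ x : E3, (((‖x‖ ^ 2 : ℝ) : ℂ)) ^ n = ((‖x‖ ^ (2 * n) : ℝ) : ℂ) := by
    intro x; push_cast; rw [pow_mul]
  simp only [h1]
  rw [integral_complex_ofReal, ← integral_indicator measurableSet_ball]
  congr 1
  have h2 : unitBall.indicator (fun x : E3 => ‖x‖ ^ (2 * n)) =
      fun x => (Set.Iio (1 : ℝ)).indicator (fun y => y ^ (2 * n)) ‖x‖ := by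
    ext x
    by_cases hx : ‖x‖ < 1 <;> simp [Set.indicator, hx]
  rw [h2, integral_fun_norm_addHaar volume ((Set.Iio (1 : ℝ)).indicator fun y => y ^ (2 * n))]
  have h3 : ∫ y in Set.Ioi (0 : ℝ), y ^ (Module.finrank ℝ E3 - 1) •
      (Set.Iio (1 : ℝ)).indicator (fun y => y ^ (2 * n)) y = 1 / (2 * n + 3) := by
    have : ∀ y : ℝ, y ^ (Module.finrank ℝ E3 - 1) •
        (Set.Iio (1 : ℝ)).indicator (fun y => y ^ (2 * n)) y =
        (Set.Iio (1 : ℝ)).indicator (fun y => y ^ (2 * n + 2)) y := by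
      intro y
      by_cases hy : y < 1
      · simp [hy]; ring
      · simp [hy]
    simp only [this]
    rw [setIntegral_indicator measurableSet_Iio, Set.Ioi_inter_Iio, ← integral_Ioc_eq_integral_Ioo,
      ← intervalIntegral.integral_of_le zero_le_one, integral_pow]
    simp
    ring
  have h4 : volume.real (ball (0 : E3) 1) = 4 * Real.pi / 3 := by
    rw [Measure.real, InnerProductSpace.volume_ball_of_dim_odd (k := 1) (by simp)]
    have : (0 : ℝ) ≤ Real.pi * 2 ^ 2 / 3 := by positivity
    simp [Nat.doubleFactorial]
    rw [ENNReal.toReal_ofReal this]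
    ring
  rw [h3, h4]
  simp
  field_simp

/-! ### Integration by parts and contragenic fields -/

theorem continuous_mul_of_supported {ρ : ℝ} (hρ : ρ < 1) {a u : E3 → ℂ} (ha : Continuous a)
    (hsupp : ∀ x, x ∉ closedBall (0 : E3) ρ → a x = 0) (hu : ContinuousOn u unitBall) :
    Continuous fun x => a x * u x := by
  rw [continuous_iff_continuousAt]
  intro x
  by_cases hx : x ∈ closedBall (0 : E3) ρ
  · exact ha.continuousAt.mul
      (hu.continuousAt (isOpen_ball.mem_nhds (closedBall_subset_ball hρ hx)))
  · have : (fun x => a x * u x) =ᶠ[𝓝 x] fun _ => 0 := by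
      filter_upwards [isClosed_closedBall.isOpen_compl.mem_nhds hx] with y hy
      rw [hsupp y hy, zero_mul]
    exact continuousAt_const.congr this.symm

theorem integrable_mul_of_supported {ρ : ℝ} (hρ : ρ < 1) {a u : E3 → ℂ} (ha : Continuous a)
    (hsupp : ∀ x, x ∉ closedBall (0 : E3) ρ → a x = 0) (hu : ContinuousOn u unitBall) :
    Integrable fun x => a x * u x :=
  (continuous_mul_of_supported hρ ha hsupp hu).integrable_of_hasCompactSupport
    (HasCompactSupport.intro (isCompact_closedBall (0 : E3) ρ) fun x hx => by
      rw [hsupp x hx, zero_mul])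

theorem fderiv_eq_zero_of_supported {ρ : ℝ} {a : E3 → ℂ}
    (hsupp : ∀ x, x ∉ closedBall (0 : E3) ρ → a x = 0) {x : E3}
    (hx : x ∉ closedBall (0 : E3) ρ) : fderiv ℝ a x = 0 := by
  have : a =ᶠ[𝓝 x] fun _ => 0 := by
    filter_upwards [isClosed_closedBall.isOpen_compl.mem_nhds hx] with y hy using hsupp y hy
  rw [this.fderiv_eq]
  simp

/-- Integration by parts against a function supported in a smaller ball. -/
theorem integral_mul_fderiv_of_supported {ρ : ℝ} (hρ : ρ < 1) {a u : E3 → ℂ}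
    (ha : ContDiff ℝ 1 a) (hsupp : ∀ x, x ∉ closedBall (0 : E3) ρ → a x = 0)
    (hu : ∀ x ∈ unitBall, ContDiffAt ℝ 1 u x) (v : E3) :
    HasIntegral volume (fun x => a x * fderiv ℝ u x v) (-∫ x, fderiv ℝ a x v * u x) := by
  have hsub : tsupport a ⊆ closedBall 0 ρ :=
    closure_minimal (fun x hx => by by_contra h; exact hx (hsupp x h)) isClosed_closedBall
  have huc : ContinuousOn u unitBall := fun x hx => (hu x hx).continuousAt.continuousWithinAt
  have hduc : ContinuousOn (fun x => fderiv ℝ u x v) unitBall := fun x hx =>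
    (((hu x hx).fderiv_right (m := 0) (by norm_num)).continuousAt.clm_apply
      continuousAt_const).continuousWithinAt
  have hda : Continuous fun x => fderiv ℝ a x v :=
    (ha.continuous_fderiv (by norm_num)).clm_apply continuous_const
  have h1 := integrable_mul_of_supported hρ ha.continuous hsupp hduc
  refine ⟨h1, integral_mul_fderiv_eq_neg_fderiv_mul_of_integrable ?_ h1
    (integrable_mul_of_supported hρ ha.continuous hsupp huc) ?_ ?_⟩
  · exact integrable_mul_of_supported hρ hda
      (fun x hx => by rw [fderiv_eq_zero_of_supported hsupp hx]; rfl) huc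
  · exact fun x _ => ha.differentiable (by norm_num) x
  · exact fun x hx =>
      (hu x (closedBall_subset_ball hρ (hsub hx))).differentiableAt (by norm_num)

/-- A combination `c` of solid spherical harmonics for which the field `(0, Re c, Im c)` is
orthogonal, with respect to every radial weight, to the gradients of the solid spherical
harmonics. -/
structure IsContragenicField (c : E3 → ℂ) : Prop where
  mem : c ∈ harmonicSpan
  integral_eq : ∀ ω, IsWeight ω → ∀ (n : ℕ) (j : ℤ),
    ∫ x, (ω x : ℂ) * (c x * solidHarmonic n (j - 1) x) =
      ∫ x, (ω x : ℂ) * (conj (c x) * solidHarmonic n (j + 1) x)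

theorem contDiff_of_mem {p : E3 → ℂ} (hp : p ∈ harmonicSpan) (k : WithTop ℕ∞) :
    ContDiff ℝ k p :=
  harmonicSpan_induction (P := fun p => ContDiff ℝ k p) (fun n m => contDiff_solidHarmonic n m k)
    (fun _ _ h1 h2 => h1.add h2) (fun _ _ h => contDiff_const.smul h) hp

/-- With `z = c x`, the left side is the inner product of `(0, Re c, Im c)` with the gradient of `W
(n+1) j`. This is the source of the identity in `IsContragenicField`. -/
theorem field_deriv_solidHarmonic (n : ℕ) (j : ℤ) (z : ℂ) (x : E3) :
    (z.re : ℂ) * fderiv ℝ (solidHarmonic (n + 1) j) x (unitVec 1)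
      + z.im * fderiv ℝ (solidHarmonic (n + 1) j) x (unitVec 2) =
    (1 / 2 : ℂ) * (z * solidHarmonic n (j - 1) x)
      - (1 / 2 : ℂ) * (conj z * solidHarmonic n (j + 1) x) := by
  have h1 : z = z.re + z.im * Complex.I := (Complex.re_add_im z).symm
  have h2 : conj z = z.re - z.im * Complex.I := by
    apply Complex.ext <;> simp
  rw [fderiv_solidHarmonic, solidHarmonicDeriv_apply, solidHarmonicDeriv_apply, h2]
  simp [axial_unitVec, zeta_unitVec]
  linear_combination (-(1 / 2) * solidHarmonic n (j - 1) x) * h1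

/-- A contragenic field is orthogonal to the gradients of harmonic functions, up to a cutoff. -/
theorem IsContragenicField.integral_cutoff_deriv {c : E3 → ℂ} (hc : IsContragenicField c)
    {u : E3 → ℝ} (hu : HarmonicOnNhd u unitBall) (k : ℕ) :
    ∫ x, cutoff k x • ((c x).re * fderiv ℝ u x (unitVec 1)
      + (c x).im * fderiv ℝ u x (unitVec 2)) = 0 := by
  obtain ⟨ρ, hρ, hsupp⟩ := exists_radius_cutoff k
  have hcd := contDiff_of_mem hc.mem 1
  have hχ : ContDiff ℝ 1 (cutoff k) := contDiff_cutoff k 1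
  have ha1 : ContDiff ℝ 1 fun x => ((cutoff k x * (c x).re : ℝ) : ℂ) :=
    Complex.ofRealCLM.contDiff.comp (hχ.mul (Complex.reCLM.contDiff.comp hcd))
  have ha2 : ContDiff ℝ 1 fun x => ((cutoff k x * (c x).im : ℝ) : ℂ) :=
    Complex.ofRealCLM.contDiff.comp (hχ.mul (Complex.imCLM.contDiff.comp hcd))
  have hs1 : ∀ x, x ∉ closedBall (0 : E3) ρ → ((cutoff k x * (c x).re : ℝ) : ℂ) = 0 :=
    fun x hx => by simp [hsupp x hx]
  have hs2 : ∀ x, x ∉ closedBall (0 : E3) ρ → ((cutoff k x * (c x).im : ℝ) : ℂ) = 0 :=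
    fun x hx => by simp [hsupp x hx]
  set a1 : E3 → ℂ := fun x => ((cutoff k x * (c x).re : ℝ) : ℂ)
  set a2 : E3 → ℂ := fun x => ((cutoff k x * (c x).im : ℝ) : ℂ)
  have hd {a : E3 → ℂ} (ha : ContDiff ℝ 1 a) (v : E3) : Continuous fun x => fderiv ℝ a x v :=
    (ha.continuous_fderiv (by norm_num)).clm_apply continuous_const
  have hsd {a : E3 → ℂ} (hs : ∀ x, x ∉ closedBall (0 : E3) ρ → a x = 0) (v : E3) :
      ∀ x, x ∉ closedBall (0 : E3) ρ → fderiv ℝ a x v = 0 := fun x hx => by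
    rw [fderiv_eq_zero_of_supported hs hx]; rfl
  -- The divergence of the cut-off field. It is supported in a smaller ball, so it can be tested
  -- against any harmonic function, whatever the growth of that function at the boundary.
  let g : E3 → ℂ := fun x => fderiv ℝ a1 x (unitVec 1) + fderiv ℝ a2 x (unitVec 2)
  have parts {q : E3 → ℂ} (hq : ∀ x ∈ unitBall, ContDiffAt ℝ 1 q x) :
      ∫ x, (a1 x * fderiv ℝ q x (unitVec 1) + a2 x * fderiv ℝ q x (unitVec 2)) =
        -∫ x, g x * q x := by
    have hqc : ContinuousOn q unitBall := fun x hx => (hq x hx).continuousAt.continuousWithinAt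
    rw [((integral_mul_fderiv_of_supported hρ ha1 hs1 hq (unitVec 1)).add
      (integral_mul_fderiv_of_supported hρ ha2 hs2 hq (unitVec 2))).2, ← neg_add,
      ← integral_add (integrable_mul_of_supported hρ (hd ha1 _) (hsd hs1 _) hqc)
      (integrable_mul_of_supported hρ (hd ha2 _) (hsd hs2 _) hqc)]
    simp only [g, add_mul]
  have hw : ∀ n m, ∫ x, g x * solidHarmonic n m x = 0 := by
    intro n m
    have h := parts fun x _ => (contDiff_solidHarmonic n m 1).contDiffAt
    cases n with
    | zero =>
      simp only [fderiv_solidHarmonic, solidHarmonicDeriv_apply, solidHarmonicPred_zero, mul_zero,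
        add_zero, sub_zero, integral_zero] at h
      exact neg_eq_zero.1 h.symm
    | succ n =>
      have hpt (x : E3) : a1 x * fderiv ℝ (solidHarmonic (n + 1) m) x (unitVec 1)
          + a2 x * fderiv ℝ (solidHarmonic (n + 1) m) x (unitVec 2) =
          (1 / 2 : ℂ) * ((cutoff k x : ℂ) * (c x * solidHarmonic n (m - 1) x))
          - (1 / 2 : ℂ) * ((cutoff k x : ℂ) * (conj (c x) * solidHarmonic n (m + 1) x)) := by
        simp only [a1, a2]
        push_cast
        linear_combination (cutoff k x : ℂ) * field_deriv_solidHarmonic n m (c x) x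
      have hi1 := (isWeight_cutoff k).integrable (fun x => c x * solidHarmonic n (m - 1) x)
        (hcd.continuous.mul (continuous_solidHarmonic _ _))
      have hi2 := (isWeight_cutoff k).integrable (fun x => conj (c x) * solidHarmonic n (m + 1) x)
        ((Complex.continuous_conj.comp hcd.continuous).mul (continuous_solidHarmonic _ _))
      simp only [hpt] at h
      rw [integral_sub (hi1.const_mul _) (hi2.const_mul _), integral_const_mul,
        integral_const_mul, hc.integral_eq _ (isWeight_cutoff k), sub_self] at h
      exact neg_eq_zero.1 h.symm
  have hg : Continuous g := (hd ha1 _).add (hd ha2 _)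
  have hgs : ∀ x, x ∉ closedBall (0 : E3) ρ → g x = 0 := fun x hx => by
    simp only [g, fderiv_eq_zero_of_supported (a := a1) hs1 hx,
      fderiv_eq_zero_of_supported (a := a2) hs2 hx, zero_apply, add_zero]
  have h0 := integral_mul_harmonic_eq_zero hρ (hg.integrable_of_hasCompactSupport
    (HasCompactSupport.intro (isCompact_closedBall (0 : E3) ρ) hgs)) hgs hu hw
  have hu1 : ∀ x ∈ unitBall, ContDiffAt ℝ 1 (fun x => (u x : ℂ)) x := fun x hx =>
    Complex.ofRealCLM.contDiff.contDiffAt.comp x ((hu x hx).1.of_le (by norm_num))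
  have h1 := parts hu1
  rw [h0, neg_zero] at h1
  have hre : ∀ x, a1 x * fderiv ℝ (fun x => (u x : ℂ)) x (unitVec 1)
      + a2 x * fderiv ℝ (fun x => (u x : ℂ)) x (unitVec 2) =
      ((cutoff k x • ((c x).re * fderiv ℝ u x (unitVec 1)
        + (c x).im * fderiv ℝ u x (unitVec 2)) : ℝ) : ℂ) := by
    intro x
    by_cases hx : x ∈ unitBall
    · have hf : HasFDerivAt (fun x => (u x : ℂ)) (Complex.ofRealCLM.comp (fderiv ℝ u x)) x :=
        Complex.ofRealCLM.hasFDerivAt.comp x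
          ((hu x hx).1.differentiableAt (by norm_num)).hasFDerivAt
      rw [hf.fderiv]
      simp [a1, a2]
      ring
    · simp [a1, a2, cutoff_eq_zero hx]
  simp only [hre] at h1
  rw [integral_complex_ofReal] at h1
  exact_mod_cast h1

/-! ### Weakly harmonic functions and uniqueness by moments -/

theorem memLp_unitBall {F : Type*} [NormedAddCommGroup F] [SecondCountableTopology F]
    {f : E3 → F} (hf : Continuous f) : MemLp f 2 (volume.restrict unitBall) := by
  have : IsFiniteMeasure (volume.restrict unitBall) :=
    isFiniteMeasure_restrict.2 measure_ball_lt_top.ne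
  obtain ⟨C, hC⟩ := (isCompact_closedBall (0 : E3) 1).exists_bound_of_continuousOn hf.continuousOn
  refine MemLp.of_bound hf.aestronglyMeasurable C ?_
  filter_upwards [ae_restrict_mem measurableSet_ball] with x hx
    using hC x (ball_subset_closedBall hx)

theorem setIntegral_unitBall {F : Type*} [NormedAddCommGroup F] [NormedSpace ℝ F] {ρ : ℝ}
    (hρ : ρ < 1) {g : E3 → F} (h : ∀ x, x ∉ closedBall (0 : E3) ρ → g x = 0) :
    ∫ x in unitBall, g x = ∫ x, g x :=
  setIntegral_eq_integral_of_forall_compl_eq_zero fun x hx =>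
    h x fun hx' => hx (closedBall_subset_ball hρ hx')

/-- A function on the unit ball which is orthogonal to those compactly supported functions that
are orthogonal to the solid spherical harmonics. -/
def IsWeaklyHarmonic (u : E3 → ℝ) : Prop :=
  ∀ ρ < 1, ∀ v : E3 → ℂ, MemLp v 2 (volume.restrict unitBall) →
    (∀ x, x ∉ closedBall (0 : E3) ρ → v x = 0) →
    (∀ n m, ∫ x in unitBall, v x * solidHarmonic n m x = 0) → ∫ x in unitBall, v x * u x = 0

theorem isWeaklyHarmonic_of_harmonicOnNhd {u : E3 → ℝ} (hu : HarmonicOnNhd u unitBall) :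
    IsWeaklyHarmonic u := by
  intro ρ hρ v hv hs h
  have : IsFiniteMeasure (volume.restrict unitBall) :=
    isFiniteMeasure_restrict.2 measure_ball_lt_top.ne
  rw [setIntegral_unitBall hρ fun x hx => by rw [hs x hx, zero_mul]]
  refine integral_mul_harmonic_eq_zero hρ ?_ hs hu fun n m => ?_
  · refine (integrableOn_iff_integrable_of_support_subset (s := unitBall) fun x hx => ?_).1
      (hv.integrable (by norm_num))
    by_contra hx'
    exact hx (hs x fun h' => hx' (closedBall_subset_ball hρ h'))
  · rw [← setIntegral_unitBall hρ fun x hx => by rw [hs x hx, zero_mul], h]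

/-- A weakly harmonic function on the unit ball which is orthogonal to the solid spherical
harmonics vanishes almost everywhere. -/
theorem IsWeaklyHarmonic.ae_eq_zero {u : E3 → ℝ} (hu : IsWeaklyHarmonic u)
    (hui : MemLp u 2 (volume.restrict unitBall))
    (h : ∀ n m, ∫ x in unitBall, (u x : ℂ) * solidHarmonic n m x = 0) :
    u =ᵐ[volume.restrict unitBall] 0 := by
  have huc : MemLp (fun x => (u x : ℂ)) 2 (volume.restrict unitBall) := hui.ofReal
  have hint {v : E3 → ℂ} (hv : MemLp v 2 (volume.restrict unitBall)) :
      IntegrableOn (fun x => v x * u x) unitBall := hv.integrable_mul huc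
  have hχ (k : ℕ) : Continuous fun x => (cutoff k x : ℂ) :=
    Complex.continuous_ofReal.comp (contDiff_cutoff k 0).continuous
  -- Vanishing moments are inherited by `χ_k u`, where `χ_k` is the cutoff.
  have hcut (k n : ℕ) (m : ℤ) :
      ∫ x in unitBall, ((cutoff k x : ℂ) * u x) * solidHarmonic n m x = 0 := by
    have hcw (l : ℕ) : Continuous fun x => (cutoff l x : ℂ) * solidHarmonic n m x :=
      (hχ l).mul (continuous_solidHarmonic n m)
    -- The integral of `χ W W'` depends on the radial weight `χ` only through a moment. Hence this
    -- combination of `χ_k W` and `χ_l W` is orthogonal to every solid harmonic and is an admissible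
    -- test function. Letting `l → ∞` compares `χ_k` with the full ball, where the integral is zero
    -- and the moment is not.
    have hrel (l : ℕ) : moment (cutoff l) n *
        ∫ x in unitBall, ((cutoff k x : ℂ) * solidHarmonic n m x) * u x =
        moment (cutoff k) n *
        ∫ x in unitBall, ((cutoff l x : ℂ) * solidHarmonic n m x) * u x := by
      obtain ⟨ρ, hρ, hsupp⟩ := exists_radius_cutoff k
      obtain ⟨ρ', hρ', hsupp'⟩ := exists_radius_cutoff l
      have hi1 := hint (memLp_unitBall (hcw k))
      have hi2 := hint (memLp_unitBall (hcw l))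
      have hs : ∀ x, x ∉ closedBall (0 : E3) (max ρ ρ') →
          moment (cutoff l) n * ((cutoff k x : ℂ) * solidHarmonic n m x)
          - moment (cutoff k) n * ((cutoff l x : ℂ) * solidHarmonic n m x) = 0 := by
        intro x hx
        have h1 : x ∉ closedBall (0 : E3) ρ := fun h' =>
          hx (closedBall_subset_closedBall (le_max_left _ _) h')
        have h2 : x ∉ closedBall (0 : E3) ρ' := fun h' =>
          hx (closedBall_subset_closedBall (le_max_right _ _) h')
        simp [hsupp x h1, hsupp' x h2]
      have := hu _ (max_lt hρ hρ') (fun x =>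
          moment (cutoff l) n * ((cutoff k x : ℂ) * solidHarmonic n m x)
          - moment (cutoff k) n * ((cutoff l x : ℂ) * solidHarmonic n m x))
        (memLp_unitBall (((hcw k).const_mul _).sub ((hcw l).const_mul _))) hs fun n' m' => ?_
      · simp only [sub_mul, mul_assoc] at this hi1 hi2 ⊢
        rw [integral_sub (hi1.const_mul _) (hi2.const_mul _), integral_const_mul,
          integral_const_mul] at this
        exact sub_eq_zero.1 this
      · have hJ (l : ℕ) : HasIntegral volume (fun x => (cutoff l x : ℂ) *
            (solidHarmonic n m x * solidHarmonic n' m' x)) _ :=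
          ⟨(isWeight_cutoff l).integrable _ ((continuous_solidHarmonic _ _).mul
            (continuous_solidHarmonic _ _)), (isWeight_cutoff l).integral_mul n n' m m'⟩
        have h3 := (((hJ k).const_mul (moment (cutoff l) n)).sub
          ((hJ l).const_mul (moment (cutoff k) n))).2
        rw [setIntegral_unitBall (max_lt hρ hρ') fun x hx => by rw [hs x hx, zero_mul]]
        refine Eq.trans ?_ (h3.trans ?_)
        · congr 1
          ext x
          ring
        · split_ifs
          · ring
          · simp
    have hl1 : Tendsto (fun l => moment (cutoff l) n) atTop (𝓝 (moment ballWeight n)) := by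
      have hc : Continuous fun x : E3 => ((‖x‖ ^ 2 : ℝ) : ℂ) ^ n :=
        (Complex.continuous_ofReal.comp (by fun_prop)).pow n
      have := tendsto_integral_cutoff (integrableOn_unitBall hc)
      simp only [Complex.real_smul] at this
      rw [moment, integral_ballWeight_mul]
      exact this
    have hl2 : Tendsto (fun l => ∫ x in unitBall, ((cutoff l x : ℂ) * solidHarmonic n m x) * u x)
        atTop (𝓝 0) := by
      have := tendsto_integral_cutoff
        (huc.integrable_mul (memLp_unitBall (continuous_solidHarmonic n m)))
      simp only [Pi.mul_apply] at this
      rw [h] at this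
      refine this.congr fun l => ?_
      obtain ⟨ρ, hρ, hsupp⟩ := exists_radius_cutoff l
      rw [setIntegral_unitBall hρ fun x hx => by simp [hsupp x hx]]
      congr 1
      ext x
      rw [Complex.real_smul]
      ring
    have hlim := tendsto_nhds_unique ((hl1.mul_const _).congr hrel) (hl2.const_mul _)
    rw [mul_zero] at hlim
    have hM : moment ballWeight n ≠ 0 := by
      rw [moment_ballWeight]
      have : 0 < 4 * Real.pi / (2 * n + 3) := by have := Real.pi_pos; positivity
      exact_mod_cast this.ne'
    rw [← (mul_eq_zero.1 hlim).resolve_left hM]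
    congr 1
    ext x
    ring
  -- Now `χ_k u` is itself an admissible test function for `u`, so `∫ χ_k u² = 0`.
  have hsq (k : ℕ) : (fun x => cutoff k x * u x ^ 2) =ᵐ[volume.restrict unitBall] 0 := by
    obtain ⟨ρ, hρ, hsupp⟩ := exists_radius_cutoff k
    have hv : MemLp (fun x => (cutoff k x : ℂ) * u x) 2 (volume.restrict unitBall) := by
      refine huc.mono ((hχ k).aestronglyMeasurable.mul huc.1) (Eventually.of_forall fun x => ?_)
      rw [norm_mul, Complex.norm_real, Real.norm_of_nonneg (cutoff_nonneg k x)]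
      exact mul_le_of_le_one_left (norm_nonneg _) (cutoff_le_one k x)
    have h0 := hu ρ hρ _ hv (fun x hx => by simp [hsupp x hx]) (hcut k)
    have hi := hint hv
    have he : (fun x => (cutoff k x : ℂ) * u x * u x) =
        fun x => ((cutoff k x * u x ^ 2 : ℝ) : ℂ) := by
      ext x; push_cast; ring
    rw [he] at h0 hi
    rw [integral_complex_ofReal] at h0
    have hi' : IntegrableOn (fun x => cutoff k x * u x ^ 2) unitBall :=
      hi.re.congr (Eventually.of_forall fun x => Complex.ofReal_re _)
    exact (integral_eq_zero_iff_of_nonneg (fun x => mul_nonneg (cutoff_nonneg k x) (sq_nonneg _))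
      hi').1 (by exact_mod_cast h0)
  filter_upwards [ae_all_iff.2 hsq, ae_restrict_mem measurableSet_ball] with x hx hxb
  obtain ⟨k, hk⟩ := ((tendsto_cutoff hxb).eventually (lt_mem_nhds zero_lt_one)).exists
  have := hx k
  simp only [Pi.zero_apply] at this ⊢
  exact pow_eq_zero_iff two_ne_zero |>.1 ((mul_eq_zero.1 this).resolve_left hk.ne')

/-! ### Monogenic functions as conjugate gradients -/

theorem eq_sum_unitVec (x : E3) : x = x 0 • unitVec 0 + x 1 • unitVec 1 + x 2 • unitVec 2 := by
  ext j
  fin_cases j <;> simp [unitVec]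

theorem inner_eq_sum (x y : E3) : inner ℝ x y = x 0 * y 0 + x 1 * y 1 + x 2 * y 2 := by
  simp [PiLp.inner_apply, Fin.sum_univ_three]
  ring

theorem clm_apply_eq_sum {F : Type*} [NormedAddCommGroup F] [NormedSpace ℝ F] (A : E3 →L[ℝ] F)
    (v : E3) : A v = v 0 • A (unitVec 0) + v 1 • A (unitVec 1) + v 2 • A (unitVec 2) := by
  conv_lhs => rw [eq_sum_unitVec v]
  simp only [map_add, map_smul]

/-- The four real equations expressing `D̄ f = 0`. -/
theorem Dbar_eq_zero_iff {f : E3 → E3} {x : E3} : Dbar f x = 0 ↔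
    partialDeriv 0 f x 0 - partialDeriv 1 f x 1 - partialDeriv 2 f x 2 = 0 ∧
    partialDeriv 0 f x 1 + partialDeriv 1 f x 0 = 0 ∧
    partialDeriv 0 f x 2 + partialDeriv 2 f x 0 = 0 ∧
    partialDeriv 1 f x 2 - partialDeriv 2 f x 1 = 0 := by
  have hq (y : E3) : (toQuaternion y).re = y 0 ∧ (toQuaternion y).imI = y 1 ∧
    (toQuaternion y).imJ = y 2 ∧ (toQuaternion y).imK = 0 := ⟨rfl, rfl, rfl, rfl⟩
  have h1 : e1.re = 0 ∧ e1.imI = 1 ∧ e1.imJ = 0 ∧ e1.imK = 0 := ⟨rfl, rfl, rfl, rfl⟩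
  have h2 : e2.re = 0 ∧ e2.imI = 0 ∧ e2.imJ = 1 ∧ e2.imK = 0 := ⟨rfl, rfl, rfl, rfl⟩
  refine QuaternionAlgebra.ext_iff.trans ?_
  simp [Dbar, hq, h1, h2, sub_eq_add_neg]

/-- The bilinear form `(y, v) ↦ ⟨ȳ, v⟩`. -/
def conjInner : E3 →L[ℝ] E3 →L[ℝ] ℝ :=
  (innerSL ℝ : E3 →L[ℝ] E3 →L[ℝ] ℝ).comp (LinearMap.toContinuousLinearMap conjugation)

theorem conjInner_apply (y v : E3) : conjInner y v = y 0 * v 0 - y 1 * v 1 - y 2 * v 2 := by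
  change inner ℝ (conjugation y) v = _
  rw [inner_eq_sum]
  simp [conjugation]
  ring

/-- A monogenic function on the unit ball is the conjugate of the gradient of a harmonic
function. -/
theorem exists_potential {f : E3 → E3} (hf : f ∈ monogenic unitBall) :
    ∃ h : E3 → ℝ, HarmonicOnNhd h unitBall ∧
      ∀ x ∈ unitBall, ∀ v, fderiv ℝ h x v = conjInner (f x) v := by
  have hd (x : E3) (hx : x ∈ unitBall) : HasFDerivAt f (fderiv ℝ f x) x :=
    ((hf x hx).1.differentiableAt (by norm_num)).hasFDerivAt
  have hω (x : E3) (hx : x ∈ unitBall) : HasFDerivAt (fun x => conjInner (f x))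
      (conjInner.comp (fderiv ℝ f x)) x := conjInner.hasFDerivAt.comp x (hd x hx)
  -- The Poincaré lemma on a convex set: the last three equations of `D̄ f = 0` say that the
  -- derivative of `f̄` is symmetric. The first one, used below, is `Δh = 0`.
  obtain ⟨h, hh⟩ := (convex_ball (0 : E3) 1).exists_forall_hasFDerivAt_of_fderiv_symmetric
    isOpen_ball (ω := fun x => conjInner (f x))
    (fun x hx => (hω x hx).differentiableAt.differentiableWithinAt) (fun x hx u v => by
      rw [(hω x hx).fderiv]
      obtain ⟨-, h1, h2, h3⟩ := Dbar_eq_zero_iff.1 (hf x hx).2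
      change conjInner (fderiv ℝ f x u) v = conjInner (fderiv ℝ f x v) u
      rw [conjInner_apply, conjInner_apply, clm_apply_eq_sum (fderiv ℝ f x) u,
        clm_apply_eq_sum (fderiv ℝ f x) v]
      change fderiv ℝ f x (unitVec 0) 1 + fderiv ℝ f x (unitVec 1) 0 = 0 at h1
      change fderiv ℝ f x (unitVec 0) 2 + fderiv ℝ f x (unitVec 2) 0 = 0 at h2
      change fderiv ℝ f x (unitVec 1) 2 - fderiv ℝ f x (unitVec 2) 1 = 0 at h3
      simp only [PiLp.add_apply, PiLp.smul_apply, smul_eq_mul]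
      linear_combination (u 1 * v 0 - u 0 * v 1) * h1 + (u 2 * v 0 - u 0 * v 2) * h2
        + (u 2 * v 1 - u 1 * v 2) * h3)
  have hfd (x : E3) (hx : x ∈ unitBall) : fderiv ℝ h =ᶠ[𝓝 x] fun x => conjInner (f x) := by
    filter_upwards [isOpen_ball.mem_nhds hx] with y hy using (hh y hy).fderiv
  refine ⟨h, fun x hx => ⟨?_, ?_⟩, fun x hx v => by rw [(hh x hx).fderiv]⟩
  -- The potential is `C²` because its derivative is as smooth as `f`, namely `C¹`.
  · rw [show (2 : WithTop ℕ∞) = (1 : ℕ) + 1 by norm_num, contDiffAt_succ_iff_hasFDerivAt]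
    · exact ⟨fun x => conjInner (f x), ⟨unitBall, isOpen_ball.mem_nhds hx, hh⟩,
        conjInner.contDiff.contDiffAt.comp x (hf x hx).1⟩
  · filter_upwards [isOpen_ball.mem_nhds hx] with y hy
    obtain ⟨h0, -⟩ := Dbar_eq_zero_iff.1 (hf y hy).2
    rw [laplacian_eq_sum, (hfd y hy).fderiv_eq, (hω y hy).fderiv, Fin.sum_univ_three]
    change conjInner (fderiv ℝ f y (unitVec 0)) (unitVec 0)
      + conjInner (fderiv ℝ f y (unitVec 1)) (unitVec 1)
      + conjInner (fderiv ℝ f y (unitVec 2)) (unitVec 2) = 0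
    rw [conjInner_apply, conjInner_apply, conjInner_apply, ← h0]
    simp [unitVec, partialDeriv]
    ring

/-- The vector field `(0, Re c, Im c)`. -/
def fieldOf (c : E3 → ℂ) (x : E3) : E3 := !₂[0, (c x).re, (c x).im]

theorem continuous_fieldOf {c : E3 → ℂ} (hc : Continuous c) : Continuous (fieldOf c) := by
  refine (PiLp.continuous_toLp 2 _).comp (continuous_pi fun i => ?_)
  fin_cases i
  · exact continuous_const
  · exact Complex.continuous_re.comp hc
  · exact Complex.continuous_im.comp hc

theorem inner_L2_eq {F G : L2 unitBall} {f g : E3 → E3} (hF : F =ᵐ[volume.restrict unitBall] f)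
    (hG : G =ᵐ[volume.restrict unitBall] g) :
    IntegrableOn (fun x => inner ℝ (f x) (g x)) unitBall ∧
      inner ℝ F G = ∫ x in unitBall, inner ℝ (f x) (g x) := by
  have h : (fun x => inner ℝ (F x) (G x)) =ᵐ[volume.restrict unitBall]
      fun x => inner ℝ (f x) (g x) := by
    filter_upwards [hF, hG] with x hx hy
    rw [hx, hy]
  exact ⟨(MeasureTheory.L2.integrable_inner F G).congr h,
    (MeasureTheory.L2.inner_def F G).trans (integral_congr_ae h)⟩

/-- The cut-off integrals all vanish by `integral_cutoff_deriv`, and they converge to the integral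
over the ball because the inner product is integrable; the potential itself need not be. -/
theorem IsContragenicField.integral_inner_eq_zero {c : E3 → ℂ} (hc : IsContragenicField c)
    {f : E3 → E3} (hf : f ∈ monogenic unitBall)
    (hi : IntegrableOn (fun x => inner ℝ (f x) (fieldOf c x)) unitBall) :
    ∫ x in unitBall, inner ℝ (f x) (fieldOf c x) = 0 := by
  obtain ⟨h, hh, hd⟩ := exists_potential hf
  refine tendsto_nhds_unique (tendsto_integral_cutoff hi) (tendsto_const_nhds.congr fun k => ?_)
  rw [← neg_zero, ← hc.integral_cutoff_deriv hh k, ← integral_neg]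
  congr 1
  ext x
  by_cases hx : x ∈ unitBall
  · rw [hd x hx, hd x hx, conjInner_apply, conjInner_apply, inner_eq_sum]
    simp [fieldOf, unitVec]
    ring
  · simp [cutoff_eq_zero hx]

theorem fieldOf_mem_harmonic {c : E3 → ℂ} (hc : c ∈ harmonicSpan) (Ω : Set E3) :
    fieldOf c ∈ harmonic Ω := by
  intro j x _
  fin_cases j
  · exact harmonicAt_const 0
  · exact (harmonicAt_of_mem hc x).comp_CLM Complex.reCLM
  · exact (harmonicAt_of_mem hc x).comp_CLM Complex.imCLM

theorem IsContragenicField.mem_contragenic {c : E3 → ℂ} (hc : IsContragenicField c)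
    (hL : MemLp (fieldOf c) 2 (volume.restrict unitBall)) :
    hL.toLp (fieldOf c) ∈ contragenic unitBall := by
  refine ⟨⟨fieldOf c, fieldOf_mem_harmonic hc.mem _, hL.coeFn_toLp⟩, ?_⟩
  rw [← Submodule.inf_orthogonal]
  refine ⟨(Submodule.mem_orthogonal _ _).2 ?_, (Submodule.mem_orthogonal _ _).2 ?_⟩
  · rintro F ⟨f, hf, hF⟩
    obtain ⟨h1, h2⟩ := inner_L2_eq hF hL.coeFn_toLp
    rw [h2, hc.integral_inner_eq_zero hf h1]
  · rintro F ⟨_, ⟨f, hf, rfl⟩, hF⟩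
    obtain ⟨h1, h2⟩ := inner_L2_eq hF hL.coeFn_toLp
    -- The first component of the field is zero, so conjugating `f` only changes the sign.
    have he : (fun x => inner ℝ ((conjugation.compLeft E3 f) x) (fieldOf c x)) =
        fun x => -inner ℝ (f x) (fieldOf c x) := by
      ext x
      rw [inner_eq_sum, inner_eq_sum]
      simp [fieldOf, conjugation]
      ring
    rw [he] at h1 h2
    have h1' := h1.neg
    simp only [Pi.neg_def, neg_neg] at h1'
    rw [h2, integral_neg, hc.integral_inner_eq_zero hf h1', neg_zero]

/-- The conjugate of the gradient of `q`. -/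
def conjGrad (q : E3 → ℝ) (x : E3) : E3 :=
  !₂[fderiv ℝ q x (unitVec 0), -fderiv ℝ q x (unitVec 1), -fderiv ℝ q x (unitVec 2)]

theorem contDiff_conjGrad {q : E3 → ℝ} (hq : ContDiff ℝ 2 q) : ContDiff ℝ 1 (conjGrad q) := by
  have h (i : Fin 3) : ContDiff ℝ 1 fun x => fderiv ℝ q x (unitVec i) :=
    (hq.fderiv_right (by norm_num)).clm_apply contDiff_const
  rw [contDiff_euclidean]
  intro i
  fin_cases i
  · exact h 0
  · exact (h 1).neg
  · exact (h 2).neg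

theorem partialDeriv_conjGrad {q : E3 → ℝ} (hq : ContDiff ℝ 2 q) (i j : Fin 3) (x : E3) :
    partialDeriv i (conjGrad q) x j =
      (if j = 0 then 1 else -1) * fderiv ℝ (fderiv ℝ q) x (unitVec i) (unitVec j) := by
  have hd : HasFDerivAt (conjGrad q) (fderiv ℝ (conjGrad q) x) x :=
    ((contDiff_conjGrad hq).differentiable (by norm_num) x).hasFDerivAt
  have h1 : HasFDerivAt (fun x => conjGrad q x j)
      ((EuclideanSpace.proj j : E3 →L[ℝ] ℝ).comp (fderiv ℝ (conjGrad q) x)) x :=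
    (EuclideanSpace.proj j : E3 →L[ℝ] ℝ).hasFDerivAt.comp x hd
  have h2 : HasFDerivAt (fun x => fderiv ℝ q x (unitVec j))
      ((fderiv ℝ (fderiv ℝ q) x).flip (unitVec j)) x := by
    have h := ((hq.fderiv_right (m := 1) (by norm_num)).differentiable (by norm_num) x).hasFDerivAt
    exact (h.clm_apply (hasFDerivAt_const (unitVec j) x)).congr_fderiv (by ext; simp)
  have h3 : HasFDerivAt (fun x => conjGrad q x j)
      ((if j = 0 then 1 else -1 : ℝ) • (fderiv ℝ (fderiv ℝ q) x).flip (unitVec j)) x := by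
    have : (fun x => conjGrad q x j) =
        fun x => (if j = 0 then 1 else -1 : ℝ) * fderiv ℝ q x (unitVec j) := by
      ext x
      fin_cases j <;> simp [conjGrad]
    rw [this]
    exact h2.const_mul _
  have := congrArg (fun A : E3 →L[ℝ] ℝ => A (unitVec i)) (h1.unique h3)
  exact this

theorem conjGrad_mem_monogenic {q : E3 → ℝ} (hq : ContDiff ℝ 2 q) (hΔ : ∀ x, Δ q x = 0)
    (Ω : Set E3) : conjGrad q ∈ monogenic Ω := by
  intro x _
  refine ⟨(contDiff_conjGrad hq).contDiffAt, Dbar_eq_zero_iff.2 ?_⟩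
  have hs : IsSymmSndFDerivAt ℝ q x := hq.contDiffAt.isSymmSndFDerivAt (by simp)
  have hl := hΔ x
  rw [laplacian_eq_sum, Fin.sum_univ_three] at hl
  simp only [partialDeriv_conjGrad hq]
  have s1 := hs (unitVec 0) (unitVec 1)
  have s2 := hs (unitVec 0) (unitVec 2)
  have s3 := hs (unitVec 1) (unitVec 2)
  simp only [one_ne_zero, if_true, if_false, Fin.isValue, show (2 : Fin 3) ≠ 0 by decide]
  refine ⟨?_, ?_, ?_, ?_⟩
  · linear_combination hl
  · linear_combination -s1
  · linear_combination -s2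
  · linear_combination -s3

/-! ### Closedness of weak harmonicity and moments of a field -/

theorem memLp_apply (F : L2 unitBall) (i : Fin 3) :
    MemLp (fun x => (F x i : ℂ)) 2 (volume.restrict unitBall) :=
  ((Lp.memLp F).continuousLinearMap_comp (EuclideanSpace.proj i : E3 →L[ℝ] ℝ)).ofReal

theorem inner_toLp_smul_unitVec {r : E3 → ℝ} {i : Fin 3}
    (hr : MemLp (fun x => r x • unitVec i) 2 (volume.restrict unitBall)) (F : L2 unitBall) :
    inner ℝ (hr.toLp _) F = ∫ x in unitBall, r x * F x i := by
  rw [(inner_L2_eq hr.coeFn_toLp (EventuallyEq.refl _ F)).2]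
  refine integral_congr_ae (Eventually.of_forall fun x => ?_)
  simp [unitVec, inner_smul_left, EuclideanSpace.inner_single_left]

theorem memLp_smul_unitVec {r : E3 → ℝ} (hr : MemLp r 2 (volume.restrict unitBall)) (i : Fin 3) :
    MemLp (fun x => r x • unitVec i) 2 (volume.restrict unitBall) :=
  hr.continuousLinearMap_comp ((ContinuousLinearMap.id ℝ ℝ).smulRight (unitVec i))

/-- The functional `F ↦ ∫ v Fᵢ` on `L₂` of the unit ball. -/
def pairing {v : E3 → ℂ} (hv : MemLp v 2 (volume.restrict unitBall)) (i : Fin 3) :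
    L2 unitBall →L[ℝ] ℂ :=
  Complex.ofRealCLM.comp (innerSL ℝ ((memLp_smul_unitVec hv.re i).toLp _))
    + Complex.I • Complex.ofRealCLM.comp (innerSL ℝ ((memLp_smul_unitVec hv.im i).toLp _))

theorem pairing_apply {v : E3 → ℂ} (hv : MemLp v 2 (volume.restrict unitBall)) (i : Fin 3)
    (F : L2 unitBall) : pairing hv i F = ∫ x in unitBall, v x * F x i := by
  have h1 : Integrable (fun x => ((((v x).re : ℝ) : ℂ) * F x i)) (volume.restrict unitBall) :=
    hv.re.ofReal.integrable_mul (memLp_apply F i)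
  have h2 : Integrable (fun x => ((((v x).im : ℝ) : ℂ) * F x i)) (volume.restrict unitBall) :=
    hv.im.ofReal.integrable_mul (memLp_apply F i)
  change ((inner ℝ _ F : ℝ) : ℂ) + Complex.I * ((inner ℝ _ F : ℝ) : ℂ) = _
  rw [inner_toLp_smul_unitVec, inner_toLp_smul_unitVec, ← integral_complex_ofReal,
    ← integral_complex_ofReal]
  simp only [RCLike.re_eq_complex_re, RCLike.im_eq_complex_im, Complex.ofReal_mul]
  rw [← integral_const_mul, ← integral_add h1 (h2.const_mul _)]
  congr 1
  ext x
  linear_combination (F x i : ℂ) * Complex.re_add_im (v x)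

/-- The elements of `L₂` of the unit ball with weakly harmonic components. -/
def weaklyHarmonic : Submodule ℝ (L2 unitBall) :=
  ⨅ (i : Fin 3) (ρ : ℝ) (_ : ρ < 1) (v : E3 → ℂ) (hv : MemLp v 2 (volume.restrict unitBall))
    (_ : ∀ x, x ∉ closedBall (0 : E3) ρ → v x = 0)
    (_ : ∀ n m, ∫ x in unitBall, v x * solidHarmonic n m x = 0),
    LinearMap.ker (pairing hv i : L2 unitBall →ₗ[ℝ] ℂ)

theorem mem_weaklyHarmonic {F : L2 unitBall} :
    F ∈ weaklyHarmonic ↔ ∀ i, IsWeaklyHarmonic fun x => F x i := by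
  simp only [weaklyHarmonic, Submodule.mem_iInf, LinearMap.mem_ker, IsWeaklyHarmonic,
    ContinuousLinearMap.coe_coe, pairing_apply]

/-- An intersection of kernels of continuous functionals. This replaces the fact that `L₂` limits of
harmonic functions are harmonic. -/
theorem isClosed_weaklyHarmonic : IsClosed (weaklyHarmonic : Set (L2 unitBall)) := by
  simp only [weaklyHarmonic, Submodule.coe_iInf]
  refine isClosed_iInter fun i => isClosed_iInter fun ρ => isClosed_iInter fun _ =>
    isClosed_iInter fun v => isClosed_iInter fun hv => isClosed_iInter fun _ =>
    isClosed_iInter fun _ => (pairing hv i).isClosed_ker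

theorem interL2_harmonic_le : interL2 (harmonic unitBall) unitBall ≤ weaklyHarmonic := by
  rintro F ⟨f, hf, hF⟩
  refine mem_weaklyHarmonic.2 fun i ρ hρ v hv hs h => ?_
  rw [← isWeaklyHarmonic_of_harmonicOnNhd (hf i) ρ hρ v hv hs h]
  refine integral_congr_ae ?_
  filter_upwards [hF] with x hx
  rw [hx]

theorem inner_toLp_eq_re {f : E3 → E3} (hf : MemLp f 2 (volume.restrict unitBall))
    {v : Fin 3 → E3 → ℂ} (hv : ∀ i, MemLp (v i) 2 (volume.restrict unitBall))
    (h : ∀ x i, f x i = (v i x).re) (F : L2 unitBall) :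
    inner ℝ (hf.toLp f) F = (∑ i, ∫ x in unitBall, v i x * F x i).re := by
  have hi (i : Fin 3) : Integrable (fun x => v i x * (F x i : ℂ)) (volume.restrict unitBall) :=
    (hv i).integrable_mul (memLp_apply F i)
  rw [(inner_L2_eq hf.coeFn_toLp (EventuallyEq.refl _ F)).2, ← integral_finsetSum _ fun i _ => hi i]
  refine Eq.trans ?_ (integral_re (integrable_finsetSum _ fun i _ => hi i))
  refine integral_congr_ae (Eventually.of_forall fun x => ?_)
  simp only [RCLike.re_eq_complex_re, inner_eq_sum, h, Fin.sum_univ_three]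
  simp

/-- The integral of the `i`-th component of `F` against a solid spherical harmonic. -/
def coeff (F : L2 unitBall) (i : Fin 3) (n : ℕ) (k : ℤ) : ℂ :=
  ∫ x in unitBall, solidHarmonic n k x * F x i

theorem conj_coeff (F : L2 unitBall) (i : Fin 3) (n : ℕ) (k : ℤ) :
    conj (coeff F i n k) = (-1) ^ k * coeff F i n (-k) := by
  rw [coeff, coeff, ← integral_conj, ← integral_const_mul]
  congr 1
  ext x
  rw [map_mul, conj_solidHarmonic, Complex.conj_ofReal, mul_assoc]

theorem coeff_eq_zero (F : L2 unitBall) (i : Fin 3) {n : ℕ} {k : ℤ} (h : n < k.natAbs) :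
    coeff F i n k = 0 := by
  simp [coeff, solidHarmonic_eq_zero n h]

theorem integral_combination (F : L2 unitBall) (i : Fin 3) (n : ℕ) (a b : ℂ) (k l : ℤ) :
    ∫ x in unitBall, (a * solidHarmonic n k x + b * solidHarmonic n l x) * F x i =
      a * coeff F i n k + b * coeff F i n l := by
  have h (k : ℤ) : Integrable (fun x => solidHarmonic n k x * (F x i : ℂ))
      (volume.restrict unitBall) :=
    (memLp_unitBall (continuous_solidHarmonic n k)).integrable_mul (memLp_apply F i)
  rw [coeff, coeff, ← integral_const_mul, ← integral_const_mul,
    ← integral_add ((h k).const_mul a) ((h l).const_mul b)]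
  congr 1
  ext x
  ring

/-- The moment `∫ (F₁ + i F₂) w`. -/
def coeffC (F : L2 unitBall) (n : ℕ) (k : ℤ) : ℂ := coeff F 1 n k + Complex.I * coeff F 2 n k

/-- The moment `∫ (F₁ - i F₂) w`. -/
def coeffD (F : L2 unitBall) (n : ℕ) (k : ℤ) : ℂ := coeff F 1 n k - Complex.I * coeff F 2 n k

theorem coeffD_eq_conj (F : L2 unitBall) (n : ℕ) (k : ℤ) :
    coeffD F n k = (-1) ^ k * conj (coeffC F n (-k)) := by
  have h : ((-1 : ℂ) ^ k) * (-1) ^ (-k) = 1 := by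
    rw [← zpow_add₀ (by norm_num), add_neg_cancel, zpow_zero]
  rw [coeffC, map_add, map_mul, conj_coeff, conj_coeff, neg_neg, Complex.conj_I, coeffD]
  linear_combination (-coeff F 1 n k + Complex.I * coeff F 2 n k) * h

theorem fderiv_solidHarmonic_unitVec (n : ℕ) (j : ℤ) (i : Fin 3) (x : E3) :
    fderiv ℝ (solidHarmonic (n + 1) j) x (unitVec i) = ![solidHarmonic n j x,
      1 / 2 * solidHarmonic n (j - 1) x - 1 / 2 * solidHarmonic n (j + 1) x,
      Complex.I / 2 * solidHarmonic n (j - 1) x + Complex.I / 2 * solidHarmonic n (j + 1) x] i := by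
  rw [fderiv_solidHarmonic, solidHarmonicDeriv_apply]
  fin_cases i <;> (simp [axial_unitVec, zeta_unitVec]; try ring)

/-- The relations between the moments of `F` expressing that `F` is orthogonal to the monogenic
polynomials and their conjugates. -/
theorem coeff_of_mem_orthogonal {F : L2 unitBall}
    (hF : F ∈ (interL2 (monogenic unitBall) unitBall ⊔ interL2 (conjMonogenic unitBall) unitBall)ᗮ)
    (n : ℕ) (j : ℤ) : coeff F 0 n j = 0 ∧ coeffC F n (j - 1) = coeffD F n (j + 1) := by
  rw [← Submodule.inf_orthogonal] at hF
  obtain ⟨h1, h2⟩ := hF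
  set A := coeff F 0 n j with hA
  set B := (1 / 2 : ℂ) * coeffC F n (j - 1) - 1 / 2 * coeffD F n (j + 1) with hB
  -- Testing with the conjugate gradient of `Re (a W (n+1) j)` gives `A - B`, and testing with its
  -- conjugate gives `A + B`. The scalars `a = 1` and `a = -i` then recover real and imaginary
  -- parts.
  have key (a : ℂ) : (a * (A - B)).re = 0 ∧ (a * (A + B)).re = 0 := by
    have hd := contDiff_solidHarmonic (n + 1) j 2
    let q : E3 → ℝ := fun x => (a * solidHarmonic (n + 1) j x).re
    have hq : ContDiff ℝ 2 q := Complex.reCLM.contDiff.comp (contDiff_const.mul hd)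
    have hqm : (fun x => a * solidHarmonic (n + 1) j x) ∈ harmonicSpan :=
      harmonicSpan.smul_mem a (solidHarmonic_mem (n + 1) j)
    have hqΔ (x : E3) : Δ q x = 0 :=
      ((harmonicAt_of_mem hqm x).comp_CLM Complex.reCLM).2.eq_of_nhds
    have hqd (x : E3) (i : Fin 3) : fderiv ℝ q x (unitVec i) =
        (a * fderiv ℝ (solidHarmonic (n + 1) j) x (unitVec i)).re := by
      have h0 := ((hd.differentiable (by norm_num) x).hasFDerivAt).const_mul a
      have h := (Complex.reCLM.hasFDerivAt (x := a * solidHarmonic (n + 1) j x)).comp x h0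
      rw [show fderiv ℝ q x = _ from h.fderiv]
      rfl
    have hv (s : Fin 3 → ℂ) (i : Fin 3) :
        Continuous fun x => s i * fderiv ℝ (solidHarmonic (n + 1) j) x (unitVec i) :=
      continuous_const.mul ((hd.continuous_fderiv (by norm_num)).clm_apply continuous_const)
    have hcg := (contDiff_conjGrad hq).continuous
    have hcc : Continuous (conjugation.compLeft E3 (conjGrad q)) :=
      (LinearMap.continuous_of_finiteDimensional conjugation).comp hcg
    have hmem := conjGrad_mem_monogenic hq hqΔ unitBall
    have e1 := h1 ((memLp_unitBall hcg).toLp _) ⟨_, hmem, MemLp.coeFn_toLp _⟩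
    have e2 := h2 ((memLp_unitBall hcc).toLp _) ⟨_, ⟨_, hmem, rfl⟩, MemLp.coeFn_toLp _⟩
    rw [inner_toLp_eq_re _ (fun i => memLp_unitBall (hv ![a, -a, -a] i)) (fun x i => by
      fin_cases i <;> simp [conjGrad, hqd])] at e1
    rw [inner_toLp_eq_re _ (fun i => memLp_unitBall (hv ![a, a, a] i)) (fun x i => by
      fin_cases i <;> simp [conjGrad, hqd, conjugation])] at e2
    simp only [mul_assoc, integral_const_mul, Fin.sum_univ_three, fderiv_solidHarmonic_unitVec,
      Matrix.cons_val_zero, Matrix.cons_val_one, Matrix.cons_val] at e1 e2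
    have i1 := integral_combination F 1 n (1 / 2) (-(1 / 2)) (j - 1) (j + 1)
    simp only [neg_mul, ← sub_eq_add_neg] at i1
    rw [i1, integral_combination] at e1 e2
    change (a * A + _ + _).re = 0 at e1
    change (a * A + _ + _).re = 0 at e2
    constructor
    · rw [← e1, hB, coeffC, coeffD]
      ring_nf
    · rw [← e2, hB, coeffC, coeffD]
      ring_nf
  have k1 := key 1
  have k2 := key (-Complex.I)
  simp at k1 k2
  have hA0 : A = 0 := Complex.ext (by simp; linarith [k1.1, k1.2]) (by simp; linarith [k2.1, k2.2])
  have hB0 : B = 0 := Complex.ext (by simp; linarith [k1.1, k1.2]) (by simp; linarith [k2.1, k2.2])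
  exact ⟨hA0, by linear_combination 2 * hB0⟩

theorem inner_fieldOf {c : E3 → ℂ} (hc : MemLp (fieldOf c) 2 (volume.restrict unitBall))
    {n : ℕ} {a b : ℂ} {k l : ℤ} (h : ∀ x, c x = a * solidHarmonic n k x + b * solidHarmonic n l x)
    (F : L2 unitBall) :
    inner ℝ (hc.toLp _) F = (a * coeffD F n k + b * coeffD F n l).re := by
  have hcont (s : ℂ) : Continuous fun x =>
      s * a * solidHarmonic n k x + s * b * solidHarmonic n l x :=
    (continuous_const.mul (continuous_solidHarmonic n k)).add
      (continuous_const.mul (continuous_solidHarmonic n l))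
  rw [inner_toLp_eq_re hc (fun i => memLp_unitBall (hcont (![0, 1, -Complex.I] i))) (fun x i => by
    rw [mul_assoc, mul_assoc, ← mul_add, ← h]
    fin_cases i <;> simp [fieldOf])]
  simp only [integral_combination, Fin.sum_univ_three, Matrix.cons_val_zero, Matrix.cons_val_one,
    Matrix.cons_val]
  congr 1
  rw [coeffD, coeffD]
  ring

theorem eq_zero_of_coeff {F : L2 unitBall} (hF : F ∈ weaklyHarmonic)
    (h : ∀ i n k, coeff F i n k = 0) : F = 0 := by
  have h0 (i : Fin 3) : (fun x => F x i) =ᵐ[volume.restrict unitBall] 0 := by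
    refine (mem_weaklyHarmonic.1 hF i).ae_eq_zero
      ((Lp.memLp F).continuousLinearMap_comp (EuclideanSpace.proj i : E3 →L[ℝ] ℝ)) fun n k => ?_
    rw [← h i n k, coeff]
    simp only [mul_comm]
  rw [Lp.eq_zero_iff_ae_eq_zero]
  filter_upwards [h0 0, h0 1, h0 2] with x hx0 hx1 hx2
  ext i
  fin_cases i
  · exact hx0
  · exact hx1
  · exact hx2

/-! ### Basic contragenic fields -/

/-- A solid spherical harmonic multiplied by this factor pairs with its conjugate to a number
that does not depend on the order. -/
def factorialPair (n : ℕ) (k : ℤ) : ℂ := (invFactorial (n + k) * invFactorial (n - k))⁻¹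

theorem factorialPair_eq {n : ℕ} {k : ℤ} {a b : ℕ} (ha : n + k = a) (hb : n - k = b) :
    factorialPair n k = a.factorial * b.factorial := by
  rw [factorialPair, ha, hb, invFactorial_natCast, invFactorial_natCast, mul_inv, inv_inv, inv_inv]

theorem factorialPair_neg (n : ℕ) (k : ℤ) : factorialPair n (-k) = factorialPair n k := by
  rw [factorialPair, factorialPair, sub_neg_eq_add, ← sub_eq_add_neg, mul_comm]

theorem factorialPair_mul {n : ℕ} {k : ℤ} (h : k.natAbs ≤ n) :
    factorialPair n k * (invFactorial (n + k) * invFactorial (n - k)) = 1 := by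
  obtain ⟨a, ha⟩ : ∃ a : ℕ, (n + k : ℤ) = a := ⟨(n + k).toNat, by omega⟩
  obtain ⟨b, hb⟩ : ∃ b : ℕ, (n - k : ℤ) = b := ⟨(n - k).toNat, by omega⟩
  refine inv_mul_cancel₀ ?_
  rw [ha, hb, invFactorial_natCast, invFactorial_natCast]
  have := a.factorial_ne_zero
  have := b.factorial_ne_zero
  simp_all

theorem IsWeight.integral_combination {ω : E3 → ℝ} (hω : IsWeight ω) {n : ℕ} {k l : ℤ}
    (hk : k.natAbs ≤ n) (hl : l.natAbs ≤ n) (a b : ℂ) (n' : ℕ) (j : ℤ) :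
    ∫ x, (ω x : ℂ) * ((a * factorialPair n k * solidHarmonic n k x +
      b * factorialPair n l * solidHarmonic n l x) * solidHarmonic n' j x) =
      if n = n' then ((if k + j = 0 then (-1) ^ k * a else 0) +
        if l + j = 0 then (-1) ^ l * b else 0) * (moment ω n / (2 * n + 1)) else 0 := by
  have h (k : ℤ) : HasIntegral volume (fun x => (ω x : ℂ) *
      (solidHarmonic n k x * solidHarmonic n' j x)) _ :=
    ⟨hω.integrable _ ((continuous_solidHarmonic _ _).mul (continuous_solidHarmonic _ _)),
      hω.integral_mul n n' k j⟩
  refine Eq.trans ?_ (((h k).const_mul (a * factorialPair n k)).add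
    ((h l).const_mul (b * factorialPair n l))).2 |>.trans ?_
  · congr 1
    ext x
    ring
  · have h1 := factorialPair_mul hk
    have h2 := factorialPair_mul hl
    by_cases hn : n = n'
    · simp only [hn, true_and, if_true] at h1 h2 ⊢
      split_ifs
      · linear_combination ((-1) ^ k * a * (moment ω n' / (2 * n' + 1))) * h1
          + ((-1) ^ l * b * (moment ω n' / (2 * n' + 1))) * h2
      · linear_combination ((-1) ^ k * a * (moment ω n' / (2 * n' + 1))) * h1
      · linear_combination ((-1) ^ l * b * (moment ω n' / (2 * n' + 1))) * h2
      · ring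
    · simp [hn]

theorem neg_one_zpow_eq (m : ℕ) : (-1 : ℂ) ^ (1 - m : ℤ) = -(-1) ^ m ∧
    (-1 : ℂ) ^ (1 + m : ℤ) = -(-1) ^ m ∧ (-1 : ℂ) ^ (m - 1 : ℤ) = -(-1) ^ m ∧
    (-1 : ℂ) ^ (-1 - m : ℤ) = -(-1) ^ m ∧ (-1 : ℂ) ^ m * (-1) ^ m = 1 := by
  have h : (-1 : ℂ) ≠ 0 := by norm_num
  rw [zpow_sub₀ h, zpow_add₀ h, zpow_sub₀ h, zpow_sub₀ h, zpow_natCast]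
  rcases neg_one_pow_eq_or ℂ m with h | h <;> simp [h]

/-- The function `c` with values `f₁ + i f₂`, for a basic contragenic field `f = (0, f₁, f₂)` of
degree `n` and order `m`. -/
def fieldCoord (n m : ℕ) (α : ℂ) (x : E3) : ℂ :=
  α * (-1) ^ (1 - m : ℤ) * factorialPair n (1 - m) * solidHarmonic n (1 - m) x
    + conj α * factorialPair n (1 + m) * solidHarmonic n (1 + m) x

theorem conj_factorialPair {n : ℕ} {k : ℤ} (hk : k.natAbs ≤ n) :
    conj (factorialPair n k) = factorialPair n k := by
  obtain ⟨a, ha⟩ : ∃ a : ℕ, (n + k : ℤ) = a := ⟨(n + k).toNat, by omega⟩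
  obtain ⟨b, hb⟩ : ∃ b : ℕ, (n - k : ℤ) = b := ⟨(n - k).toNat, by omega⟩
  rw [factorialPair_eq ha hb]
  simp

theorem conj_fieldCoord {n m : ℕ} (h : m + 1 ≤ n) (α : ℂ) (x : E3) :
    conj (fieldCoord n m α x) =
      conj α * factorialPair n (m - 1) * solidHarmonic n (m - 1) x
      + α * (-1) ^ (1 + m : ℤ) * factorialPair n (-1 - m) * solidHarmonic n (-1 - m) x := by
  obtain ⟨h1, h2, -, -, h5⟩ := neg_one_zpow_eq m
  have e1 : (-(1 - m) : ℤ) = m - 1 := by ring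
  have e2 : (-(1 + m) : ℤ) = -1 - m := by ring
  simp only [fieldCoord, map_add, map_mul, conj_solidHarmonic,
    conj_factorialPair (show (1 - m : ℤ).natAbs ≤ n by omega),
    conj_factorialPair (show (1 + m : ℤ).natAbs ≤ n by omega), Complex.conj_conj]
  rw [← factorialPair_neg n (1 - m), ← factorialPair_neg n (1 + m), e1, e2, h1, h2]
  simp only [map_neg, map_pow, map_one]
  linear_combination (conj α * factorialPair n (m - 1) * solidHarmonic n (m - 1) x) * h5

theorem continuous_fieldCoord (n m : ℕ) (α : ℂ) : Continuous (fieldCoord n m α) :=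
  (continuous_const.mul (continuous_solidHarmonic _ _)).add
    (continuous_const.mul (continuous_solidHarmonic _ _))

/-- Order `1 - m` pairs with `j - 1` only for `j = m`, and order `1 + m` only for `j = -m`. For `m =
0` both contributions occur at once, which is why they are added. -/
theorem IsWeight.integral_fieldCoord_mul {ω : E3 → ℝ} (hω : IsWeight ω) {n m : ℕ} (h : m + 1 ≤ n)
    (α : ℂ) (n' : ℕ) (j : ℤ) :
    ∫ x, (ω x : ℂ) * (fieldCoord n m α x * solidHarmonic n' (j - 1) x) =
      if n = n' then ((if j = m then α else 0) + if j = -m then -(-1) ^ m * conj α else 0) *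
        (moment ω n / (2 * n + 1)) else 0 := by
  obtain ⟨h1, h2, -, -, h5⟩ := neg_one_zpow_eq m
  unfold fieldCoord
  rw [hω.integral_combination (by omega) (by omega),
    if_congr (show (1 - m + (j - 1) : ℤ) = 0 ↔ j = m by omega) rfl rfl,
    if_congr (show (1 + m + (j - 1) : ℤ) = 0 ↔ j = -m by omega) rfl rfl, h1, h2]
  rw [show -(-1 : ℂ) ^ m * (α * -(-1) ^ m) = α by linear_combination α * h5]

/-- Conjugation exchanges the two terms of `fieldCoord`: the integrals at `j = m` and `j = -m` are
then produced by the opposite terms, with the same values. The signs and factorials in `fieldCoord`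
are chosen for this. -/
theorem isContragenicField_fieldCoord {n m : ℕ} (h : m + 1 ≤ n) (α : ℂ) :
    IsContragenicField (fieldCoord n m α) where
  mem := harmonicSpan.add_mem (harmonicSpan.smul_mem _ (solidHarmonic_mem _ _))
    (harmonicSpan.smul_mem _ (solidHarmonic_mem _ _))
  integral_eq ω hω n' j := by
    obtain ⟨h1, h2, h3, h4, h5⟩ := neg_one_zpow_eq m
    rw [hω.integral_fieldCoord_mul h]
    simp only [conj_fieldCoord h]
    rw [hω.integral_combination (by omega) (by omega),
      if_congr (show (m - 1 + (j + 1) : ℤ) = 0 ↔ j = -m by omega) rfl rfl,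
      if_congr (show (-1 - m + (j + 1) : ℤ) = 0 ↔ j = m by omega) rfl rfl, h2, h3, h4]
    rw [show -(-1 : ℂ) ^ m * (α * -(-1) ^ m) = α by linear_combination α * h5]
    congr 2
    rw [add_comm]

/-- The factor relating inner products with a basic contragenic field to moments. -/
def fieldFactor (m l : ℕ) : ℕ :=
  (2 * m + l).factorial * (l + 2).factorial + (2 * m + 2 + l).factorial * l.factorial

theorem fieldFactor_pos (m l : ℕ) : 0 < fieldFactor m l := by
  unfold fieldFactor
  positivity

/-- The inner product involves the moments `coeffD` at `1 - m` and `1 + m`. The first is conjugate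
to `coeffC` at `m - 1` for every `F`, the second equals it by orthogonality to monogenic functions,
so a single complex number survives. -/
theorem inner_fieldCoord {n m l : ℕ} (h : n = m + 1 + l) (α : ℂ)
    (hc : MemLp (fieldOf (fieldCoord n m α)) 2 (volume.restrict unitBall)) {F : L2 unitBall}
    (hF : F ∈ (interL2 (monogenic unitBall) unitBall ⊔
      interL2 (conjMonogenic unitBall) unitBall)ᗮ) :
    inner ℝ (hc.toLp _) F = fieldFactor m l * (conj α * coeffC F n (m - 1)).re := by
  obtain ⟨h1, h2, -, -, h5⟩ := neg_one_zpow_eq m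
  rw [inner_fieldOf hc (fun x => rfl), coeffD_eq_conj F n (1 - m),
    show (1 + m : ℤ) = m + 1 by ring, ← (coeff_of_mem_orthogonal hF n m).2, h1,
    show (-(1 - m) : ℤ) = m - 1 by ring,
    factorialPair_eq (k := m + 1) (a := 2 * m + 2 + l) (b := l) (by omega) (by omega),
    factorialPair_eq (k := 1 - m) (a := l + 2) (b := 2 * m + l) (by omega) (by omega)]
  generalize coeffC F n (m - 1) = C
  rw [show α * -(-1) ^ m * (((l + 2).factorial : ℂ) * (2 * m + l).factorial) * (-(-1) ^ m * conj C) +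
      conj α * (((2 * m + 2 + l).factorial : ℂ) * l.factorial) * C =
      (((l + 2).factorial * (2 * m + l).factorial : ℝ) : ℂ) * (α * conj C) +
      (((2 * m + 2 + l).factorial * l.factorial : ℝ) : ℂ) * (conj α * C) by
    push_cast
    linear_combination (((l + 2).factorial : ℂ) * (2 * m + l).factorial * (α * conj C)) * h5,
    Complex.add_re, Complex.re_ofReal_mul, Complex.re_ofReal_mul, fieldFactor]
  push_cast
  simp
  ring

theorem coeffC_toLp {c : E3 → ℂ} (hc : Continuous c)
    (hL : MemLp (fieldOf c) 2 (volume.restrict unitBall)) (n : ℕ) (k : ℤ) :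
    coeffC (hL.toLp _) n k = ∫ x, (ballWeight x : ℂ) * (c x * solidHarmonic n k x) := by
  have h (i : Fin 3) : coeff (hL.toLp _) i n k =
      ∫ x in unitBall, solidHarmonic n k x * (fieldOf c x i : ℂ) := by
    refine integral_congr_ae ?_
    filter_upwards [hL.coeFn_toLp] with x hx
    rw [hx]
  have hw := continuous_solidHarmonic n k
  have h1 : IntegrableOn (fun x => solidHarmonic n k x * ((c x).re : ℂ)) unitBall :=
    integrableOn_unitBall (hw.mul (Complex.continuous_ofReal.comp (Complex.continuous_re.comp hc)))
  have h2 : IntegrableOn (fun x => solidHarmonic n k x * ((c x).im : ℂ)) unitBall :=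
    integrableOn_unitBall (hw.mul (Complex.continuous_ofReal.comp (Complex.continuous_im.comp hc)))
  rw [integral_ballWeight_mul, coeffC, h, h]
  change (∫ x in unitBall, solidHarmonic n k x * ((c x).re : ℂ))
    + Complex.I * ∫ x in unitBall, solidHarmonic n k x * ((c x).im : ℂ) = _
  rw [← integral_const_mul, ← integral_add h1 (h2.const_mul _)]
  congr 1
  ext x
  linear_combination (solidHarmonic n k x) * Complex.re_add_im (c x)

/-- The second field plays the role of `F` in `inner_fieldCoord`. The term `conj α'` appears for `m
= 0` because the orders `m` and `-m` then coincide. -/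
theorem inner_fieldCoord_fieldCoord {n m l n' m' : ℕ} (h : n = m + 1 + l) (h' : m' + 1 ≤ n')
    (α α' : ℂ) (hc : MemLp (fieldOf (fieldCoord n m α)) 2 (volume.restrict unitBall))
    (hc' : MemLp (fieldOf (fieldCoord n' m' α')) 2 (volume.restrict unitBall)) :
    inner ℝ (hc.toLp _) (hc'.toLp _) = if n' = n ∧ m' = m then
      fieldFactor m l * (4 * Real.pi / ((2 * n + 1) * (2 * n + 3))) *
        (conj α * (α' - if m = 0 then conj α' else 0)).re else 0 := by
  rw [inner_fieldCoord h α hc ((isContragenicField_fieldCoord h' α').mem_contragenic hc').2,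
    coeffC_toLp (continuous_fieldCoord _ _ _), isWeight_ballWeight.integral_fieldCoord_mul h',
    moment_ballWeight]
  by_cases hn : n' = n
  · subst hn
    by_cases hm : m' = m
    · subst hm
      have e : (((4 * Real.pi / (2 * n' + 3) : ℝ) : ℂ) / (2 * n' + 1)) =
          ((4 * Real.pi / ((2 * n' + 1) * (2 * n' + 3)) : ℝ) : ℂ) := by
        push_cast
        rw [div_div, mul_comm (2 * (n' : ℂ) + 3)]
      rw [if_pos rfl, if_pos (show (m' : ℤ) = m' from rfl),
        if_pos (show n' = n' ∧ m' = m' from ⟨rfl, rfl⟩), e, ← mul_assoc, mul_comm _ (Complex.ofReal _),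
        Complex.re_ofReal_mul, ← mul_assoc]
      congr 3
      by_cases h0 : m' = 0
      · subst h0
        simp [sub_eq_add_neg]
      · rw [if_neg (show ¬ (m' : ℤ) = -m' by omega), if_neg h0]
        simp
    · rw [if_neg (show ¬ (m : ℤ) = m' by omega), if_neg (show ¬ (m : ℤ) = -m' by omega),
        if_neg (show ¬ (n' = n' ∧ m' = m) by tauto)]
      simp
  · simp [hn]

/-! ### The family `Z`: identification, orthogonality and norms -/

/-- The degree of a member of the family. -/
def Index.degree : Index → ℕ
  | .zero n _ => n
  | .plus n _ _ _ => n
  | .minus n _ _ _ => n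

/-- The order of a member of the family. -/
def Index.order : Index → ℕ
  | .zero _ _ => 0
  | .plus _ m _ _ => m
  | .minus _ m _ _ => m

/-- The amplitude of a member of the family. -/
def Index.amplitude : Index → ℂ
  | .zero n _ => Complex.I * (((2 * (n - 1).factorial : ℕ) : ℝ)⁻¹ : ℝ)
  | .plus n m _ _ => Complex.I * ((((n - m - 1).factorial : ℕ) : ℝ)⁻¹ : ℝ)
  | .minus n m _ _ => ((((n - m - 1).factorial : ℕ) : ℝ)⁻¹ : ℝ)

theorem Index.order_lt (i : Index) : i.order + 1 ≤ i.degree := by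
  cases i with
  | zero n hn => simpa [order, degree] using hn
  | plus n m hm hmn => exact hmn
  | minus n m hm hmn => exact hmn

theorem solidHarmonic_eq_solid {n : ℕ} (hn : n ≠ 0) (m : ℕ) (x : E3) :
    solidHarmonic n m x =
      ((n + m).factorial : ℂ)⁻¹ * (solidU n m x + solidV n m x * Complex.I) := by
  rw [solid_eq_solidHarmonic hn, ← mul_assoc, inv_mul_cancel₀, one_mul]
  exact_mod_cast (n + m).factorial_ne_zero

theorem solidHarmonic_neg_eq_solid {n : ℕ} (hn : n ≠ 0) (m : ℕ) (x : E3) :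
    (-1) ^ m * solidHarmonic n (-m) x =
      ((n + m).factorial : ℂ)⁻¹ * (solidU n m x - solidV n m x * Complex.I) := by
  rw [← zpow_natCast, ← conj_solidHarmonic, solidHarmonic_eq_solid hn]
  simp [sub_eq_add_neg]

/-- For `m = 0` both terms have order `1` and add up to a multiple of `α - conj α`. Only the
imaginary part of `α` counts, and it counts twice; hence one field instead of two and the factor `2`
in the amplitude. -/
theorem fieldCoord_zero (l : ℕ) (x : E3) :
    fieldCoord (l + 1) 0 (Complex.I * (((2 * l.factorial : ℕ) : ℝ)⁻¹ : ℝ)) x =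
      solidV (l + 1) 1 x - solidU (l + 1) 1 x * Complex.I := by
  rw [fieldCoord]
  simp only [Nat.cast_zero, sub_zero, add_zero]
  rw [show ((1 : ℤ)) = ((1 : ℕ) : ℤ) by norm_num, solidHarmonic_eq_solid (by omega),
    factorialPair_eq (k := ((1 : ℕ) : ℤ)) (a := l + 2) (b := l) (by omega) (by omega),
    show l + 1 + 1 = l + 2 by ring]
  have h1 : (((l + 2).factorial : ℕ) : ℂ) ≠ 0 := by exact_mod_cast Nat.factorial_ne_zero _
  have h2 : ((l.factorial : ℕ) : ℂ) ≠ 0 := by exact_mod_cast Nat.factorial_ne_zero _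
  simp only [map_mul, Complex.conj_I, Complex.conj_ofReal, zpow_natCast]
  push_cast
  field_simp
  linear_combination (-2 * (solidV (l + 1) 1 x : ℂ)) * Complex.I_sq

/-- The quotient `(l + 2)! / l! = (l + 1)(l + 2)` is the coefficient `dCoeff` for order `m + 1`. An
imaginary `α` gives the fields `Zplus`, a real one the fields `Zminus`. -/
theorem fieldCoord_succ (m l : ℕ) (α : ℂ) (x : E3) :
    fieldCoord (m + 1 + 1 + l) (m + 1) α x =
      l.factorial * (α * ((l + 1) * (l + 2)) *
        (solidU (m + 1 + 1 + l) m x - solidV (m + 1 + 1 + l) m x * Complex.I)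
      + conj α * (solidU (m + 1 + 1 + l) (m + 2) x
        + solidV (m + 1 + 1 + l) (m + 2) x * Complex.I)) := by
  rw [fieldCoord, show (1 - (m + 1 : ℕ) : ℤ) = -(m : ℤ) by push_cast; ring,
    show (1 + (m + 1 : ℕ) : ℤ) = ((m + 2 : ℕ) : ℤ) by push_cast; ring,
    factorialPair_eq (k := -(m : ℤ)) (a := l + 2) (b := 2 * m + 2 + l) (by omega) (by omega),
    factorialPair_eq (k := ((m + 2 : ℕ) : ℤ)) (a := 2 * m + 4 + l) (b := l) (by omega) (by omega),
    solidHarmonic_eq_solid (by omega)]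
  have h := solidHarmonic_neg_eq_solid (n := m + 1 + 1 + l) (by omega) m x
  rw [show m + 1 + 1 + l + m = 2 * m + 2 + l by ring] at h
  rw [show m + 1 + 1 + l + (m + 2) = 2 * m + 4 + l by ring]
  have h1 : (((2 * m + 2 + l).factorial : ℕ) : ℂ) ≠ 0 := by exact_mod_cast Nat.factorial_ne_zero _
  have h2 : (((2 * m + 4 + l).factorial : ℕ) : ℂ) ≠ 0 := by exact_mod_cast Nat.factorial_ne_zero _
  have hz : (-1 : ℂ) ^ (-(m : ℤ)) = (-1) ^ m := by
    rw [zpow_neg, zpow_natCast]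
    rcases neg_one_pow_eq_or ℂ m with h | h <;> simp [h]
  have hf : ((l + 2).factorial : ℂ) = (l + 2) * (l + 1) * l.factorial := by
    rw [Nat.factorial_succ, Nat.factorial_succ]
    push_cast
    ring
  rw [hz, show α * (-1) ^ m * (((l + 2).factorial : ℂ) * (2 * m + 2 + l).factorial) *
      solidHarmonic (m + 1 + 1 + l) (-m) x = α * (((l + 2).factorial : ℂ) *
      (2 * m + 2 + l).factorial) * ((-1) ^ m * solidHarmonic (m + 1 + 1 + l) (-m) x) by ring,
    h, hf]
  field_simp

theorem Z_eq (i : Index) : Z i = fieldOf (fieldCoord i.degree i.order i.amplitude) := by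
  ext1 x
  cases i with
  | zero n hn =>
    obtain ⟨l, rfl⟩ := Nat.exists_eq_add_of_le' hn
    have h := fieldCoord_zero l x
    simp only [Index.degree, Index.order, Index.amplitude, Nat.add_sub_cancel, fieldOf, Z, Zzero,
      h]
    simp
  | plus n m hm hmn =>
    obtain ⟨m, rfl⟩ := Nat.exists_eq_add_of_le' hm
    obtain ⟨l, rfl⟩ := Nat.exists_eq_add_of_le hmn
    have h1 : ((l.factorial : ℕ) : ℝ) ≠ 0 := by exact_mod_cast Nat.factorial_ne_zero _
    simp only [Index.degree, Index.order, Index.amplitude, fieldOf, Z, Zplus, dCoeff,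
      fieldCoord_succ, show m + 1 + 1 + l - (m + 1) - 1 = l by omega]
    ext j
    fin_cases j
    · rfl
    · simp
      field_simp
      ring
    · simp
      field_simp
      ring
  | minus n m hm hmn =>
    obtain ⟨m, rfl⟩ := Nat.exists_eq_add_of_le' hm
    obtain ⟨l, rfl⟩ := Nat.exists_eq_add_of_le hmn
    have h1 : ((l.factorial : ℕ) : ℝ) ≠ 0 := by exact_mod_cast Nat.factorial_ne_zero _
    simp only [Index.degree, Index.order, Index.amplitude, fieldOf, Z, Zminus, dCoeff,
      fieldCoord_succ, show m + 1 + 1 + l - (m + 1) - 1 = l by omega]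
    ext j
    fin_cases j
    · rfl
    · simp
      field_simp
      ring
    · simp
      field_simp
      ring

theorem memLp_Z (i : Index) : MemLp (Z i) 2 (volume.restrict unitBall) := by
  rw [Z_eq]
  exact memLp_unitBall (continuous_fieldOf (continuous_fieldCoord _ _ _))

theorem toLp_Z_mem_contragenic (i : Index) : (memLp_Z i).toLp (Z i) ∈ contragenic unitBall := by
  have h := memLp_Z i
  -- Stated for an arbitrary `f`, so that the equation for `Z i` can be substituted although the
  -- `MemLp` proof depends on it.
  have : ∀ (f : E3 → E3) (hf : MemLp f 2 (volume.restrict unitBall)), f = fieldOf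
      (fieldCoord i.degree i.order i.amplitude) → hf.toLp f ∈ contragenic unitBall := by
    rintro f hf rfl
    exact (isContragenicField_fieldCoord i.order_lt _).mem_contragenic hf
  exact this _ h (Z_eq i)

theorem inner_Z (i : Index) {l : ℕ} (h : i.degree = i.order + 1 + l) {F : L2 unitBall}
    (hF : F ∈ (interL2 (monogenic unitBall) unitBall ⊔
      interL2 (conjMonogenic unitBall) unitBall)ᗮ) :
    inner ℝ ((memLp_Z i).toLp (Z i)) F =
      fieldFactor i.order l * (conj i.amplitude * coeffC F i.degree (i.order - 1)).re := by
  have : ∀ (f : E3 → E3) (hf : MemLp f 2 (volume.restrict unitBall)), f = fieldOf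
      (fieldCoord i.degree i.order i.amplitude) → inner ℝ (hf.toLp f) F =
      fieldFactor i.order l * (conj i.amplitude * coeffC F i.degree (i.order - 1)).re := by
    rintro f hf rfl
    exact inner_fieldCoord h _ hf hF
  exact this _ _ (Z_eq i)

theorem inner_Z_Z (i j : Index) {l : ℕ} (h : i.degree = i.order + 1 + l) :
    inner ℝ ((memLp_Z i).toLp (Z i)) ((memLp_Z j).toLp (Z j)) =
      if j.degree = i.degree ∧ j.order = i.order then
      fieldFactor i.order l * (4 * Real.pi / ((2 * i.degree + 1) * (2 * i.degree + 3))) *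
        (conj i.amplitude * (j.amplitude - if i.order = 0 then conj j.amplitude else 0)).re
      else 0 := by
  have : ∀ (f g : E3 → E3) (hf : MemLp f 2 (volume.restrict unitBall))
      (hg : MemLp g 2 (volume.restrict unitBall)), f = fieldOf
      (fieldCoord i.degree i.order i.amplitude) → g = fieldOf
      (fieldCoord j.degree j.order j.amplitude) → inner ℝ (hf.toLp f) (hg.toLp g) =
      if j.degree = i.degree ∧ j.order = i.order then
      fieldFactor i.order l * (4 * Real.pi / ((2 * i.degree + 1) * (2 * i.degree + 3))) *
        (conj i.amplitude * (j.amplitude - if i.order = 0 then conj j.amplitude else 0)).re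
      else 0 := by
    rintro f g hf hg rfl rfl
    exact inner_fieldCoord_fieldCoord h j.order_lt _ _ hf hg
  exact this _ _ _ _ (Z_eq i) (Z_eq j)

/-- Only equal degree and order need an argument: for positive order one amplitude is imaginary and
the other real, so `Re (conj α α') = 0`. -/
theorem inner_Z_eq_zero {i j : Index} (hij : i ≠ j) :
    inner ℝ ((memLp_Z i).toLp (Z i)) ((memLp_Z j).toLp (Z j)) = 0 := by
  obtain ⟨l, hl⟩ := Nat.exists_eq_add_of_le i.order_lt
  rw [inner_Z_Z i j hl]
  split_ifs with h h0
  · obtain ⟨h1, h2⟩ := h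
    cases i <;> cases j <;> simp only [Index.order, Index.degree] at h0 h1 h2
    · exact absurd (by simp [h1]) hij
    all_goals omega
  · obtain ⟨h1, h2⟩ := h
    cases i <;> cases j <;> simp only [Index.order, Index.degree] at h0 h1 h2
    · exact absurd trivial h0
    · omega
    · omega
    · omega
    · subst h1 h2; exact absurd rfl hij
    · simp [Index.amplitude]
    · omega
    · simp [Index.amplitude]
    · subst h1 h2; exact absurd rfl hij
  · rfl

theorem norm_Z_zero (n : ℕ) (hn : 1 ≤ n) :
    ‖(memLp_Z (.zero n hn)).toLp (Z (.zero n hn))‖ =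
      Real.sqrt (4 * Real.pi * n * (n + 1) / ((2 * n + 1) * (2 * n + 3))) := by
  obtain ⟨l, rfl⟩ := Nat.exists_eq_add_of_le' hn
  rw [norm_eq_sqrt_real_inner, inner_Z_Z _ _ (l := l) (by simp [Index.degree, Index.order]; ring)]
  congr 1
  have h1 : ((l.factorial : ℕ) : ℝ) ≠ 0 := by exact_mod_cast Nat.factorial_ne_zero _
  have hf : ((l + 2).factorial : ℝ) = (l + 2) * (l + 1) * l.factorial := by
    rw [Nat.factorial_succ, Nat.factorial_succ]
    push_cast
    ring
  simp only [Index.degree, Index.order, Index.amplitude, fieldFactor, Nat.add_sub_cancel]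
  simp [add_comm 2 l, hf]
  field_simp
  ring

/-- With degree `n` and order `M = m + 1`, dividing `fieldFactor` by `(l!)²` leaves
`(n+M-1)!/(n-M-1)!` times `(n-M)(n-M+1) + (n+M)(n+M+1) = 2 (n² + M² + n)`. -/
theorem norm_sq_of_amplitude {m l : ℕ} {a : ℝ} (ha : a = ((l.factorial : ℕ) : ℝ)⁻¹) :
    fieldFactor (m + 1) l * (4 * Real.pi / ((2 * ((m + 1 + 1 + l : ℕ) : ℝ) + 1) *
      (2 * ((m + 1 + 1 + l : ℕ) : ℝ) + 3))) * (a * a) =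
    8 * Real.pi * (((m + 1 + 1 + l : ℕ) : ℝ) ^ 2 + ((m + 1 : ℕ) : ℝ) ^ 2 + (m + 1 + 1 + l : ℕ)) *
      (((m + 1 + 1 + l) + (m + 1) - 1).factorial : ℝ) /
      ((2 * ((m + 1 + 1 + l : ℕ) : ℝ) + 1) * (2 * ((m + 1 + 1 + l : ℕ) : ℝ) + 3) *
      (((m + 1 + 1 + l) - (m + 1) - 1).factorial : ℝ)) := by
  have h1 : ((l.factorial : ℕ) : ℝ) ≠ 0 := by exact_mod_cast Nat.factorial_ne_zero _
  have hf (l : ℕ) : ((l + 2).factorial : ℝ) = (l + 2) * (l + 1) * l.factorial := by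
    rw [Nat.factorial_succ, Nat.factorial_succ]
    push_cast
    ring
  rw [show (m + 1 + 1 + l) - (m + 1) - 1 = l by omega,
    show (m + 1 + 1 + l) + (m + 1) - 1 = 2 * m + 2 + l by omega, fieldFactor, ha,
    show 2 * (m + 1) + 2 + l = 2 * m + 2 + l + 2 by ring, show 2 * (m + 1) + l = 2 * m + 2 + l by ring]
  push_cast [hf]
  field_simp
  ring

theorem norm_Z_plus (n m : ℕ) (hm : 1 ≤ m) (hmn : m + 1 ≤ n) :
    ‖(memLp_Z (.plus n m hm hmn)).toLp (Z (.plus n m hm hmn))‖ =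
      Real.sqrt (8 * Real.pi * ((n : ℝ) ^ 2 + (m : ℝ) ^ 2 + n) * ((n + m - 1).factorial : ℝ) /
        ((2 * n + 1) * (2 * n + 3) * ((n - m - 1).factorial : ℝ))) := by
  obtain ⟨m, rfl⟩ := Nat.exists_eq_add_of_le' hm
  obtain ⟨l, rfl⟩ := Nat.exists_eq_add_of_le hmn
  rw [norm_eq_sqrt_real_inner, inner_Z_Z _ _ (l := l) rfl, if_pos ⟨rfl, rfl⟩,
    ← norm_sq_of_amplitude rfl]
  congr 1
  simp [Index.degree, Index.order, Index.amplitude, show m + 1 + 1 + l - (m + 1) - 1 = l by omega]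

theorem norm_Z_minus (n m : ℕ) (hm : 1 ≤ m) (hmn : m + 1 ≤ n) :
    ‖(memLp_Z (.minus n m hm hmn)).toLp (Z (.minus n m hm hmn))‖ =
      Real.sqrt (8 * Real.pi * ((n : ℝ) ^ 2 + (m : ℝ) ^ 2 + n) * ((n + m - 1).factorial : ℝ) /
        ((2 * n + 1) * (2 * n + 3) * ((n - m - 1).factorial : ℝ))) := by
  obtain ⟨m, rfl⟩ := Nat.exists_eq_add_of_le' hm
  obtain ⟨l, rfl⟩ := Nat.exists_eq_add_of_le hmn
  rw [norm_eq_sqrt_real_inner, inner_Z_Z _ _ (l := l) rfl, if_pos ⟨rfl, rfl⟩,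
    ← norm_sq_of_amplitude rfl]
  congr 1
  simp [Index.degree, Index.order, Index.amplitude, show m + 1 + 1 + l - (m + 1) - 1 = l by omega]

theorem toLp_Z_ne_zero (i : Index) : (memLp_Z i).toLp (Z i) ≠ 0 := by
  rw [← norm_pos_iff]
  have := Real.pi_pos
  cases i with
  | zero n hn =>
    rw [norm_Z_zero]
    positivity
  | plus n m hm hmn =>
    rw [norm_Z_plus]
    positivity
  | minus n m hm hmn =>
    rw [norm_Z_minus]
    positivity

/-! ### Completeness of the family -/

/-- The moments of an element orthogonal to the family, to the monogenic functions and to their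
conjugates vanish. -/
theorem coeffC_eq_zero {F : L2 unitBall}
    (hF : F ∈ (interL2 (monogenic unitBall) unitBall ⊔
      interL2 (conjMonogenic unitBall) unitBall)ᗮ)
    (hZ : ∀ i, inner ℝ ((memLp_Z i).toLp (Z i)) F = 0) (n : ℕ) (k : ℤ) : coeffC F n k = 0 := by
  have hre (i : Index) : (conj i.amplitude * coeffC F i.degree (i.order - 1)).re = 0 := by
    obtain ⟨l, hl⟩ := Nat.exists_eq_add_of_le i.order_lt
    have h := hZ i
    rw [inner_Z i hl hF] at h
    exact (mul_eq_zero.1 h).resolve_left (by exact_mod_cast (fieldFactor_pos _ _).ne')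
  have hbig (k : ℤ) (hk : n < k.natAbs) : coeffC F n k = 0 ∧ coeffD F n k = 0 := by
    simp [coeffC, coeffD, coeff_eq_zero F _ hk]
  have hrel (j : ℤ) := (coeff_of_mem_orthogonal hF n j).2
  -- The amplitudes of `plus` and `minus` detect the imaginary and the real part.
  have hmid (m : ℕ) (hm : 1 ≤ m) (hmn : m + 1 ≤ n) : coeffC F n (m - 1) = 0 := by
    have h0 : (((n - m - 1).factorial : ℕ) : ℝ) ≠ 0 := by exact_mod_cast Nat.factorial_ne_zero _
    have h1 := hre (.plus n m hm hmn)
    have h2 := hre (.minus n m hm hmn)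
    simp only [Index.amplitude, Index.degree, Index.order] at h1 h2
    simp [Nat.factorial_ne_zero] at h1 h2
    exact Complex.ext h2 h1
  -- The fixed point of `k ↦ -k - 2`: the relation makes the moment imaginary, and `Zzero` detects
  -- its imaginary part.
  have hneg : coeffC F n (-1) = 0 := by
    rcases Nat.eq_zero_or_pos n with rfl | hn
    · exact (hbig _ (by norm_num)).1
    · have h1 := hre (.zero n hn)
      simp only [Index.amplitude, Index.degree, Index.order] at h1
      simp [Nat.factorial_ne_zero] at h1
      have h2 := hrel 0
      rw [coeffD_eq_conj] at h2
      norm_num at h2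
      have h3 := congrArg Complex.re h2
      simp at h3
      exact Complex.ext (by simp; linarith) h1
  rcases lt_or_ge n k.natAbs with h | h
  · exact (hbig k h).1
  rcases le_or_gt 0 k with h0 | h0
  · by_cases hk : k + 2 ≤ n
    · have := hmid (k + 1).toNat (by omega) (by omega)
      rwa [show (((k + 1).toNat : ℕ) : ℤ) - 1 = k by omega] at this
    -- Here the partner order exceeds the degree, so its moment is zero.
    · have := hrel (k + 1)
      rw [add_sub_cancel_right] at this
      rw [this, (hbig (k + 1 + 1) (by omega)).2]
  · by_cases hk : k = -1
    · rw [hk, hneg]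
    -- For `k ≤ -2` the partner `-k - 2` is in the range already treated.
    · have h1 := hmid (-k - 1).toNat (by omega) (by omega)
      have h2 := hrel (-k - 1)
      rw [show (((-k - 1).toNat : ℕ) : ℤ) - 1 = -k - 1 - 1 by omega] at h1
      rw [h1, sub_add_cancel, coeffD_eq_conj, neg_neg] at h2
      have h3 := (mul_eq_zero.1 h2.symm).resolve_left (zpow_ne_zero _ (by norm_num))
      simpa using h3

theorem eq_zero_of_orthogonal {F : L2 unitBall} (hF : F ∈ weaklyHarmonic)
    (hM : F ∈ (interL2 (monogenic unitBall) unitBall ⊔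
      interL2 (conjMonogenic unitBall) unitBall)ᗮ)
    (hZ : ∀ i, inner ℝ ((memLp_Z i).toLp (Z i)) F = 0) : F = 0 := by
  refine eq_zero_of_coeff hF fun i n k => ?_
  have hC := coeffC_eq_zero hM hZ n k
  have hD : coeffD F n k = 0 := by
    rw [coeffD_eq_conj, coeffC_eq_zero hM hZ, map_zero, mul_zero]
  rw [coeffC] at hC
  rw [coeffD] at hD
  fin_cases i
  · exact (coeff_of_mem_orthogonal hM n k).1
  · change coeff F 1 n k = 0
    linear_combination (1 / 2 : ℂ) * hC + (1 / 2 : ℂ) * hD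
  · change coeff F 2 n k = 0
    linear_combination (-Complex.I / 2) * hC + (Complex.I / 2) * hD
      + coeff F 2 n k * Complex.I_sq

/-- The difference between `F` and its projection onto the closed span is orthogonal to the family.
It remains weakly harmonic and orthogonal to the monogenic functions and their conjugates because
both conditions are closed, so all its moments vanish. -/
theorem contragenic_le_closure : contragenic unitBall ≤
    (Submodule.span ℝ (Set.range fun i => (memLp_Z i).toLp (Z i))).topologicalClosure := by
  set K := (Submodule.span ℝ (Set.range fun i => (memLp_Z i).toLp (Z i))).topologicalClosure
  have hle : Submodule.span ℝ (Set.range fun i => (memLp_Z i).toLp (Z i)) ≤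
      contragenic unitBall := Submodule.span_le.2 (by
    rintro _ ⟨i, rfl⟩
    exact toLp_Z_mem_contragenic i)
  have h1 : K ≤ weaklyHarmonic := Submodule.topologicalClosure_minimal _
    (hle.trans (inf_le_left.trans interL2_harmonic_le)) isClosed_weaklyHarmonic
  have h2 : K ≤ _ := Submodule.topologicalClosure_minimal _ (hle.trans inf_le_right)
    (Submodule.isClosed_orthogonal _)
  have : CompleteSpace K := (Submodule.isClosed_topologicalClosure _).completeSpace_coe
  intro F hF
  have hP := K.starProjection_apply_mem F
  have h0 : F - K.starProjection F = 0 := by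
    refine eq_zero_of_orthogonal (sub_mem (interL2_harmonic_le hF.1) (h1 hP))
      (sub_mem hF.2 (h2 hP)) fun i => ?_
    exact K.sub_starProjection_mem_orthogonal F _
      (Submodule.le_topologicalClosure _ (Submodule.subset_span ⟨i, rfl⟩))
  rw [sub_eq_zero.1 h0]
  exact hP

end Basis

end Contragenic

end

theorem mainTheorem3 :
    (∀ i : Contragenic.Index, Contragenic.Z i ∈ Contragenic.harmonic Contragenic.unitBall) ∧
    ∃ hZ : ∀ i : Contragenic.Index,
        MemLp (Contragenic.Z i) 2 (volume.restrict Contragenic.unitBall),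
      Contragenic.IsOrthogonalBasis
        (fun i => ((hZ i).toLp (Contragenic.Z i) : Contragenic.L2 Contragenic.unitBall))
        (Contragenic.contragenic Contragenic.unitBall) ∧
      (∀ (n : ℕ) (hn : 1 ≤ n),
        ‖(hZ (.zero n hn)).toLp (Contragenic.Z (.zero n hn))‖ =
          Real.sqrt (4 * Real.pi * n * (n + 1) / ((2 * n + 1) * (2 * n + 3)))) ∧
      (∀ (n m : ℕ) (hm : 1 ≤ m) (hmn : m + 1 ≤ n),
        ‖(hZ (.plus n m hm hmn)).toLp (Contragenic.Z (.plus n m hm hmn))‖ =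
          Real.sqrt (8 * Real.pi * ((n : ℝ) ^ 2 + (m : ℝ) ^ 2 + n) * ((n + m - 1).factorial : ℝ) /
            ((2 * n + 1) * (2 * n + 3) * ((n - m - 1).factorial : ℝ))) ∧
        ‖(hZ (.minus n m hm hmn)).toLp (Contragenic.Z (.minus n m hm hmn))‖ =
          Real.sqrt (8 * Real.pi * ((n : ℝ) ^ 2 + (m : ℝ) ^ 2 + n) * ((n + m - 1).factorial : ℝ) /
            ((2 * n + 1) * (2 * n + 3) * ((n - m - 1).factorial : ℝ)))) := by
  refine ⟨fun i => ?_, Contragenic.memLp_Z,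
    ⟨Contragenic.toLp_Z_mem_contragenic, Contragenic.toLp_Z_ne_zero,
      fun _ _ => Contragenic.inner_Z_eq_zero, Contragenic.contragenic_le_closure⟩,
    Contragenic.norm_Z_zero, fun n m hm hmn =>
      ⟨Contragenic.norm_Z_plus n m hm hmn, Contragenic.norm_Z_minus n m hm hmn⟩⟩
  rw [Contragenic.Z_eq]
  exact Contragenic.fieldOf_mem_harmonic
    (Contragenic.isContragenicField_fieldCoord i.order_lt _).mem _
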